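/- Let $d\ge 0$, $T>0$, $\varepsilon>0$, let $\mathbb T^d=\mathbb R^d/\mathbb Z^d$ be the flat torus, $U\subset\mathbb R$ open, $f_1,\dots,f_d\in C^2(U)$, $A\in C^2(U)$, and let $(\eta,q)$ be a strictly convex entropy/entropy-flux pair, i.e. $\eta\in C^2(U)$ is strictly convex, $q_\alpha\in C^1(U)$ and $q_\alpha'=\eta' f_\alpha'$ on $U$ (for instance $\eta(u)=\tfrac12u^2$). $H^1(\mathbb T^d)$ carries the norm $\|v\|_{H^1}^2=\|v\|_{L^2}^2+\|\nabla v\|_{L^2}^2$, $|v|_{H^1}=\|\nabla v\|_{L^2}$, and $H^{-1}(\mathbb T^d)$ is the dual of $H^1(\mathbb T^d)$ with the dual norm. Let $u\in L^2(0,T;H^1(\mathbb T^d))\cap L^\infty((0,T)\times\mathbb T^d)$ be an entropy weak solution (with respect to $(\eta,q)$) of $$\partial_t u+\sum_{\alpha=1}^d\partial_{x_\alpha}f_\alpha(u)=\varepsilon\sum_{\alpha=1}^d\partial_{x_\alpha}\bigl(A(u)\,\partial_{x_\alpha}u\bigr)\quad\text{on }(0,T)\times\mathbb T^d$$ with initial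 data $u_0\in H^1(\mathbb T^d)$. This means that $u$ takes values in $U$ a.e., $\varepsilon A(u)\partial_{x_\alpha}u\in L^1$ for each $\alpha$, for all $\phi\in C_0^\infty([0,T)\times\mathbb T^d)$ $$\int_0^T\!\!\int_{\mathbb T^d}\partial_t\phi\,u+\sum_\alpha\partial_{x_\alpha}\phi\,\bigl(f_\alpha(u)-\varepsilon A(u)\partial_{x_\alpha}u\bigr)\,dx\,dt+\int_{\mathbb T^d}u_0\,\phi(0,\cdot)\,dx=0,$$ $\varepsilon\sum_\alpha\partial_{x_\alpha}(\eta'(u))A(u)\partial_{x_\alpha}u\in W^{-1,1}((0,T)\times\mathbb T^d)$, and for all non-negative $\Phi\in C_0^\infty([0,T)\times\mathbb T^d)$ $$\int_0^T\!\!\int_{\mathbb T^d}\partial_t\Phi\,\eta(u)+\sum_\alpha\partial_{x_\alpha}\Phi\,\bigl(q_\alpha(u)-\varepsilon\eta'(u)A(u)\partial_{x_\alpha}u\bigr)-\varepsilon\,\Phi\sum_\alpha\partial_{x_\alpha}(\eta'(u))A(u)\partial_{x_\alpha}u\,dx\,dt+\int_{\mathbb T^d}\Phi(0,\cdot)\,\eta(u_0)\,dx\ge0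 .$$ Let $\hat u\in W^{1,\infty}((0,T)\times\mathbb T^d)$ be a Lipschitz continuous weak solution, with initial data $\hat u(0,\cdot)$, of the perturbed equation $$\partial_t\hat u+\sum_{\alpha=1}^d\partial_{x_\alpha}f_\alpha(\hat u)=\varepsilon\sum_{\alpha=1}^d\partial_{x_\alpha}\bigl(A(\hat u)\,\partial_{x_\alpha}\hat u\bigr)+r,\qquad r=r_1+\varepsilon r_2,$$ where $r_1\in L^1(0,T;L^2(\mathbb T^d))$, $r_2\in L^2(0,T;H^{-1}(\mathbb T^d))$ and $r_2$ has zero mean, i.e. $\langle r_2(t),1\rangle=0$ for almost every $t\in(0,T)$ (as is the case when $r_2$ is a spatial divergence). The weak formulation is the one above, with $\int_0^T\!\int_{\mathbb T^d} r_1\phi\,dx\,dt+\varepsilon\int_0^T\langle r_2,\phi\rangle\,dt$ added to its left-hand side. Assume that there is a compact set $K\subset U$ with $u,\hat u\in K$ a.e. on $(0,T)\times\mathbb T^d$ and $\inf_{z\in K}A(z)=1$. Put $$\Lambda:=2\sum_{\alpha=1}^d\sup_{z\in K}|f_\alpha''(z)|\,\|\partial_{x_\alpha}\hat u\|_{L^\infty((0,T)\times\mathbb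 T^d)}+2\varepsilon\sup_{z\in K}|A'(z)|^2\,\|\nabla\hat u\|_{L^\infty((0,T)\times\mathbb T^d)}^2 .$$ Then, for almost all $t\in(0,T]$, $$\|u-\hat u\|_{L^\infty(0,t;L^2(\mathbb T^d))}^2+\varepsilon\,|u-\hat u|_{L^2(0,t;H^1(\mathbb T^d))}^2\le\Bigl(4\|u_0-\hat u(0)\|_{L^2(\mathbb T^d)}^2+16\|r_1\|_{L^1(0,t;L^2(\mathbb T^d))}^2+8\varepsilon\|r_2\|_{L^2(0,t;H^{-1}(\mathbb T^d))}^2\Bigr)e^{2\Lambda t}.$$ -/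

import Mathlib

open MeasureTheory Set
open scoped ENNReal

noncomputable section

namespace ScalarCD

/-! ### Calculus on the flat torus -/

/-- The flat torus `ℝ^d / ℤ^d`, with its Lebesgue measure `volume` of total mass one. -/
abbrev Td (d : ℕ) : Type := UnitAddTorus (Fin d)

/-- The covering map `ℝ^d → ℝ^d / ℤ^d`. -/
def toTd {d : ℕ} (y : Fin d → ℝ) : Td d := fun i => (y i : UnitAddCircle)

/-- Smooth functions on the torus: those whose periodic lift to `ℝ^d` is smooth. -/
def IsSmooth {d : ℕ} (ψ : Td d → ℝ) : Prop :=
  ContDiff ℝ ((⊤ : ℕ∞) : WithTop ℕ∞) (fun y : Fin d → ℝ => ψ (toTd y))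

/-- The classical partial derivative in the `i`-th coordinate direction of the torus. -/
def pd {d : ℕ} (i : Fin d) (ψ : Td d → ℝ) (x : Td d) : ℝ :=
  deriv (fun s : ℝ => ψ (x + Pi.single i (s : UnitAddCircle))) 0

/-- The classical gradient on the torus. -/
def grad {d : ℕ} (ψ : Td d → ℝ) (x : Td d) : EuclideanSpace ℝ (Fin d) :=
  WithLp.toLp 2 (fun i => pd i ψ x)

/-- `g` is the weak gradient of `v` on the torus. -/
def HasWeakGrad {d : ℕ} (v : Td d → ℝ) (g : Td d → EuclideanSpace ℝ (Fin d)) : Prop :=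
  Integrable v ∧ Integrable g ∧
    ∀ ψ : Td d → ℝ, IsSmooth ψ → ∀ i : Fin d,
      ∫ x, v x * pd i ψ x = - ∫ x, g x i * ψ x

section Smooth

variable {d : ℕ}

lemma toTd_surjective : Function.Surjective (toTd (d := d)) := by
  intro x
  choose y hy using fun i => QuotientAddGroup.mk_surjective (x i)
  exact ⟨y, funext hy⟩

lemma isOpenQuotientMap_toTd : IsOpenQuotientMap (toTd (d := d)) := by
  have h : IsOpenQuotientMap (Pi.map (fun (_ : Fin d) (s : ℝ) => (s : UnitAddCircle))) :=
    IsOpenQuotientMap.piMap (fun _ => QuotientAddGroup.isOpenQuotientMap_mk)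
  exact h

lemma toTd_add_single (y : Fin d → ℝ) (i : Fin d) (s : ℝ) :
    toTd y + Pi.single i (s : UnitAddCircle) = toTd (y + s • Pi.single i 1) := by
  funext j
  by_cases h : j = i
  · subst h; simp [toTd]
  · simp [toTd, h]

lemma IsSmooth.hasDerivAt {ψ : Td d → ℝ} (hψ : IsSmooth ψ) (i : Fin d) (x : Td d) (s : ℝ) :
    HasDerivAt (fun s : ℝ => ψ (x + Pi.single i (s : UnitAddCircle)))
      (pd i ψ (x + Pi.single i (s : UnitAddCircle))) s := by
  obtain ⟨y, rfl⟩ := toTd_surjective x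
  have key : ∀ z : Fin d → ℝ, ∀ s : ℝ, HasDerivAt
      (fun s : ℝ => ψ (toTd z + Pi.single i (s : UnitAddCircle)))
      (fderiv ℝ (fun y => ψ (toTd y)) (z + s • Pi.single i 1) (Pi.single i 1)) s := by
    intro z s
    simp only [toTd_add_single]
    have h1 : HasFDerivAt (fun y => ψ (toTd y))
        (fderiv ℝ (fun y => ψ (toTd y)) (z + s • Pi.single i 1)) (z + s • Pi.single i 1) :=
      ((hψ.differentiable (by simp)) _).hasFDerivAt
    have h2 : HasDerivAt (fun s : ℝ => z + s • (Pi.single i 1 : Fin d → ℝ)) (Pi.single i 1) s := by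
      simpa using ((hasDerivAt_id s).smul_const (Pi.single i 1 : Fin d → ℝ)).const_add z
    exact h1.comp_hasDerivAt s h2
  have e : pd i ψ (toTd y + Pi.single i (s : UnitAddCircle)) =
      fderiv ℝ (fun y => ψ (toTd y)) (y + s • Pi.single i 1) (Pi.single i 1) := by
    rw [toTd_add_single, pd, (key _ 0).deriv]
    simp
  rw [e]
  exact key y s

lemma IsSmooth.continuous {ψ : Td d → ℝ} (hψ : IsSmooth ψ) : Continuous ψ :=
  isOpenQuotientMap_toTd.isQuotientMap.continuous_iff.2 (ContDiff.continuous hψ)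

lemma IsSmooth.pd_toTd {ψ : Td d → ℝ} (hψ : IsSmooth ψ) (i : Fin d) (y : Fin d → ℝ) :
    pd i ψ (toTd y) = fderiv ℝ (fun y => ψ (toTd y)) y (Pi.single i 1) := by
  have h1 : HasFDerivAt (fun y => ψ (toTd y)) (fderiv ℝ (fun y => ψ (toTd y)) y)
      (y + (0 : ℝ) • Pi.single i 1) := by
    simpa using ((hψ.differentiable (by simp)) y).hasFDerivAt
  have h2 : HasDerivAt (fun s : ℝ => y + s • (Pi.single i 1 : Fin d → ℝ))
      (Pi.single i 1) 0 := by
    simpa using ((hasDerivAt_id (0 : ℝ)).smul_const (Pi.single i 1 : Fin d → ℝ)).const_add y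
  have h3 := (h1.comp_hasDerivAt (0 : ℝ) h2).deriv
  rw [← h3, pd]
  simp only [toTd_add_single]
  rfl

lemma IsSmooth.continuous_pd {ψ : Td d → ℝ} (hψ : IsSmooth ψ) (i : Fin d) :
    Continuous (pd i ψ) := by
  refine isOpenQuotientMap_toTd.isQuotientMap.continuous_iff.2 ?_
  have h : pd i ψ ∘ toTd = fun y => fderiv ℝ (fun y => ψ (toTd y)) y (Pi.single i 1) :=
    funext (hψ.pd_toTd i)
  rw [h]
  exact (ContDiff.continuous_fderiv hψ (by simp)).clm_apply continuous_const

lemma IsSmooth.mul {ψ χ : Td d → ℝ} (hψ : IsSmooth ψ) (hχ : IsSmooth χ) :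
    IsSmooth (fun x => ψ x * χ x) := ContDiff.mul hψ hχ

lemma IsSmooth.pd_mul {ψ χ : Td d → ℝ} (hψ : IsSmooth ψ) (hχ : IsSmooth χ) (i : Fin d)
    (x : Td d) : pd i (fun x => ψ x * χ x) x = pd i ψ x * χ x + ψ x * pd i χ x := by
  have h := (((hψ.hasDerivAt i x 0).mul (hχ.hasDerivAt i x 0)).deriv)
  simp only [AddCircle.coe_zero, Pi.single_zero, add_zero] at h
  exact h

lemma integrable_of_continuous {E : Type*} [NormedAddCommGroup E] {v : Td d → E}
    (hv : Continuous v) : Integrable v :=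
  hv.integrable_of_hasCompactSupport (HasCompactSupport.of_compactSpace v)

lemma hasDerivAt_integral_of_bound {X : Type*} [MeasurableSpace X] {μ : Measure X}
    {F F' : ℝ → X → ℝ} {C : ℝ} (hF : ∀ s, AEStronglyMeasurable (F s) μ)
    (hi : Integrable (F 0) μ) (hF' : AEStronglyMeasurable (F' 0) μ)
    (hb : ∀ x s, ‖F' s x‖ ≤ C) (hbi : Integrable (fun _ : X => C) μ)
    (hd : ∀ x s, HasDerivAt (fun s => F s x) (F' s x) s) :
    HasDerivAt (fun s => ∫ x, F s x ∂μ) (∫ x, F' 0 x ∂μ) 0 :=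
  (hasDerivAt_integral_of_dominated_loc_of_deriv_le (s := univ) (bound := fun _ => C)
    Filter.univ_mem (Filter.Eventually.of_forall hF) hi hF'
    (Filter.Eventually.of_forall fun x s _ => hb x s) hbi
    (Filter.Eventually.of_forall fun x s _ => hd x s)).2

lemma IsSmooth.integral_pd {ψ : Td d → ℝ} (hψ : IsSmooth ψ) (i : Fin d) :
    ∫ x, pd i ψ x = 0 := by
  obtain ⟨C, hC⟩ := (isCompact_univ (X := Td d)).exists_bound_of_continuousOn
    (hψ.continuous_pd i).continuousOn
  have ht : ∀ s : ℝ, Continuous (fun x : Td d => x + Pi.single i (s : UnitAddCircle)) :=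
    fun s => continuous_id.add continuous_const
  have m1 : ∀ s : ℝ, Continuous (fun x : Td d => ψ (x + Pi.single i (s : UnitAddCircle))) :=
    fun s => hψ.continuous.comp (ht s)
  have m2 : Continuous (fun x : Td d => pd i ψ (x + Pi.single i ((0 : ℝ) : UnitAddCircle))) :=
    (hψ.continuous_pd i).comp (ht 0)
  have h2 : HasDerivAt (fun s : ℝ => ∫ x : Td d, ψ (x + Pi.single i (s : UnitAddCircle)))
      (∫ x : Td d, pd i ψ (x + Pi.single i ((0 : ℝ) : UnitAddCircle))) 0 := by
    refine hasDerivAt_integral_of_bound (μ := (volume : Measure (Td d))) (C := C)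
      (F := fun (s : ℝ) (x : Td d) => ψ (x + Pi.single i (s : UnitAddCircle)))
      (F' := fun (s : ℝ) (x : Td d) => pd i ψ (x + Pi.single i (s : UnitAddCircle)))
      ?_ ?_ ?_ ?_ ?_ ?_
    · intro s
      exact (m1 s).aestronglyMeasurable
    · exact integrable_of_continuous (m1 0)
    · exact m2.aestronglyMeasurable
    · intro x s
      exact hC _ (mem_univ _)
    · exact integrable_of_continuous continuous_const
    · intro x s
      exact hψ.hasDerivAt i x s
  have c1 : (fun s : ℝ => ∫ x : Td d, ψ (x + Pi.single i (s : UnitAddCircle)))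
      = fun _ => ∫ x, ψ x := funext fun s => integral_add_right_eq_self ψ _
  have c2 : (fun x : Td d => pd i ψ (x + Pi.single i ((0 : ℝ) : UnitAddCircle))) = pd i ψ := by
    funext x
    rw [AddCircle.coe_zero, Pi.single_zero, add_zero]
  rw [c1, c2] at h2
  exact h2.unique (hasDerivAt_const _ _)

lemma continuous_grad {ψ : Td d → ℝ} (hψ : IsSmooth ψ) : Continuous (grad ψ) :=
  (PiLp.continuous_toLp 2 _).comp (continuous_pi fun i => hψ.continuous_pd i)

/-- For a smooth function the classical gradient is the weak gradient. -/
lemma IsSmooth.hasWeakGrad {ψ : Td d → ℝ} (hψ : IsSmooth ψ) : HasWeakGrad ψ (grad ψ) := by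
  refine ⟨integrable_of_continuous hψ.continuous,
    integrable_of_continuous (continuous_grad hψ), fun χ hχ i => ?_⟩
  have h := (hψ.mul hχ).integral_pd i
  simp only [hψ.pd_mul hχ] at h
  have h' := integral_add (integrable_of_continuous ((hψ.continuous_pd i).mul hχ.continuous))
    (integrable_of_continuous (hψ.continuous.mul (hχ.continuous_pd i)))
  simp only [Pi.mul_apply] at h'
  rw [h'] at h
  simp only [grad]
  linarith

lemma memLp_of_continuous {E : Type*} [NormedAddCommGroup E] {v : Td d → E}
    (hv : Continuous v) : MemLp v 2 :=
  hv.memLp_of_hasCompactSupport (HasCompactSupport.of_compactSpace v)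

end Smooth

/-! ### The spaces `H¹(𝕋^d)` and `H⁻¹(𝕋^d)` -/

/-- `H¹(𝕋^d)`, as the space of pairs `(v, ∇v)` in `L² × L²`; its norm is the standard one,
`‖v‖²_{H¹} = ‖v‖²_{L²} + ‖∇v‖²_{L²}`. -/
def H1 (d : ℕ) : Submodule ℝ (WithLp 2
    (Lp ℝ 2 (volume : Measure (Td d)) × Lp (EuclideanSpace ℝ (Fin d)) 2
      (volume : Measure (Td d)))) where
  carrier := {p | HasWeakGrad (p.fst : Td d → ℝ) (p.snd : Td d → EuclideanSpace ℝ (Fin d))}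
  zero_mem' := by
    have h1 := Lp.coeFn_zero ℝ 2 (volume : Measure (Td d))
    have h2 := Lp.coeFn_zero (EuclideanSpace ℝ (Fin d)) 2 (volume : Measure (Td d))
    refine ⟨(integrable_congr h1).2 (integrable_zero _ _ _),
      (integrable_congr h2).2 (integrable_zero _ _ _), fun ψ hψ i => ?_⟩
    have e1 : ∫ x, ((0 : Lp ℝ 2 (volume : Measure (Td d))) : Td d → ℝ) x * pd i ψ x = 0 := by
      rw [integral_congr_ae (g := fun _ => (0 : ℝ))
        (by filter_upwards [h1] with x hx; rw [hx]; simp)]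
      simp
    have e2 : ∫ x, ((0 : Lp (EuclideanSpace ℝ (Fin d)) 2 (volume : Measure (Td d))) :
        Td d → EuclideanSpace ℝ (Fin d)) x i * ψ x = 0 := by
      rw [integral_congr_ae (g := fun _ => (0 : ℝ))
        (by filter_upwards [h2] with x hx; rw [hx]; simp)]
      simp
    exact e1.trans (by rw [← neg_zero, ← e2]; rfl)
  add_mem' := by
    rintro p q ⟨hp1, hp2, hp⟩ ⟨hq1, hq2, hq⟩
    have h1 := Lp.coeFn_add p.fst q.fst
    have h2 := Lp.coeFn_add p.snd q.snd
    refine ⟨(integrable_congr h1).2 (hp1.add hq1), (integrable_congr h2).2 (hp2.add hq2),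
      fun ψ hψ i => ?_⟩
    obtain ⟨C, hC⟩ := (isCompact_univ (X := Td d)).exists_bound_of_continuousOn
      (hψ.continuous_pd i).continuousOn
    obtain ⟨C', hC'⟩ := (isCompact_univ (X := Td d)).exists_bound_of_continuousOn
      hψ.continuous.continuousOn
    have b1 : ∀ v : Td d → ℝ, Integrable v → Integrable (fun x => v x * pd i ψ x) :=
      fun v hv => hv.mul_bdd (c := C) (hψ.continuous_pd i).aestronglyMeasurable
        (Filter.Eventually.of_forall fun x => hC x (mem_univ x))
    have b2 : ∀ g : Td d → EuclideanSpace ℝ (Fin d), Integrable g →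
        Integrable (fun x => g x i * ψ x) :=
      fun g hg => ((EuclideanSpace.proj (𝕜 := ℝ) i).integrable_comp hg).mul_bdd (c := C')
        hψ.continuous.aestronglyMeasurable
        (Filter.Eventually.of_forall fun x => hC' x (mem_univ x))
    have e1 : ∫ x, ((p.fst + q.fst : Lp ℝ 2 (volume : Measure (Td d))) : Td d → ℝ) x * pd i ψ x
        = ∫ x, (p.fst x * pd i ψ x + q.fst x * pd i ψ x) := by
      refine integral_congr_ae ?_
      filter_upwards [h1] with x hx
      rw [hx, Pi.add_apply]
      exact add_mul _ _ _
    have e2 : ∫ x, ((p.snd + q.snd : Lp (EuclideanSpace ℝ (Fin d)) 2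
          (volume : Measure (Td d))) : Td d → EuclideanSpace ℝ (Fin d)) x i * ψ x
        = ∫ x, (p.snd x i * ψ x + q.snd x i * ψ x) := by
      refine integral_congr_ae ?_
      filter_upwards [h2] with x hx
      rw [hx, Pi.add_apply]
      exact add_mul _ _ _
    rw [integral_add (b1 _ hp1) (b1 _ hq1), hp ψ hψ i, hq ψ hψ i] at e1
    rw [integral_add (b2 _ hp2) (b2 _ hq2)] at e2
    refine e1.trans ?_
    refine Eq.trans ?_ (congrArg Neg.neg e2.symm)
    ring
  smul_mem' := by
    rintro c p ⟨hp1, hp2, hp⟩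
    have h1 := Lp.coeFn_smul c p.fst
    have h2 := Lp.coeFn_smul c p.snd
    refine ⟨(integrable_congr h1).2 (hp1.smul c), (integrable_congr h2).2 (hp2.smul c),
      fun ψ hψ i => ?_⟩
    have e1 : ∫ x, ((c • p.fst : Lp ℝ 2 (volume : Measure (Td d))) : Td d → ℝ) x * pd i ψ x
        = ∫ x, c * (p.fst x * pd i ψ x) := by
      refine integral_congr_ae ?_
      filter_upwards [h1] with x hx
      simp [hx, mul_assoc]
    have e2 : ∫ x, ((c • p.snd : Lp (EuclideanSpace ℝ (Fin d)) 2
          (volume : Measure (Td d))) : Td d → EuclideanSpace ℝ (Fin d)) x i * ψ x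
        = ∫ x, c * (p.snd x i * ψ x) := by
      refine integral_congr_ae ?_
      filter_upwards [h2] with x hx
      simp [hx, mul_assoc]
    rw [integral_const_mul, hp ψ hψ i] at e1
    rw [integral_const_mul] at e2
    refine e1.trans ?_
    refine Eq.trans ?_ (congrArg Neg.neg e2.symm)
    ring

/-- The element of `H¹(𝕋^d)` given by a smooth function. -/
def H1.ofSmooth {d : ℕ} (ψ : Td d → ℝ) (hψ : IsSmooth ψ) : H1 d :=
  ⟨WithLp.toLp 2 ((memLp_of_continuous hψ.continuous).toLp ψ,
      (memLp_of_continuous (continuous_grad hψ)).toLp (grad ψ)), by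
    have h1 := (memLp_of_continuous hψ.continuous).coeFn_toLp
    have h2 := (memLp_of_continuous (continuous_grad hψ)).coeFn_toLp
    refine ⟨(integrable_congr h1).2 hψ.hasWeakGrad.1,
      (integrable_congr h2).2 hψ.hasWeakGrad.2.1, fun χ hχ i => ?_⟩
    have e1 := integral_congr_ae (μ := (volume : Measure (Td d)))
      (f := fun x => (memLp_of_continuous hψ.continuous).toLp ψ x * pd i χ x)
      (g := fun x => ψ x * pd i χ x) (by filter_upwards [h1] with x hx; rw [hx])
    have e2 := integral_congr_ae (μ := (volume : Measure (Td d)))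
      (f := fun x => (memLp_of_continuous (continuous_grad hψ)).toLp (grad ψ) x i * χ x)
      (g := fun x => grad ψ x i * χ x) (by filter_upwards [h2] with x hx; rw [hx])
    exact e1.trans ((hψ.hasWeakGrad.2.2 χ hχ i).trans (congrArg Neg.neg e2.symm))⟩

/-- `H⁻¹(𝕋^d)`, the dual of `H¹(𝕋^d)` with the dual norm. -/
abbrev Hneg1 (d : ℕ) : Type := StrongDual ℝ (H1 d)

lemma isSmooth_const {d : ℕ} (c : ℝ) : IsSmooth (fun _ : Td d => c) := contDiff_const

/-- The function `v` lies in `H¹(𝕋^d)`. -/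
def MemH1 {d : ℕ} (v : Td d → ℝ) : Prop :=
  MemLp v 2 ∧ ∃ g : Td d → EuclideanSpace ℝ (Fin d), MemLp g 2 ∧ HasWeakGrad v g

/-! ### Space-time notions on `(0,T) × 𝕋^d` -/

/-- Lebesgue measure on the time interval `(0,T)`. -/
abbrev timeMeasure (T : ℝ) : Measure ℝ := volume.restrict (Ioo 0 T)

/-- Lebesgue measure on `(0,T) × 𝕋^d`. -/
abbrev stMeasure (d : ℕ) (T : ℝ) : Measure (ℝ × Td d) := (timeMeasure T).prod volume

/-- The norm of `L^p(0,T; L^q(𝕋^d))`, with values in `[0,∞]`. -/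
def mixedNorm {d : ℕ} {E : Type*} [NormedAddCommGroup E] (p q : ℝ≥0∞) (T : ℝ)
    (v : ℝ → Td d → E) : ℝ≥0∞ :=
  eLpNorm (fun t => eLpNorm (v t) q volume) p (timeMeasure T)

/-- The norm of `L^∞((0,T) × 𝕋^d)`. -/
def supNorm {d : ℕ} {E : Type*} [NormedAddCommGroup E] (T : ℝ) (v : ℝ → Td d → E) : ℝ :=
  (eLpNorm (fun p : ℝ × Td d => v p.1 p.2) ∞ (stMeasure d T)).toReal

/-- `r ∈ L^p(0,T; L^q(𝕋^d))`. -/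
def MemMixed {d : ℕ} (p q : ℝ≥0∞) (T : ℝ) (r : ℝ → Td d → ℝ) : Prop :=
  AEStronglyMeasurable (fun z : ℝ × Td d => r z.1 z.2) (stMeasure d T) ∧
    mixedNorm p q T r < ∞

/-- `Dv` is the weak spatial gradient of `v` on `(0,T) × 𝕋^d`. -/
def HasSpatialWeakGrad {d : ℕ} (T : ℝ) (v : ℝ → Td d → ℝ)
    (Dv : ℝ → Td d → EuclideanSpace ℝ (Fin d)) : Prop :=
  AEStronglyMeasurable (fun p : ℝ × Td d => Dv p.1 p.2) (stMeasure d T) ∧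
    ∀ᵐ t ∂(timeMeasure T), HasWeakGrad (v t) (Dv t)

/-- `v ∈ L²(0,T; H¹(𝕋^d))` with spatial gradient `Dv`. -/
def MemL2H1 {d : ℕ} (T : ℝ) (v : ℝ → Td d → ℝ)
    (Dv : ℝ → Td d → EuclideanSpace ℝ (Fin d)) : Prop :=
  HasSpatialWeakGrad T v Dv ∧
    MemLp (fun p : ℝ × Td d => v p.1 p.2) 2 (stMeasure d T) ∧
    MemLp (fun p : ℝ × Td d => Dv p.1 p.2) 2 (stMeasure d T)

/-- `v ∈ W^{1,∞}((0,T) × 𝕋^d)` (with its continuous representative on `[0,T] × 𝕋^d`, so that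
`v 0` is the initial trace): `v` is Lipschitz continuous. -/
def IsLipschitzST {d : ℕ} (T : ℝ) (v : ℝ → Td d → ℝ) : Prop :=
  ∃ C : NNReal, LipschitzOnWith C (fun p : ℝ × Td d => v p.1 p.2) (Icc 0 T ×ˢ univ)

/-- Smooth functions on `ℝ × 𝕋^d`. -/
def IsSmoothST {d : ℕ} (φ : ℝ → Td d → ℝ) : Prop :=
  ContDiff ℝ ((⊤ : ℕ∞) : WithTop ℕ∞) (fun p : ℝ × (Fin d → ℝ) => φ p.1 (toTd p.2))

lemma IsSmoothST.slice {d : ℕ} {φ : ℝ → Td d → ℝ} (hφ : IsSmoothST φ) (t : ℝ) :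
    IsSmooth (φ t) :=
  ContDiff.comp (g := fun p : ℝ × (Fin d → ℝ) => φ p.1 (toTd p.2)) hφ
    (contDiff_const.prodMk contDiff_id)

/-- Test functions in `C_0^∞([0,T) × 𝕋^d)`. They are written as smooth functions of `t ∈ ℝ`, of
which only the restriction to `[0,T)` enters. -/
def IsTest {d : ℕ} (T : ℝ) (φ : ℝ → Td d → ℝ) : Prop :=
  IsSmoothST φ ∧ ∃ T' < T, ∀ t, T' ≤ t → ∀ x, φ t x = 0

/-- Test functions in `C_0^∞((0,T) × 𝕋^d)`. -/
def IsInteriorTest {d : ℕ} (T : ℝ) (φ : ℝ → Td d → ℝ) : Prop :=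
  IsTest T φ ∧ ∃ T₀ > 0, ∀ t, t ≤ T₀ → ∀ x, φ t x = 0

/-- The classical time derivative. -/
def dt {d : ℕ} (φ : ℝ → Td d → ℝ) (t : ℝ) (x : Td d) : ℝ := deriv (fun s => φ s x) t

/-- `g ∈ W^{-1,1}((0,T) × 𝕋^d)`: as a distribution, `g = g₀ + ∂ₜ g₁ + div G` with
`g₀, g₁, G ∈ L¹`. -/
def MemWNegOneOne {d : ℕ} (T : ℝ) (g : ℝ → Td d → ℝ) : Prop :=
  (∀ φ, IsInteriorTest T φ →
    Integrable (fun p : ℝ × Td d => g p.1 p.2 * φ p.1 p.2) (stMeasure d T)) ∧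
  ∃ (g₀ g₁ : ℝ × Td d → ℝ) (G : Fin d → ℝ × Td d → ℝ),
    Integrable g₀ (stMeasure d T) ∧ Integrable g₁ (stMeasure d T) ∧
    (∀ α, Integrable (G α) (stMeasure d T)) ∧
    ∀ φ, IsInteriorTest T φ →
      ∫ p, g p.1 p.2 * φ p.1 p.2 ∂(stMeasure d T) =
        ∫ p, (g₀ p * φ p.1 p.2 - g₁ p * dt φ p.1 p.2
          - ∑ α, G α p * pd α (φ p.1) p.2) ∂(stMeasure d T)

/-! ### Weak and entropy weak solutions -/

/-- `u`, with spatial gradient `Du`, is a weak solution, with values in `U` and initial data `u₀`,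
of `∂ₜ u + ∑ ∂_α f_α(u) = ε ∑ ∂_α (A(u) ∂_α u) + r`, where the source `r` is given by its pairing
with test functions. -/
structure IsWeakSolution {d : ℕ} (U : Set ℝ) (f : Fin d → ℝ → ℝ) (A : ℝ → ℝ) (ε T : ℝ)
    (u₀ : Td d → ℝ) (r : (φ : ℝ → Td d → ℝ) → IsTest T φ → ℝ)
    (u : ℝ → Td d → ℝ) (Du : ℝ → Td d → EuclideanSpace ℝ (Fin d)) : Prop where
  memLp : MemLp (fun p : ℝ × Td d => u p.1 p.2) ∞ (stMeasure d T)
  mem_state : ∀ᵐ p ∂(stMeasure d T), u p.1 p.2 ∈ U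
  grad : HasSpatialWeakGrad T u Du
  flux : ∀ α, Integrable (fun p : ℝ × Td d => ε * (A (u p.1 p.2) * Du p.1 p.2 α)) (stMeasure d T)
  weak : ∀ φ (hφ : IsTest T φ),
    ∫ p, (dt φ p.1 p.2 * u p.1 p.2
      + ∑ α, pd α (φ p.1) p.2 *
          (f α (u p.1 p.2) - ε * (A (u p.1 p.2) * Du p.1 p.2 α))) ∂(stMeasure d T)
      + r φ hφ + ∫ x, u₀ x * φ 0 x = 0

/-- `(η, q)` is a strictly convex entropy/entropy-flux pair for the flux `f` on the open set `U`.
As `U` need not be an interval, strict convexity is required on the intervals contained in `U`. -/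
structure IsEntropyPair {d : ℕ} (U : Set ℝ) (f : Fin d → ℝ → ℝ) (η : ℝ → ℝ)
    (q : Fin d → ℝ → ℝ) : Prop where
  contDiff_entropy : ContDiffOn ℝ 2 η U
  contDiff_flux : ∀ α, ContDiffOn ℝ 1 (q α) U
  convex : ∀ I ⊆ U, Convex ℝ I → StrictConvexOn ℝ I η
  compat : ∀ α, ∀ z ∈ U, deriv (q α) z = deriv η z * deriv (f α) z

/-- `u` is an entropy weak solution of `∂ₜ u + ∑ ∂_α f_α(u) = ε ∑ ∂_α (A(u) ∂_α u)` with respect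
to the pair `(η, q)`, with initial data `u₀`. In the definition `DE` is the weak gradient of
`η'(u)`. -/
structure IsEntropyWeakSolution {d : ℕ} (U : Set ℝ) (f : Fin d → ℝ → ℝ) (A : ℝ → ℝ) (ε T : ℝ)
    (η : ℝ → ℝ) (q : Fin d → ℝ → ℝ) (u₀ : Td d → ℝ)
    (u : ℝ → Td d → ℝ) (Du : ℝ → Td d → EuclideanSpace ℝ (Fin d)) : Prop where
  weakSolution : IsWeakSolution U f A ε T u₀ (fun _ _ => 0) u Du
  entropy : ∃ DE : ℝ → Td d → EuclideanSpace ℝ (Fin d),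
    HasSpatialWeakGrad T (fun t x => deriv η (u t x)) DE ∧
    MemWNegOneOne T (fun t x => ε * ∑ α, DE t x α * (A (u t x) * Du t x α)) ∧
    ∀ Φ, IsTest T Φ → (∀ t x, 0 ≤ Φ t x) →
      0 ≤ ∫ p, (dt Φ p.1 p.2 * η (u p.1 p.2)
          + ∑ α, pd α (Φ p.1) p.2 * (q α (u p.1 p.2)
              - ε * (deriv η (u p.1 p.2) * (A (u p.1 p.2) * Du p.1 p.2 α)))) ∂(stMeasure d T)
        - ε * ∫ p, Φ p.1 p.2 * ∑ α, DE p.1 p.2 α * (A (u p.1 p.2) * Du p.1 p.2 α)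
            ∂(stMeasure d T)
        + ∫ x, Φ 0 x * η (u₀ x)

/-- The pairing of the residual `r = r₁ + ε r₂` with test functions, where
`r₁ ∈ L¹(0,T; L²)` and `r₂ ∈ L²(0,T; H⁻¹)`. -/
def residual {d : ℕ} (ε T : ℝ) (r₁ : ℝ → Td d → ℝ) (r₂ : ℝ → Hneg1 d)
    (φ : ℝ → Td d → ℝ) (hφ : IsTest T φ) : ℝ :=
  ∫ p, r₁ p.1 p.2 * φ p.1 p.2 ∂(stMeasure d T)
    + ε * ∫ t, r₂ t (H1.ofSmooth (φ t) (hφ.1.slice t)) ∂(timeMeasure T)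

/-- The constant `Λ` of the stability estimate, for the reference function `û` with spatial
gradient `Dû`. -/
def stabilityRate {d : ℕ} (f : Fin d → ℝ → ℝ) (A : ℝ → ℝ) (K : Set ℝ) (ε T : ℝ)
    (Dû : ℝ → Td d → EuclideanSpace ℝ (Fin d)) : ℝ :=
  2 * ∑ α, sSup ((fun z => |deriv (deriv (f α)) z|) '' K) * supNorm T (fun t x => Dû t x α)
    + 2 * ε * sSup ((fun z => |deriv A z| ^ 2) '' K) * supNorm T Dû ^ 2

end ScalarCD

end

/-! The difference w = u - û satisfies a balance law ∂ₜw + div(G - Ĝ) = -(r₁ + εr₂) in which every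
term lies in an energy space: both functions have values in K and L² gradients, so the fluxes f -
εA∇ are in L². Such a law can be tested with its own solution. This is done on the Fourier side:
each coefficient of w agrees a.e. in time with an absolutely continuous function, its square obeys
the product rule, and summing over the frequencies gives the energy inequality
`IsBalance.energy_le`. Since r₂ has zero mean, the zero frequency drops out and a Poincaré
inequality bounds its pairing by √(3/2) ‖r₂‖ ‖∇w‖.

The relative flux is estimated in `IsH1.sum_integral_sub_mul_cdFlux_le`. Integrals of exact
derivatives over the torus vanish, which reduces the convective part to the Taylor remainder of f
times ∇û. In the diffusive part A ≥ 1 yields ε‖∇w‖², a quarter of which absorbs the error from A(u)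
- A(û). Young's inequality for r₂, Grönwall's inequality and the absorption of the essential
supremum of ‖w‖² (`energy_bound`) give the estimate.

One difficulty remains: Λ sees f'' and A' on K only, K may have gaps, and Taylor's formula needs the
whole segment between û and u. By continuity û stays in one component [a,b] of K. For u, an H¹
function cannot jump over a gap (`IsH1.lt_or_gt`), and conservation of the mean fixes its side of
the gap for almost all times (`IsBalance.lt_or_gt`). So either u has values in [a,b] as well
(`stability_of_interval`), or some c ∉ K separates u from û (`stability_of_separated`). In the
second case u - c and c - û are estimated one by one: convection produces no energy for a single
solution, and (u₀ - c)(c - û₀) ≥ 0 bounds the sum of the two initial energies by ‖u₀ - û₀‖². -/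

namespace ScalarCD
variable {d : ℕ}

/-! ### Real Fourier coefficients on the torus and Parseval's identity -/

lemma volume_unitAddCircle : (volume : Measure UnitAddCircle) = AddCircle.haarAddCircle := by
  rw [AddCircle.volume_eq_smul_haarAddCircle]; simp

/-- The circle has length one, so its volume is the Haar probability measure for which the Fourier
series are normalized. -/
lemma volume_Td : (volume : Measure (Td d)) =
    Measure.pi fun _ : Fin d => (AddCircle.haarAddCircle : Measure UnitAddCircle) := by
  rw [volume_pi, volume_unitAddCircle]

instance : IsProbabilityMeasure (volume : Measure (Td d)) := by
  rw [volume_Td]; infer_instance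

/-- The trigonometric function `cos (2π k · x)`. -/
noncomputable def tcos (k : Fin d → ℤ) (x : Td d) : ℝ := (UnitAddTorus.mFourier k x).re

/-- The trigonometric function `sin (2π k · x)`. -/
noncomputable def tsin (k : Fin d → ℤ) (x : Td d) : ℝ := (UnitAddTorus.mFourier k x).im

lemma mFourier_toTd (k : Fin d → ℤ) (y : Fin d → ℝ) :
    UnitAddTorus.mFourier k (toTd y) =
      Complex.exp (((2 * Real.pi * ∑ i, k i * y i : ℝ) : ℂ) * Complex.I) := by
  simp only [UnitAddTorus.mFourier, ContinuousMap.coe_mk, toTd, fourier_coe_apply]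
  rw [← Complex.exp_sum]
  congr 1
  push_cast
  rw [Finset.mul_sum, Finset.sum_mul]
  refine Finset.sum_congr rfl fun i _ => ?_
  ring

lemma tcos_toTd (k : Fin d → ℤ) (y : Fin d → ℝ) :
    tcos k (toTd y) = Real.cos (2 * Real.pi * ∑ i, k i * y i) := by
  rw [tcos, mFourier_toTd, Complex.exp_ofReal_mul_I_re]

lemma tsin_toTd (k : Fin d → ℤ) (y : Fin d → ℝ) :
    tsin k (toTd y) = Real.sin (2 * Real.pi * ∑ i, k i * y i) := by
  rw [tsin, mFourier_toTd, Complex.exp_ofReal_mul_I_im]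

lemma isSmooth_tcos (k : Fin d → ℤ) : IsSmooth (tcos k) := by
  unfold IsSmooth
  simp only [tcos_toTd]
  fun_prop

lemma isSmooth_tsin (k : Fin d → ℤ) : IsSmooth (tsin k) := by
  unfold IsSmooth
  simp only [tsin_toTd]
  fun_prop

lemma hasDerivAt_phase (k : Fin d → ℤ) (y : Fin d → ℝ) (i : Fin d) :
    HasDerivAt (fun s : ℝ => 2 * Real.pi * ∑ j, k j * (y + s • Pi.single i 1 : Fin d → ℝ) j)
      (2 * Real.pi * k i) 0 := by
  have e : (fun s : ℝ => 2 * Real.pi * ∑ j, k j * (y + s • Pi.single i 1 : Fin d → ℝ) j) =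
      fun s => 2 * Real.pi * ∑ j, k j * y j + s * (2 * Real.pi * k i) := by
    funext s
    simp only [Pi.add_apply, Pi.smul_apply, smul_eq_mul, mul_add, Finset.sum_add_distrib]
    congr 1
    rw [Finset.sum_eq_single i]
    · simp; ring
    · intro j _ hj; simp [hj]
    · simp
  rw [e]
  simpa using ((hasDerivAt_id (0 : ℝ)).mul_const (2 * Real.pi * k i)).const_add
    (2 * Real.pi * ∑ j, k j * y j)

lemma pd_tcos (k : Fin d → ℤ) (i : Fin d) (x : Td d) :
    pd i (tcos k) x = -(2 * Real.pi * k i) * tsin k x := by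
  obtain ⟨y, rfl⟩ := toTd_surjective x
  simp only [pd, toTd_add_single, tcos_toTd, tsin_toTd]
  rw [(hasDerivAt_phase k y i).cos.deriv]
  simp; ring

lemma pd_tsin (k : Fin d → ℤ) (i : Fin d) (x : Td d) :
    pd i (tsin k) x = (2 * Real.pi * k i) * tcos k x := by
  obtain ⟨y, rfl⟩ := toTd_surjective x
  simp only [pd, toTd_add_single, tcos_toTd, tsin_toTd]
  rw [(hasDerivAt_phase k y i).sin.deriv]
  simp; ring

lemma tcos_zero : tcos (0 : Fin d → ℤ) = fun _ => 1 := by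
  funext x; simp [tcos, UnitAddTorus.mFourier_zero]

lemma tsin_zero : tsin (0 : Fin d → ℤ) = fun _ => 0 := by
  funext x; simp [tsin, UnitAddTorus.mFourier_zero]

/-- The cosine coefficients of a function. -/
noncomputable def ccoef (v : Td d → ℝ) (k : Fin d → ℤ) : ℝ := ∫ x, v x * tcos k x

/-- The sine coefficients of a function. -/
noncomputable def scoef (v : Td d → ℝ) (k : Fin d → ℤ) : ℝ := ∫ x, v x * tsin k x

lemma _root_.MeasureTheory.Integrable.mul_continuous {v : Td d → ℝ} (hv : Integrable v)
    {ψ : Td d → ℝ} (hψ : Continuous ψ) : Integrable (fun x => v x * ψ x) := by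
  obtain ⟨C, hC⟩ := (isCompact_univ (X := Td d)).exists_bound_of_continuousOn hψ.continuousOn
  exact hv.mul_bdd (c := C) hψ.aestronglyMeasurable
    (Filter.Eventually.of_forall fun x => hC x (mem_univ x))

/-- For real v the complex coefficient is c_k - i s_k, whose squared modulus is c_k² + s_k²; this
carries Parseval's identity over to the real system. -/
lemma mFourierCoeff_ofReal {v : Td d → ℝ} (hv : Integrable v) (k : Fin d → ℤ) :
    ∫ x, UnitAddTorus.mFourier (-k) x * (v x : ℂ) = ccoef v k - scoef v k * Complex.I := by
  have e : ∀ x, UnitAddTorus.mFourier (-k) x * (v x : ℂ) =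
      ((v x * tcos k x : ℝ) : ℂ) - ((v x * tsin k x : ℝ) : ℂ) * Complex.I := by
    intro x
    rw [UnitAddTorus.mFourier_neg, tcos, tsin]
    apply Complex.ext <;> simp [mul_comm]
  simp only [e]
  rw [integral_sub, integral_mul_const, integral_complex_ofReal, integral_complex_ofReal]
  · rfl
  · exact (hv.mul_continuous (isSmooth_tcos k).continuous).ofReal
  · exact (hv.mul_continuous (isSmooth_tsin k).continuous).ofReal.mul_const _

/-- **Parseval's identity** for the real trigonometric system. -/
theorem hasSum_sq_coef {v : Td d → ℝ} (hv : MemLp v 2) :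
    HasSum (fun k => ccoef v k ^ 2 + scoef v k ^ 2) (∫ x, v x ^ 2) := by
  have hv' := hv.ofReal (K := ℂ)
  have hi := mFourierCoeff_ofReal (hv.integrable (by norm_num))
  rw [volume_Td] at hv'
  have h := UnitAddTorus.hasSum_sq_mFourierCoeff (d := Fin d) (hv'.toLp _)
  have e1 : ∀ k, UnitAddTorus.mFourierCoeff (hv'.toLp _ : Td d → ℂ) k =
      ccoef v k - scoef v k * Complex.I := by
    intro k
    rw [← hi k, volume_Td]
    refine integral_congr_ae ?_
    filter_upwards [hv'.coeFn_toLp] with x hx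
    rw [hx]; rfl
  have e2 : ∫ x, v x ^ 2 = ∫ x, ‖(hv'.toLp _ : Td d → ℂ) x‖ ^ 2
      ∂(Measure.pi fun _ : Fin d => (AddCircle.haarAddCircle : Measure UnitAddCircle)) := by
    rw [volume_Td]
    refine integral_congr_ae ?_
    filter_upwards [hv'.coeFn_toLp] with x hx
    rw [hx]; simp
  rw [e2]
  refine HasSum.congr_fun h fun k => ?_
  simp only [e1]
  rw [← Complex.normSq_eq_norm_sq, Complex.normSq_apply]
  simp; ring

lemma ccoef_add {v g : Td d → ℝ} (hv : Integrable v) (hg : Integrable g) (k : Fin d → ℤ) :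
    ccoef (fun x => v x + g x) k = ccoef v k + ccoef g k := by
  simp only [ccoef, add_mul]
  exact integral_add (hv.mul_continuous (isSmooth_tcos k).continuous)
    (hg.mul_continuous (isSmooth_tcos k).continuous)

lemma scoef_add {v g : Td d → ℝ} (hv : Integrable v) (hg : Integrable g) (k : Fin d → ℤ) :
    scoef (fun x => v x + g x) k = scoef v k + scoef g k := by
  simp only [scoef, add_mul]
  exact integral_add (hv.mul_continuous (isSmooth_tsin k).continuous)
    (hg.mul_continuous (isSmooth_tsin k).continuous)

/-- **Parseval's identity** for the product of two functions. -/
theorem hasSum_mul_coef {v g : Td d → ℝ} (hv : MemLp v 2) (hg : MemLp g 2) :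
    HasSum (fun k => ccoef v k * ccoef g k + scoef v k * scoef g k) (∫ x, v x * g x) := by
  -- Polarization: the quadratic identity is applied to v + g, v and g.
  have h := ((hasSum_sq_coef (hv.add hg)).sub (hasSum_sq_coef hv)).sub (hasSum_sq_coef hg)
  have h2 := h.mul_left (1 / 2)
  have e : 1 / 2 * ((∫ x, (v + g) x ^ 2) - (∫ x, v x ^ 2) - ∫ x, g x ^ 2) = ∫ x, v x * g x := by
    have : ∀ x, (v + g) x ^ 2 = v x ^ 2 + 2 * (v x * g x) + g x ^ 2 := by
      intro x; simp only [Pi.add_apply]; ring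
    simp only [this]
    rw [integral_add, integral_add, integral_const_mul]
    · ring
    · exact hv.integrable_sq
    · exact (hv.integrable_mul hg).const_mul 2
    · exact hv.integrable_sq.add ((hv.integrable_mul hg).const_mul 2)
    · exact hg.integrable_sq
  rw [e] at h2
  refine HasSum.congr_fun h2 fun k => ?_
  have a1 := ccoef_add (hv.integrable (by norm_num)) (hg.integrable (by norm_num)) k
  have a2 := scoef_add (hv.integrable (by norm_num)) (hg.integrable (by norm_num)) k
  change _ = 1 / 2 * (ccoef (fun x => v x + g x) k ^ 2 + scoef (fun x => v x + g x) k ^ 2 -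
    _ - _)
  rw [a1, a2]; ring

end ScalarCD

/-! ### Trigonometric polynomials, weak gradients and a Poincaré inequality -/

namespace ScalarCD

variable {d : ℕ}

/-- The real trigonometric polynomial with the given coefficients. -/
noncomputable def trigSum (F : Finset (Fin d → ℤ)) (a b : (Fin d → ℤ) → ℝ) (x : Td d) : ℝ :=
  ∑ k ∈ F, (a k * tcos k x + b k * tsin k x)

lemma isSmooth_trigSum (F : Finset (Fin d → ℤ)) (a b : (Fin d → ℤ) → ℝ) :
    IsSmooth (trigSum F a b) := by
  unfold IsSmooth trigSum
  refine ContDiff.sum fun k _ => ?_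
  exact (contDiff_const.mul (isSmooth_tcos k)).add (contDiff_const.mul (isSmooth_tsin k))

lemma pd_trigSum (F : Finset (Fin d → ℤ)) (a b : (Fin d → ℤ) → ℝ) (i : Fin d) (x : Td d) :
    pd i (trigSum F a b) x = trigSum F (fun k => 2 * Real.pi * k i * b k)
      (fun k => -(2 * Real.pi * k i * a k)) x := by
  have h : HasDerivAt (fun s : ℝ => trigSum F a b (x + Pi.single i (s : UnitAddCircle)))
      (∑ k ∈ F, (a k * pd i (tcos k) x + b k * pd i (tsin k) x)) 0 := by
    unfold trigSum
    refine HasDerivAt.fun_sum fun k _ => ?_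
    have h1 := (isSmooth_tcos k).hasDerivAt i x 0
    have h2 := (isSmooth_tsin k).hasDerivAt i x 0
    simp only [AddCircle.coe_zero, Pi.single_zero, add_zero] at h1 h2
    exact (h1.const_mul _).add (h2.const_mul _)
  rw [pd, h.deriv, trigSum]
  refine Finset.sum_congr rfl fun k _ => ?_
  rw [pd_tcos, pd_tsin]; ring

lemma integral_mul_trigSum {v : Td d → ℝ} (hv : Integrable v) (F : Finset (Fin d → ℤ))
    (a b : (Fin d → ℤ) → ℝ) :
    ∫ x, v x * trigSum F a b x = ∑ k ∈ F, (a k * ccoef v k + b k * scoef v k) := by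
  have h1 := fun k => hv.mul_continuous (isSmooth_tcos (d := d) k).continuous
  have h2 := fun k => hv.mul_continuous (isSmooth_tsin (d := d) k).continuous
  have e : ∀ x, v x * trigSum F a b x =
      ∑ k ∈ F, (a k * (v x * tcos k x) + b k * (v x * tsin k x)) := by
    intro x
    rw [trigSum, Finset.mul_sum]
    exact Finset.sum_congr rfl fun k _ => by ring
  simp only [e]
  rw [integral_finsetSum]
  · refine Finset.sum_congr rfl fun k _ => ?_
    rw [integral_add ((h1 k).const_mul _) ((h2 k).const_mul _), integral_const_mul,
      integral_const_mul]
    rfl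
  · exact fun k _ => ((h1 k).const_mul _).add ((h2 k).const_mul _)

/-- **Bessel's inequality**. -/
lemma sum_sq_coef_le {v : Td d → ℝ} (hv : MemLp v 2) (F : Finset (Fin d → ℤ)) :
    ∑ k ∈ F, (ccoef v k ^ 2 + scoef v k ^ 2) ≤ ∫ x, v x ^ 2 :=
  sum_le_hasSum F (fun k _ => by positivity) (hasSum_sq_coef hv)

lemma sum_mul_le_sqrt {ι : Type*} (F : Finset ι) (a b c e : ι → ℝ) :
    ∑ k ∈ F, (a k * c k + b k * e k) ≤
      √(∑ k ∈ F, (a k ^ 2 + b k ^ 2)) * √(∑ k ∈ F, (c k ^ 2 + e k ^ 2)) := by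
  calc ∑ k ∈ F, (a k * c k + b k * e k)
      ≤ ∑ k ∈ F, √(a k ^ 2 + b k ^ 2) * √(c k ^ 2 + e k ^ 2) := by
        refine Finset.sum_le_sum fun k _ => ?_
        rw [← Real.sqrt_mul (by positivity)]
        refine Real.le_sqrt_of_sq_le ?_
        nlinarith [sq_nonneg (a k * e k - b k * c k)]
    _ ≤ _ := by
        refine (Real.sum_mul_le_sqrt_mul_sqrt F _ _).trans (le_of_eq ?_)
        congr 2 <;> exact Finset.sum_congr rfl fun k _ => Real.sq_sqrt (by positivity)

/-- The frequencies k and -k give the same functions up to sign, so the real system is not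
orthonormal and only an inequality holds. It follows by duality: pairing the polynomial with itself
and using Bessel's inequality gives ‖p‖² ≤ √(∑(a² + b²)) ‖p‖. -/
lemma integral_sq_trigSum_le (F : Finset (Fin d → ℤ)) (a b : (Fin d → ℤ) → ℝ) :
    ∫ x, trigSum F a b x ^ 2 ≤ ∑ k ∈ F, (a k ^ 2 + b k ^ 2) := by
  set p := trigSum F a b
  have hp : MemLp p 2 := memLp_of_continuous (isSmooth_trigSum F a b).continuous
  have h1 : ∫ x, p x ^ 2 = ∑ k ∈ F, (a k * ccoef p k + b k * scoef p k) := by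
    rw [← integral_mul_trigSum (hp.integrable (by norm_num))]
    simp only [sq]; rfl
  have h2 := sum_mul_le_sqrt F a b (ccoef p) (scoef p)
  have h3 := Real.sqrt_le_sqrt (sum_sq_coef_le hp F)
  rw [← h1] at h2
  have h0 : 0 ≤ ∫ x, p x ^ 2 := integral_nonneg fun x => sq_nonneg _
  have hS : 0 ≤ ∑ k ∈ F, (a k ^ 2 + b k ^ 2) := Finset.sum_nonneg fun k _ => by positivity
  have h4 : ∫ x, p x ^ 2 ≤ √(∑ k ∈ F, (a k ^ 2 + b k ^ 2)) * √(∫ x, p x ^ 2) :=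
    h2.trans (mul_le_mul_of_nonneg_left h3 (Real.sqrt_nonneg _))
  have h5 := Real.sq_sqrt h0
  have h6 := Real.sq_sqrt hS
  have h7 := Real.sqrt_nonneg (∫ x, p x ^ 2)
  have h8 := Real.sqrt_nonneg (∑ k ∈ F, (a k ^ 2 + b k ^ 2))
  nlinarith [sq_nonneg (√(∑ k ∈ F, (a k ^ 2 + b k ^ 2)) - √(∫ x, p x ^ 2))]

/-- The partial Fourier sum of a real function. -/
noncomputable def trigProj (F : Finset (Fin d → ℤ)) (v : Td d → ℝ) : Td d → ℝ :=
  trigSum F (ccoef v) (scoef v)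

/-- Expanding the square, the cross term is -2∑(c_k² + s_k²) and the norm of the partial sum is at
most ∑(c_k² + s_k²), so the error is bounded by the Parseval defect of v. -/
lemma tendsto_trigProj {v : Td d → ℝ} (hv : MemLp v 2) :
    Filter.Tendsto (fun F => ∫ x, (trigProj F v x - v x) ^ 2) Filter.atTop (nhds 0) := by
  have h : Filter.Tendsto (fun F : Finset (Fin d → ℤ) => (∫ x, v x ^ 2) -
      ∑ k ∈ F, (ccoef v k ^ 2 + scoef v k ^ 2)) Filter.atTop (nhds 0) := by
    rw [← sub_self (∫ x, v x ^ 2)]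
    exact tendsto_const_nhds.sub (hasSum_sq_coef hv)
  refine squeeze_zero (fun F => integral_nonneg fun x => sq_nonneg _) (fun F => ?_) h
  have hp : MemLp (trigProj F v) 2 := memLp_of_continuous (isSmooth_trigSum F _ _).continuous
  have e : ∀ x, (trigProj F v x - v x) ^ 2 =
      trigProj F v x ^ 2 - 2 * (v x * trigProj F v x) + v x ^ 2 := fun x => by ring
  simp only [e]
  rw [integral_add, integral_sub, integral_const_mul]
  · have h1 := integral_mul_trigSum (hv.integrable (by norm_num)) F (ccoef v) (scoef v)
    have h2 := integral_sq_trigSum_le F (ccoef v) (scoef v)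
    rw [trigProj, h1]
    simp only [← sq] at h1 ⊢
    linarith
  · exact hp.integrable_sq
  · exact (hv.integrable_mul hp).const_mul 2
  · exact hp.integrable_sq.sub ((hv.integrable_mul hp).const_mul 2)
  · exact hv.integrable_sq

section WeakGrad

variable {v : Td d → ℝ} {g : Td d → EuclideanSpace ℝ (Fin d)}

lemma HasWeakGrad.ccoef_grad (h : HasWeakGrad v g) (i : Fin d) (k : Fin d → ℤ) :
    ccoef (fun x => g x i) k = 2 * Real.pi * k i * scoef v k := by
  have := h.2.2 _ (isSmooth_tcos k) i
  rw [ccoef, ← neg_eq_iff_eq_neg.2 this, scoef, ← integral_const_mul, ← integral_neg]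
  refine integral_congr_ae (Filter.Eventually.of_forall fun x => ?_)
  simp only [pd_tcos]; ring

lemma HasWeakGrad.scoef_grad (h : HasWeakGrad v g) (i : Fin d) (k : Fin d → ℤ) :
    scoef (fun x => g x i) k = -(2 * Real.pi * k i * ccoef v k) := by
  have := h.2.2 _ (isSmooth_tsin k) i
  rw [scoef, ← neg_eq_iff_eq_neg.2 this, ccoef, ← integral_const_mul, ← integral_neg, ← integral_neg]
  refine integral_congr_ae (Filter.Eventually.of_forall fun x => ?_)
  simp only [pd_tsin]; ring

/-- Partial sums commute with weak derivatives, so those of an H¹ function converge in L² together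
with their gradients. -/
lemma HasWeakGrad.pd_trigProj (h : HasWeakGrad v g) (F : Finset (Fin d → ℤ)) (i : Fin d) :
    pd i (trigProj F v) = trigProj F (fun x => g x i) := by
  funext x
  rw [trigProj, pd_trigSum, trigProj]
  congr 1
  · funext k; rw [h.ccoef_grad]
  · funext k; rw [h.scoef_grad]

lemma memLp_coord (hg : MemLp g 2) (i : Fin d) : MemLp (fun x => g x i) 2 :=
  (EuclideanSpace.proj (𝕜 := ℝ) i).comp_memLp' hg

lemma integral_normSq_eq (hg : MemLp g 2) : ∫ x, ‖g x‖ ^ 2 = ∑ i, ∫ x, g x i ^ 2 := by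
  rw [← integral_finsetSum _ fun i _ => (memLp_coord hg i).integrable_sq]
  refine integral_congr_ae (Filter.Eventually.of_forall fun x => ?_)
  simp [EuclideanSpace.norm_sq_eq]

/-- A **Poincaré inequality** for the Fourier coefficients. -/
lemma HasWeakGrad.sum_sq_coef_le (h : HasWeakGrad v g) (hg : MemLp g 2)
    {F : Finset (Fin d → ℤ)} (hF : (0 : Fin d → ℤ) ∉ F) :
    ∑ k ∈ F, (ccoef v k ^ 2 + scoef v k ^ 2) ≤ 1 / 2 * ∫ x, ‖g x‖ ^ 2 := by
  rw [integral_normSq_eq hg, Finset.mul_sum]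
  have h1 : ∀ i, ∑ k ∈ F, (2 * Real.pi * k i) ^ 2 * (ccoef v k ^ 2 + scoef v k ^ 2) ≤
      ∫ x, g x i ^ 2 := by
    intro i
    refine le_trans (le_of_eq ?_) (ScalarCD.sum_sq_coef_le (memLp_coord hg i) F)
    refine Finset.sum_congr rfl fun k _ => ?_
    rw [h.ccoef_grad, h.scoef_grad]; ring
  refine le_trans ?_ (Finset.sum_le_sum fun i _ => mul_le_mul_of_nonneg_left (h1 i) (by norm_num))
  simp only [Finset.mul_sum]
  rw [Finset.sum_comm]
  refine Finset.sum_le_sum fun k hk => ?_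
  -- A nonzero frequency has an integer coordinate with square at least 1, and that single term
  -- carries the weight (2π k_i)² ≥ 4π². The crude lower bound 2 is all that the constant 1/2 needs.
  have hk0 : k ≠ 0 := fun e => hF (e ▸ hk)
  obtain ⟨i, hi⟩ := Function.ne_iff.1 hk0
  refine le_trans ?_ (Finset.single_le_sum
    (f := fun i => 1 / 2 * ((2 * Real.pi * k i) ^ 2 * (ccoef v k ^ 2 + scoef v k ^ 2)))
    (fun j _ => by positivity) (Finset.mem_univ i))
  have hki : (1 : ℝ) ≤ (k i : ℝ) ^ 2 := by
    have : (1 : ℤ) ≤ (k i) ^ 2 := by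
      have : 0 < (k i) ^ 2 := by have : k i ≠ 0 := hi
                                 positivity
      omega
    exact_mod_cast this
  have hpi : (2 : ℝ) ≤ (2 * Real.pi * k i) ^ 2 := by
    have := Real.pi_gt_three
    have : (1:ℝ) ≤ Real.pi ^ 2 := by nlinarith
    calc (2:ℝ) ≤ 4 * 1 * 1 := by norm_num
      _ ≤ 4 * Real.pi ^ 2 * (k i : ℝ) ^ 2 := by gcongr
      _ = _ := by ring
  have : 0 ≤ ccoef v k ^ 2 + scoef v k ^ 2 := by positivity
  nlinarith

/-- A function on the torus with vanishing weak gradient is constant. -/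
lemma HasWeakGrad.ae_eq_const (hv : MemLp v 2) (h : HasWeakGrad v g) (hg : g =ᵐ[volume] 0) :
    ∀ᵐ x, v x = ∫ y, v y := by
  have hg2 : MemLp g 2 := (memLp_congr_ae hg).2 MemLp.zero
  have h0 : ∫ x, ‖g x‖ ^ 2 = 0 := by
    rw [integral_congr_ae (g := fun _ => (0 : ℝ))]
    · simp
    · filter_upwards [hg] with x hx; simp [hx]
  -- The Poincaré inequality on a singleton removes each nonzero frequency. Parseval then leaves
  -- only the mean, so the variance of v vanishes.
  have hz : ∀ k : Fin d → ℤ, k ≠ 0 → ccoef v k ^ 2 + scoef v k ^ 2 = 0 := by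
    intro k hk
    have := h.sum_sq_coef_le hg2 (F := {k}) (by simpa using hk.symm)
    rw [h0, Finset.sum_singleton] at this
    exact le_antisymm (by linarith) (by positivity)
  have hs := hasSum_sq_coef hv
  have hs' := hs.unique (hasSum_single 0 hz)
  have c0 : ccoef v 0 = ∫ y, v y := by simp [ccoef, tcos_zero]
  have s0 : scoef v 0 = 0 := by simp [scoef, tsin_zero]
  rw [c0, s0] at hs'
  set m := ∫ y, v y
  have hvi : Integrable v := hv.integrable (by norm_num)
  have e : ∫ x, (v x - m) ^ 2 = 0 := by
    have : ∀ x, (v x - m) ^ 2 = v x ^ 2 - 2 * m * v x + m ^ 2 := fun x => by ring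
    simp only [this]
    have hA : Integrable (fun x => v x ^ 2 - 2 * m * v x) :=
      hv.integrable_sq.sub (hvi.const_mul _)
    rw [integral_add hA (integrable_const _),
      integral_sub hv.integrable_sq (hvi.const_mul _), integral_const_mul, hs']
    simp; ring
  have hi : Integrable (fun x => (v x - m) ^ 2) := (hv.sub (memLp_const m)).integrable_sq
  rw [integral_eq_zero_iff_of_nonneg (fun x => sq_nonneg _) hi] at e
  filter_upwards [e] with x hx
  have : (v x - m) ^ 2 = 0 := hx
  nlinarith [pow_eq_zero_iff (two_ne_zero) |>.1 this]

end WeakGrad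
end ScalarCD

/-! ### Smooth approximation and the chain rule in H¹ -/

namespace ScalarCD

/-- The **Cauchy–Schwarz inequality** for integrals. -/
lemma abs_integral_mul_le_sqrt {X : Type*} [MeasurableSpace X] {μ : Measure X} {a b : X → ℝ}
    (ha : MemLp a 2 μ) (hb : MemLp b 2 μ) :
    |∫ x, a x * b x ∂μ| ≤ √(∫ x, a x ^ 2 ∂μ) * √(∫ x, b x ^ 2 ∂μ) := by
  have h := integral_mul_norm_le_Lp_mul_Lq (μ := μ) (f := a) (g := b) (p := 2) (q := 2)
    (by constructor <;> norm_num) (by simpa using ha) (by simpa using hb)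
  refine (abs_integral_le_integral_abs).trans ?_
  simp only [abs_mul]
  refine h.trans (le_of_eq ?_)
  rw [Real.sqrt_eq_rpow, Real.sqrt_eq_rpow]
  simp

/-- The splitting pq - ab = (p - a)(q - b) + (p - a)b + a(q - b), with the Cauchy–Schwarz inequality
for each term. -/
lemma tendsto_integral_mul {X : Type*} [MeasurableSpace X] {μ : Measure X} {a b : X → ℝ}
    {p q : ℕ → X → ℝ} (hp : ∀ n, MemLp (p n) 2 μ) (hq : ∀ n, MemLp (q n) 2 μ)
    (ha : MemLp a 2 μ) (hb : MemLp b 2 μ)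
    (hpa : Filter.Tendsto (fun n => ∫ x, (p n x - a x) ^ 2 ∂μ) Filter.atTop (nhds 0))
    (hqb : Filter.Tendsto (fun n => ∫ x, (q n x - b x) ^ 2 ∂μ) Filter.atTop (nhds 0)) :
    Filter.Tendsto (fun n => ∫ x, p n x * q n x ∂μ) Filter.atTop (nhds (∫ x, a x * b x ∂μ)) := by
  have hpa' := (Real.continuous_sqrt.tendsto 0).comp hpa
  have hqb' := (Real.continuous_sqrt.tendsto 0).comp hqb
  rw [Real.sqrt_zero] at hpa' hqb'
  have hlim : Filter.Tendsto (fun n => √(∫ x, (p n x - a x) ^ 2 ∂μ) * √(∫ x, (q n x - b x) ^ 2 ∂μ)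
      + √(∫ x, (p n x - a x) ^ 2 ∂μ) * √(∫ x, b x ^ 2 ∂μ)
      + √(∫ x, a x ^ 2 ∂μ) * √(∫ x, (q n x - b x) ^ 2 ∂μ)) Filter.atTop (nhds 0) := by
    simpa using ((hpa'.mul hqb').add (hpa'.mul_const _)).add (hqb'.const_mul _)
  rw [tendsto_iff_dist_tendsto_zero]
  refine squeeze_zero (fun _ => dist_nonneg) (fun n => ?_) hlim
  have m1 := (hp n).sub ha
  have m2 := (hq n).sub hb
  have e : ∫ x, p n x * q n x ∂μ - ∫ x, a x * b x ∂μ =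
      ∫ x, (p n x - a x) * (q n x - b x) ∂μ + ∫ x, (p n x - a x) * b x ∂μ
        + ∫ x, a x * (q n x - b x) ∂μ := by
    have i1 : Integrable (fun x => (p n x - a x) * (q n x - b x)) μ := m1.integrable_mul m2
    have i2 : Integrable (fun x => (p n x - a x) * b x) μ := m1.integrable_mul hb
    have i3 : Integrable (fun x => a x * (q n x - b x)) μ := ha.integrable_mul m2
    have i4 : Integrable (fun x => p n x * q n x) μ := (hp n).integrable_mul (hq n)
    have i5 : Integrable (fun x => a x * b x) μ := ha.integrable_mul hb
    have i12 : Integrable (fun x => (p n x - a x) * (q n x - b x) + (p n x - a x) * b x) μ :=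
      i1.add i2
    rw [← integral_sub i4 i5, ← integral_add i1 i2, ← integral_add i12 i3]
    refine integral_congr_ae (Filter.Eventually.of_forall fun x => ?_)
    ring
  rw [Real.dist_eq, e]
  exact (abs_add_three _ _ _).trans (add_le_add (add_le_add (abs_integral_mul_le_sqrt m1 m2)
    (abs_integral_mul_le_sqrt m1 hb)) (abs_integral_mul_le_sqrt ha m2))

variable {d : ℕ}

/-- Almost everywhere convergence needs a sequence instead of the net of all finite sets. L²
convergence along a sequence gives convergence in measure, hence a.e. along a subsequence. -/
lemma exists_seq_trigProj {v : Td d → ℝ} (hv : MemLp v 2) :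
    ∃ F : ℕ → Finset (Fin d → ℤ), Filter.Tendsto F Filter.atTop Filter.atTop ∧
      ∀ᵐ x, Filter.Tendsto (fun n => trigProj (F n) v x) Filter.atTop (nhds (v x)) := by
  obtain ⟨F, hF⟩ := Filter.exists_seq_tendsto (Filter.atTop : Filter (Finset (Fin d → ℤ)))
  have hp : ∀ F, MemLp (trigProj F v) 2 := fun F =>
    memLp_of_continuous (isSmooth_trigSum F _ _).continuous
  have h := (tendsto_trigProj hv).comp hF
  have hL : Filter.Tendsto (fun n => eLpNorm (trigProj (F n) v - v) 2 volume)
      Filter.atTop (nhds 0) := by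
    have e : ∀ n, eLpNorm (trigProj (F n) v - v) 2 volume =
        ENNReal.ofReal (√(∫ x, (trigProj (F n) v x - v x) ^ 2)) := by
      intro n
      rw [((hp _).sub hv).eLpNorm_eq_integral_rpow_norm (by norm_num) (by norm_num)]
      congr 1
      rw [Real.sqrt_eq_rpow]
      simp
    simp only [e]
    have := (Real.continuous_sqrt.tendsto 0).comp h
    rw [Real.sqrt_zero] at this
    have h' := (ENNReal.continuous_ofReal.tendsto 0).comp this
    rw [ENNReal.ofReal_zero] at h'
    exact h'
  have hm := tendstoInMeasure_of_tendsto_eLpNorm (p := 2) (by norm_num)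
    (fun n => (hp (F n)).1) hv.1 hL
  obtain ⟨ns, hns, hae⟩ := hm.exists_seq_tendsto_ae
  exact ⟨F ∘ ns, hF.comp hns.tendsto_atTop, hae⟩

/-- By translation invariance s ↦ ∫ ψ(x + s eᵢ) is constant, so its derivative vanishes. Smoothness
of ψ is not required, which allows products g(p) q with g only C¹. -/
lemma integral_eq_zero_of_hasDerivAt {ψ ψ' : Td d → ℝ} (hψ : Continuous ψ) (hψ' : Continuous ψ')
    (i : Fin d) (h : ∀ (x : Td d) (s : ℝ), HasDerivAt (fun s : ℝ => ψ (x + Pi.single i (s : UnitAddCircle)))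
      (ψ' (x + Pi.single i (s : UnitAddCircle))) s) : ∫ x, ψ' x = 0 := by
  obtain ⟨C, hC⟩ := (isCompact_univ (X := Td d)).exists_bound_of_continuousOn hψ'.continuousOn
  have ht : ∀ s : ℝ, Continuous (fun x : Td d => x + Pi.single i (s : UnitAddCircle)) :=
    fun s => continuous_id.add continuous_const
  have m1 : ∀ s : ℝ, Continuous (fun x : Td d => ψ (x + Pi.single i (s : UnitAddCircle))) :=
    fun s => hψ.comp (ht s)
  have m2 : Continuous (fun x : Td d => ψ' (x + Pi.single i ((0 : ℝ) : UnitAddCircle))) :=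
    hψ'.comp (ht 0)
  have h2 := hasDerivAt_integral_of_bound (μ := (volume : Measure (Td d))) (C := C)
      (F := fun (s : ℝ) (x : Td d) => ψ (x + Pi.single i (s : UnitAddCircle)))
      (F' := fun (s : ℝ) (x : Td d) => ψ' (x + Pi.single i (s : UnitAddCircle)))
      (fun s => (m1 s).aestronglyMeasurable) (integrable_of_continuous (m1 0))
      m2.aestronglyMeasurable (fun x s => hC _ (mem_univ _))
      (integrable_of_continuous continuous_const) h
  have c1 : (fun s : ℝ => ∫ x : Td d, ψ (x + Pi.single i (s : UnitAddCircle)))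
      = fun _ => ∫ x, ψ x := funext fun s => integral_add_right_eq_self ψ _
  have c2 : ∀ x : Td d, ψ' (x + Pi.single i ((0 : ℝ) : UnitAddCircle)) = ψ' x := by
    intro x
    rw [AddCircle.coe_zero, Pi.single_zero, add_zero]
  simp only [c1, c2] at h2
  exact h2.unique (hasDerivAt_const _ _)

/-- An `L²` function whose weak gradient is `g ∈ L²`. -/
structure IsH1 (v : Td d → ℝ) (g : Td d → EuclideanSpace ℝ (Fin d)) : Prop where
  memLp : MemLp v 2
  memLp_grad : MemLp g 2
  weak : HasWeakGrad v g

lemma IsSmooth.isH1 {ψ : Td d → ℝ} (hψ : IsSmooth ψ) : IsH1 ψ (grad ψ) :=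
  ⟨memLp_of_continuous hψ.continuous, memLp_of_continuous (continuous_grad hψ), hψ.hasWeakGrad⟩

/-- L² convergence serves the factors that enter linearly, a.e. convergence the nonlinear factor
g'(v) in the chain rule. -/
lemma IsH1.exists_approx {v : Td d → ℝ} {g : Td d → EuclideanSpace ℝ (Fin d)} (h : IsH1 v g) :
    ∃ p : ℕ → Td d → ℝ, (∀ n, IsSmooth (p n)) ∧
      (∀ᵐ x, Filter.Tendsto (fun n => p n x) Filter.atTop (nhds (v x))) ∧
      Filter.Tendsto (fun n => ∫ x, (p n x - v x) ^ 2) Filter.atTop (nhds 0) ∧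
      ∀ i, Filter.Tendsto (fun n => ∫ x, (pd i (p n) x - g x i) ^ 2) Filter.atTop (nhds 0) := by
  obtain ⟨F, hF, hae⟩ := exists_seq_trigProj h.memLp
  refine ⟨fun n => trigProj (F n) v, fun n => isSmooth_trigSum _ _ _, hae,
    (tendsto_trigProj h.memLp).comp hF, fun i => ?_⟩
  simp only [h.weak.pd_trigProj]
  exact (tendsto_trigProj (memLp_coord h.memLp_grad i)).comp hF

/-- Integration by parts and the chain rule for `H¹` functions on the torus. -/
theorem IsH1.integral_comp_mul_grad {v z : Td d → ℝ} {Dv Dz : Td d → EuclideanSpace ℝ (Fin d)}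
    (hv : IsH1 v Dv) (hz : IsH1 z Dz) {g g' : ℝ → ℝ} (hg : ∀ s, HasDerivAt g (g' s) s)
    (hg' : Continuous g') {C : ℝ} (hC : ∀ s, |g' s| ≤ C) (i : Fin d) :
    ∫ x, g (v x) * Dz x i = -∫ x, (g' (v x) * z x) * Dv x i := by
  obtain ⟨p, hps, hpae, hp, hDp⟩ := hv.exists_approx
  obtain ⟨q, hqs, -, hq, hDq⟩ := hz.exists_approx
  have hC0 : 0 ≤ C := (abs_nonneg _).trans (hC 0)
  have hgc : Continuous g := continuous_iff_continuousAt.2 fun s => (hg s).continuousAt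
  have hlip : ∀ s t, |g s - g t| ≤ C * |s - t| := by
    intro s t
    have := Convex.norm_image_sub_le_of_norm_hasDerivWithin_le (f := g) (f' := g') (C := C)
      (s := univ) (fun x _ => (hg x).hasDerivWithinAt) (fun x _ => hC x) convex_univ
      (mem_univ t) (mem_univ s)
    simpa using this
  have mp : ∀ n, MemLp (p n) 2 := fun n => memLp_of_continuous (hps n).continuous
  have mq : ∀ n, MemLp (q n) 2 := fun n => memLp_of_continuous (hqs n).continuous
  have mDp : ∀ n, MemLp (pd i (p n)) 2 := fun n => memLp_of_continuous ((hps n).continuous_pd i)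
  have mDq : ∀ n, MemLp (pd i (q n)) 2 := fun n => memLp_of_continuous ((hqs n).continuous_pd i)
  have mDv := memLp_coord hv.memLp_grad i
  have mDz := memLp_coord hz.memLp_grad i
  have mg : ∀ {w : Td d → ℝ}, MemLp w 2 → MemLp (fun x => g (w x)) 2 := by
    intro w hw
    have : MemLp (fun x => C * ‖w x‖ + |g 0|) 2 := (hw.norm.const_mul C).add (memLp_const _)
    refine this.of_le (hgc.comp_aestronglyMeasurable hw.1) (Filter.Eventually.of_forall fun x => ?_)
    have h1 := hlip (w x) 0
    have h2 : |g (w x)| ≤ |g (w x) - g 0| + |g 0| := by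
      simpa using abs_add_le (g (w x) - g 0) (g 0)
    rw [Real.norm_eq_abs, Real.norm_eq_abs, Real.norm_eq_abs]
    rw [sub_zero] at h1
    exact (h2.trans (by linarith)).trans (le_abs_self _)
  have mg' : ∀ {w y : Td d → ℝ}, MemLp w 2 → MemLp y 2 → MemLp (fun x => g' (w x) * y x) 2 := by
    intro w y hw hy
    refine (hy.const_mul C).of_le ((hg'.comp_aestronglyMeasurable hw.1).mul hy.1)
      (Filter.Eventually.of_forall fun x => ?_)
    rw [norm_mul, norm_mul, Real.norm_eq_abs, Real.norm_eq_abs C, abs_of_nonneg hC0]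
    exact mul_le_mul_of_nonneg_right (hC _) (norm_nonneg _)
  -- For the approximations the identity is the vanishing of ∫ ∂ᵢ(g(p) q).
  have key : ∀ n, ∫ x, g (p n x) * pd i (q n) x = -∫ x, (g' (p n x) * q n x) * pd i (p n) x := by
    intro n
    have h0 := integral_eq_zero_of_hasDerivAt (ψ := fun x => g (p n x) * q n x)
      (ψ' := fun x => g' (p n x) * pd i (p n) x * q n x + g (p n x) * pd i (q n) x)
      ((hgc.comp (hps n).continuous).mul (hqs n).continuous)
      ((((hg'.comp (hps n).continuous).mul ((hps n).continuous_pd i)).mul (hqs n).continuous).add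
        ((hgc.comp (hps n).continuous).mul ((hqs n).continuous_pd i))) i
      (fun x s => ((hg _).comp s ((hps n).hasDerivAt i x s)).mul ((hqs n).hasDerivAt i x s))
    have e : ∀ x, g' (p n x) * pd i (p n) x * q n x + g (p n x) * pd i (q n) x =
      (g' (p n x) * q n x) * pd i (p n) x + g (p n x) * pd i (q n) x := fun x => by ring
    simp only [e] at h0
    have i1 : Integrable (fun x => (g' (p n x) * q n x) * pd i (p n) x) :=
      (mg' (mp n) (mq n)).integrable_mul (mDp n)
    have i2 : Integrable (fun x => g (p n x) * pd i (q n) x) :=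
      (mg (mp n)).integrable_mul (mDq n)
    rw [integral_add i1 i2] at h0
    linarith
  have l1 : Filter.Tendsto (fun n => ∫ x, g (p n x) * pd i (q n) x) Filter.atTop
      (nhds (∫ x, g (v x) * Dz x i)) := by
    refine tendsto_integral_mul (fun n => mg (mp n)) mDq (mg hv.memLp) mDz ?_ (hDq i)
    refine squeeze_zero (fun n => integral_nonneg fun x => sq_nonneg _) (fun n => ?_)
      (by simpa using hp.const_mul (C ^ 2))
    rw [← integral_const_mul]
    refine integral_mono ((mg (mp n)).sub (mg hv.memLp)).integrable_sq
      (((mp n).sub hv.memLp).integrable_sq.const_mul _) fun x => ?_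
    have := hlip (p n x) (v x)
    have h2 := pow_le_pow_left₀ (abs_nonneg _) this 2
    rw [mul_pow, sq_abs, sq_abs] at h2
    exact h2
  have l2 : Filter.Tendsto (fun n => ∫ x, (g' (p n x) * q n x) * pd i (p n) x) Filter.atTop
      (nhds (∫ x, (g' (v x) * z x) * Dv x i)) := by
    refine tendsto_integral_mul (fun n => mg' (mp n) (mq n)) mDp (mg' hv.memLp hz.memLp) mDv ?_
      (hDp i)
    -- As g' is merely continuous and bounded, no Lipschitz bound on g'(p n) - g'(v) is available.
    -- Dominated convergence with majorant (2C)² z² replaces it.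
    have hd : Filter.Tendsto (fun n => ∫ x, ((g' (p n x) - g' (v x)) * z x) ^ 2) Filter.atTop
        (nhds 0) := by
      have h0 : ∫ x : Td d, (0 : ℝ) = 0 := by simp
      rw [← h0]
      refine tendsto_integral_of_dominated_convergence (fun x => (2 * C) ^ 2 * z x ^ 2)
        (fun n => ?_) (hz.memLp.integrable_sq.const_mul _) (fun n => ?_) ?_
      · exact ((((hg'.comp_aestronglyMeasurable (mp n).1).sub
          (hg'.comp_aestronglyMeasurable hv.memLp.1)).mul hz.memLp.1).pow 2)
      · refine Filter.Eventually.of_forall fun x => ?_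
        rw [Real.norm_eq_abs, abs_of_nonneg (sq_nonneg _), mul_pow]
        refine mul_le_mul_of_nonneg_right ?_ (sq_nonneg _)
        rw [← sq_abs]
        refine pow_le_pow_left₀ (abs_nonneg _) ?_ 2
        exact (abs_sub _ _).trans (by linarith [hC (p n x), hC (v x)])
      · filter_upwards [hpae] with x hx
        have := (((hg'.tendsto _).comp hx).sub_const (g' (v x))).mul_const (z x)
        simpa using this.pow 2
    refine squeeze_zero (fun n => integral_nonneg fun x => sq_nonneg _) (fun n => ?_)
      (by simpa using (hq.const_mul (2 * C ^ 2)).add (hd.const_mul 2))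
    have iq : Integrable (fun x => (q n x - z x) ^ 2) := ((mq n).sub hz.memLp).integrable_sq
    have iz : Integrable (fun x => ((g' (p n x) - g' (v x)) * z x) ^ 2) := by
      have := ((mg' (mp n) hz.memLp).sub (mg' hv.memLp hz.memLp)).integrable_sq
      refine this.congr (Filter.Eventually.of_forall fun x => ?_)
      simp only [Pi.sub_apply]; ring
    rw [← integral_const_mul, ← integral_const_mul,
      ← integral_add (iq.const_mul _) (iz.const_mul _)]
    refine integral_mono ((mg' (mp n) (mq n)).sub (mg' hv.memLp hz.memLp)).integrable_sq
      ((iq.const_mul _).add (iz.const_mul _)) fun x => ?_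
    have h1 : g' (p n x) ^ 2 ≤ C ^ 2 := by
      rw [← sq_abs]; exact pow_le_pow_left₀ (abs_nonneg _) (hC _) 2
    have h2 : (g' (p n x)) ^ 2 * (q n x - z x) ^ 2 ≤ C ^ 2 * (q n x - z x) ^ 2 :=
      mul_le_mul_of_nonneg_right h1 (sq_nonneg _)
    nlinarith [sq_nonneg (g' (p n x) * (q n x - z x) - (g' (p n x) - g' (v x)) * z x)]
  refine tendsto_nhds_unique l1 ?_
  simp only [key]
  exact l2.neg

end ScalarCD

/-! ### Localization by smooth test functions, gaps in the values of H¹ functions, gradients of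
Lipschitz functions -/

namespace ScalarCD

variable {d : ℕ}

/-- Smooth functions are uniformly dense in the continuous functions on the torus. -/
lemma exists_isSmooth_near {ψ : Td d → ℝ} (hψ : Continuous ψ) {δ : ℝ} (hδ : 0 < δ) :
    ∃ χ : Td d → ℝ, IsSmooth χ ∧ ∀ x, |χ x - ψ x| ≤ δ := by
  let f : C(Td d, ℂ) := ⟨fun x => (ψ x : ℂ), Complex.continuous_ofReal.comp hψ⟩
  have hf : f ∈ (Submodule.span ℂ
      (range (UnitAddTorus.mFourier (d := Fin d)))).topologicalClosure := by
    rw [UnitAddTorus.span_mFourier_closure_eq_top]; trivial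
  obtain ⟨g, hg, hgf⟩ := Metric.mem_closure_iff.1 hf δ hδ
  have hs : IsSmooth (fun x => (g x).re) ∧ IsSmooth (fun x => (g x).im) := by
    -- Multiplication by complex scalars mixes real and imaginary parts, so the induction carries
    -- both.
    refine Submodule.span_induction (p := fun g _ => IsSmooth (fun x => (g x).re) ∧
      IsSmooth (fun x => (g x).im)) ?_ ?_ ?_ ?_ hg
    · rintro _ ⟨k, rfl⟩
      exact ⟨isSmooth_tcos k, isSmooth_tsin k⟩
    · exact ⟨by simpa using isSmooth_const 0, by simpa using isSmooth_const 0⟩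
    · rintro f g - - ⟨h1, h2⟩ ⟨h3, h4⟩
      exact ⟨ContDiff.add h1 h3, ContDiff.add h2 h4⟩
    · rintro c f - ⟨h1, h2⟩
      constructor
      · exact ContDiff.sub (contDiff_const (c := c.re).mul h1)
          (contDiff_const (c := c.im).mul h2)
      · exact ContDiff.add (contDiff_const (c := c.re).mul h2)
          (contDiff_const (c := c.im).mul h1)
  refine ⟨_, hs.1, fun x => ?_⟩
  have h1 : ‖g x - f x‖ ≤ δ := by
    rw [← dist_eq_norm, dist_comm]
    exact (ContinuousMap.dist_apply_le_dist x).trans hgf.le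
  have h2 := (Complex.abs_re_le_norm (g x - f x)).trans h1
  simpa [f] using h2

/-- A function whose integral against each nonnegative smooth function is nonnegative is
nonnegative almost everywhere. -/
theorem ae_nonneg_of_integral_mul_smooth {g : Td d → ℝ} (hg : Integrable g)
    (h : ∀ ψ : Td d → ℝ, IsSmooth ψ → (∀ x, 0 ≤ ψ x) → 0 ≤ ∫ x, g x * ψ x) :
    ∀ᵐ x, 0 ≤ g x := by
  have hc : ∀ ψ : Td d → ℝ, Continuous ψ → (∀ x, 0 ≤ ψ x) → 0 ≤ ∫ x, g x * ψ x := by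
    intro ψ hψ h0
    refine le_of_forall_pos_le_add fun e he => ?_
    set M := ∫ x, |g x|
    have hM : 0 ≤ M := integral_nonneg fun x => abs_nonneg _
    obtain ⟨χ, hχ, hχn⟩ := exists_isSmooth_near hψ (δ := e / (2 * (M + 1))) (by positivity)
    set δ := e / (2 * (M + 1))
    have hδ : 0 < δ := by positivity
    -- The approximation may dip to -δ; adding δ makes it an admissible nonnegative test function,
    -- at a total distance of at most 2δ from ψ.
    have hs : IsSmooth (fun x => χ x + δ) := ContDiff.add hχ contDiff_const
    have h1 := h _ hs (fun x => by have := abs_le.1 (hχn x); linarith [h0 x])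
    have h2 : (∫ x, g x * (χ x + δ)) - ∫ x, g x * ψ x ≤ 2 * δ * M := by
      rw [← integral_sub (hg.mul_continuous hs.continuous) (hg.mul_continuous hψ),
        ← integral_const_mul]
      refine integral_mono ((hg.mul_continuous hs.continuous).sub (hg.mul_continuous hψ))
        (hg.abs.const_mul _) fun x => ?_
      have a1 : |χ x + δ - ψ x| ≤ 2 * δ := by
        have := abs_le.1 (hχn x)
        rw [abs_le]; constructor <;> linarith
      calc g x * (χ x + δ) - g x * ψ x = g x * (χ x + δ - ψ x) := by ring
        _ ≤ |g x| * |χ x + δ - ψ x| := by rw [← abs_mul]; exact le_abs_self _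
        _ ≤ |g x| * (2 * δ) := mul_le_mul_of_nonneg_left a1 (abs_nonneg _)
        _ = _ := by ring
    have h3 : 2 * δ * M ≤ e := by
      have : 2 * δ * (M + 1) = e := by simp only [δ]; field_simp
      nlinarith
    linarith
  -- Thickened indicators pass from continuous test functions to closed sets. Inner regularity then
  -- shows that {g < 0} is null, since each closed subset of it is.
  have hF : ∀ F : Set (Td d), IsClosed F → 0 ≤ ∫ x in F, g x := by
    intro F hF
    have hδ : ∀ n : ℕ, (0 : ℝ) < 1 / (n + 1) := fun n => Nat.one_div_pos_of_nat
    have hlim : Filter.Tendsto (fun n : ℕ => ∫ x, g x *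
        ((thickenedIndicator (hδ n) F x : NNReal) : ℝ)) Filter.atTop
        (nhds (∫ x, g x * F.indicator (fun _ => (1 : ℝ)) x)) := by
      have hpt := thickenedIndicator_tendsto_indicator_closure hδ
        tendsto_one_div_add_atTop_nhds_zero_nat F
      rw [hF.closure_eq] at hpt
      refine tendsto_integral_of_dominated_convergence (fun x => ‖g x‖) (fun n => ?_) hg.norm
        (fun n => ?_) (Filter.Eventually.of_forall fun x => ?_)
      · exact hg.1.mul (NNReal.continuous_coe.comp
          (thickenedIndicator (hδ n) F).continuous).aestronglyMeasurable
      · refine Filter.Eventually.of_forall fun x => ?_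
        rw [norm_mul]
        refine mul_le_of_le_one_right (norm_nonneg _) ?_
        rw [Real.norm_eq_abs, abs_of_nonneg (NNReal.coe_nonneg _)]
        exact_mod_cast thickenedIndicator_le_one (hδ n) F x
      · have h1 := (NNReal.continuous_coe.tendsto _).comp (tendsto_pi_nhds.1 hpt x)
        have h2 : ((F.indicator (fun _ => (1 : NNReal)) x : NNReal) : ℝ) =
            F.indicator (fun _ => (1 : ℝ)) x := by
          by_cases hx : x ∈ F <;> simp [hx]
        rw [h2] at h1
        exact h1.const_mul (g x)
    have h1 : 0 ≤ ∫ x, g x * F.indicator (fun _ => (1 : ℝ)) x :=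
      ge_of_tendsto' hlim fun n => hc _ (NNReal.continuous_coe.comp
          (thickenedIndicator (hδ n) F).continuous) fun x => NNReal.coe_nonneg _
    have h2 : (fun x => g x * F.indicator (fun _ => (1 : ℝ)) x) = F.indicator g := by
      funext x
      by_cases hx : x ∈ F <;> simp [hx]
    rwa [h2, integral_indicator hF.measurableSet] at h1
  set g₀ := hg.1.mk g
  have hg₀ : g =ᵐ[volume] g₀ := hg.1.ae_eq_mk
  have hm : Measurable g₀ := hg.1.stronglyMeasurable_mk.measurable
  have hS : MeasurableSet {x | g₀ x < 0} := measurableSet_lt hm measurable_const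
  have h0 : volume {x : Td d | g₀ x < 0} = 0 := by
    rw [hS.measure_eq_iSup_isClosed_of_ne_top (measure_ne_top _ _)]
    simp only [ENNReal.iSup_eq_zero]
    intro F hFS hFc
    have h1 := hF F hFc
    rw [integral_congr_ae (ae_restrict_of_ae hg₀)] at h1
    have hi : IntegrableOn g₀ F := (hg.congr hg₀).integrableOn
    have h2 : 0 ≤ᵐ[volume.restrict F] fun x => -g₀ x := by
      filter_upwards [ae_restrict_mem hFc.measurableSet] with x hx
      have : g₀ x < 0 := hFS hx
      simp only [Pi.zero_apply]; linarith
    have h3 : ∫ x in F, -g₀ x = 0 := by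
      have := integral_nonneg_of_ae h2
      rw [integral_neg] at this ⊢
      linarith
    rw [integral_eq_zero_iff_of_nonneg_ae h2 hi.neg] at h3
    have h4 : ∀ᵐ x ∂(volume.restrict F), False := by
      filter_upwards [h3, ae_restrict_mem hFc.measurableSet] with x hx hxF
      have : g₀ x < 0 := hFS hxF
      simp only [Pi.zero_apply] at hx
      linarith
    have := ae_iff.1 h4
    simpa using this
  have : ∀ᵐ x : Td d, ¬ g₀ x < 0 := by rw [ae_iff]; simpa using h0
  filter_upwards [this, hg₀] with x hx hx'
  rw [hx']; exact not_lt.1 hx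

/-- A continuous function on a compact set of reals extends to a bounded continuous function. -/
lemma exists_bounded_extension {K : Set ℝ} (hK : IsCompact K) {h : ℝ → ℝ}
    (hh : ContinuousOn h K) :
    ∃ H : ℝ → ℝ, Continuous H ∧ (∃ C, ∀ s, |H s| ≤ C) ∧ ∀ s ∈ K, H s = h s := by
  obtain ⟨C, hC⟩ := hK.exists_bound_of_continuousOn hh
  obtain ⟨g, hg⟩ := ContinuousMap.exists_restrict_eq hK.isClosed ⟨K.domRestrict h, hh.domRestrict⟩
  refine ⟨fun s => max (-|C|) (min |C| (g s)), by fun_prop, ⟨|C|, fun s => ?_⟩, fun s hs => ?_⟩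
  · rw [abs_le]
    exact ⟨le_max_left _ _, max_le (by linarith [abs_nonneg C]) (min_le_left _ _)⟩
  · have h1 : g s = h s := DFunLike.congr_fun hg (⟨s, hs⟩ : K)
    have h2 := abs_le.1 ((hC s hs).trans (le_abs_self C))
    simp only [h1]
    rw [min_eq_right h2.2, max_eq_right h2.1]

lemma hasDerivAt_primitive {H : ℝ → ℝ} (hH : Continuous H) (a s : ℝ) :
    HasDerivAt (fun s => ∫ r in a..s, H r) (H s) s :=
  intervalIntegral.integral_hasDerivAt_right (hH.intervalIntegrable _ _)
    hH.stronglyMeasurable.stronglyMeasurableAtFilter hH.continuousAt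

/-- A `C¹` function on a compact interval extends to a `C¹` function with bounded derivative. -/
lemma exists_C1_extension {a b : ℝ} {f f' : ℝ → ℝ} (hf : ∀ s ∈ Icc a b, HasDerivAt f (f' s) s)
    (hf' : ContinuousOn f' (Icc a b)) :
    ∃ g g' : ℝ → ℝ, (∀ s, HasDerivAt g (g' s) s) ∧ Continuous g' ∧ (∃ C, ∀ s, |g' s| ≤ C) ∧
      ∀ s ∈ Icc a b, g s = f s ∧ g' s = f' s := by
  obtain ⟨H, hH, hb, he⟩ := exists_bounded_extension isCompact_Icc hf'
  refine ⟨fun s => f a + ∫ r in a..s, H r, H, fun s => (hasDerivAt_primitive hH a s).const_add _,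
    hH, hb, fun s hs => ⟨?_, he s hs⟩⟩
  have h1 : ∫ r in a..s, H r = f s - f a := by
    refine intervalIntegral.integral_eq_sub_of_hasDerivAt (fun r hr => ?_)
      (hH.intervalIntegrable _ _)
    rw [uIcc_of_le hs.1] at hr
    have hr' : r ∈ Icc a b := ⟨hr.1, hr.2.trans hs.2⟩
    rw [he r hr']
    exact hf r hr'
  simp only [h1]; ring

lemma grad_const (c : ℝ) : grad (fun _ : Td d => c) = 0 := by
  funext x
  ext i
  simp [grad, pd]

/-- The integrand is the i-th derivative of a primitive of h evaluated at v. The chain rule is used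
with z = 1, after extending h from K to a bounded continuous function. -/
lemma IsH1.integral_mul_grad_eq_zero {v : Td d → ℝ} {Dv : Td d → EuclideanSpace ℝ (Fin d)}
    (hv : IsH1 v Dv) {K : Set ℝ} (hK : IsCompact K) (hvK : ∀ᵐ x, v x ∈ K) {h : ℝ → ℝ}
    (hh : ContinuousOn h K) (i : Fin d) : ∫ x, h (v x) * Dv x i = 0 := by
  obtain ⟨H, hH, ⟨C, hC⟩, he⟩ := exists_bounded_extension hK hh
  have h1 := hv.integral_comp_mul_grad (isSmooth_const (d := d) 1).isH1
    (hasDerivAt_primitive hH 0) hH hC i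
  simp only [grad_const, Pi.zero_apply, PiLp.zero_apply, mul_zero, integral_zero, mul_one] at h1
  rw [← neg_eq_zero, h1]
  refine congrArg _ (integral_congr_ae ?_)
  filter_upwards [hvK] with x hx
  rw [he _ hx]

/-- An `H¹` function on the torus does not jump over a gap in its set of values. -/
theorem IsH1.lt_or_gt {v : Td d → ℝ} {Dv : Td d → EuclideanSpace ℝ (Fin d)}
    (hv : IsH1 v Dv) {K : Set ℝ} (hK : IsClosed K) (hvK : ∀ᵐ x, v x ∈ K) {c : ℝ} (hc : c ∉ K) :
    (∀ᵐ x, v x < c) ∨ ∀ᵐ x, c < v x := by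
  have hne : K.Nonempty := by
    obtain ⟨x, hx⟩ := hvK.exists
    exact ⟨_, hx⟩
  -- H vanishes on K and is positive at c. Its primitive g, based at c, therefore has the strict
  -- sign of s - c, although g is locally constant where K has interior.
  set H : ℝ → ℝ := fun s => min 1 (Metric.infDist s K)
  have hH : Continuous H := continuous_const.min (Metric.continuous_infDist_pt K)
  have hH0 : ∀ s, 0 ≤ H s := fun s => le_min zero_le_one Metric.infDist_nonneg
  have hHb : ∀ s, |H s| ≤ 1 := fun s => by
    rw [abs_of_nonneg (hH0 s)]; exact min_le_left _ _
  have hHK : ∀ s ∈ K, H s = 0 := fun s hs => by simp [H, Metric.infDist_zero_of_mem hs]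
  have hHc : 0 < H c := lt_min one_pos ((hK.notMem_iff_infDist_pos hne).1 hc)
  set g : ℝ → ℝ := fun s => ∫ r in c..s, H r
  have hgd : ∀ s, HasDerivAt g (H s) s := hasDerivAt_primitive hH c
  have hgc : Continuous g := continuous_iff_continuousAt.2 fun s => (hgd s).continuousAt
  have hgpos : ∀ s, c < s → 0 < g s := fun s hs =>
    intervalIntegral.integral_pos hs hH.continuousOn (fun r _ => hH0 r)
      ⟨c, left_mem_Icc.2 hs.le, hHc⟩
  have hgneg : ∀ s, s < c → g s < 0 := fun s hs => by
    have : 0 < ∫ r in s..c, H r := intervalIntegral.integral_pos hs hH.continuousOn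
      (fun r _ => hH0 r) ⟨c, right_mem_Icc.2 hs.le, hHc⟩
    simp only [g]
    rw [intervalIntegral.integral_symm]; linarith
  have hgb : ∀ s, |g s| ≤ |s - c| := fun s => by
    have := intervalIntegral.norm_integral_le_of_norm_le_const (a := c) (b := s) (f := H) (C := 1)
      (fun x _ => hHb x)
    simpa using this
  have hgL : MemLp (fun x => g (v x)) 2 :=
    (hv.memLp.sub (memLp_const c)).of_le (hgc.comp_aestronglyMeasurable hv.memLp.1)
      (Filter.Eventually.of_forall fun x => hgb _)
  -- The weak gradient of g(v) is H(v)∇v, and H(v) = 0 a.e. Hence g(v) is constant and v lies on one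
  -- side of c.
  have hw : HasWeakGrad (fun x => g (v x)) (0 : Td d → EuclideanSpace ℝ (Fin d)) := by
    refine ⟨hgL.integrable (by norm_num), integrable_zero _ _ _, fun ψ hψ i => ?_⟩
    have h1 := hv.integral_comp_mul_grad hψ.isH1 hgd hH hHb i
    simp only [grad] at h1
    rw [h1, integral_congr_ae (g := fun _ => (0 : ℝ))]
    · simp
    · filter_upwards [hvK] with x hx
      rw [hHK _ hx]; simp
  have hconst := hw.ae_eq_const hgL (Filter.EventuallyEq.refl _ _)
  rcases lt_or_ge 0 (∫ y, g (v y)) with hm | hm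
  · right
    filter_upwards [hconst, hvK] with x hx hxK
    rcases lt_trichotomy (v x) c with h | h | h
    · have := hgneg _ h
      linarith
    · exact absurd (h ▸ hxK) hc
    · exact h
  · left
    filter_upwards [hconst, hvK] with x hx hxK
    rcases lt_trichotomy (v x) c with h | h | h
    · exact h
    · exact absurd (h ▸ hxK) hc
    · have := hgpos _ h
      linarith

/-- The weak gradient of a Lipschitz function is bounded by its Lipschitz constant. -/
theorem HasWeakGrad.abs_le_of_lipschitz {v : Td d → ℝ} {g : Td d → EuclideanSpace ℝ (Fin d)}
    (h : HasWeakGrad v g) {C : NNReal} (hv : LipschitzWith C v) (i : Fin d) :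
    ∀ᵐ x, |g x i| ≤ C := by
  -- ∫ v ∂ᵢψ is the derivative at s = 0 of ∫ v(x) ψ(x + s eᵢ). Translation moves the shift onto v,
  -- where the Lipschitz bound shows that the integral changes by at most C|s| ∫ ψ.
  have key : ∀ ψ : Td d → ℝ, IsSmooth ψ → (∀ x, 0 ≤ ψ x) →
      |∫ x, g x i * ψ x| ≤ C * ∫ x, ψ x := by
    intro ψ hψ h0
    have hI : 0 ≤ ∫ x, ψ x := integral_nonneg h0
    rw [← abs_neg, ← h.2.2 ψ hψ i]
    obtain ⟨B, hB⟩ := (isCompact_univ (X := Td d)).exists_bound_of_continuousOn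
      ((hv.continuous.norm.mul continuous_const).continuousOn (f := fun x => ‖v x‖ * 1))
    obtain ⟨P, hP⟩ := (isCompact_univ (X := Td d)).exists_bound_of_continuousOn
      (hψ.continuous_pd i).continuousOn
    have ht : ∀ s : ℝ, Continuous (fun x : Td d => x + Pi.single i (s : UnitAddCircle)) :=
      fun s => continuous_id.add continuous_const
    have m1 : ∀ s : ℝ, Continuous
        (fun x : Td d => v x * ψ (x + Pi.single i (s : UnitAddCircle))) :=
      fun s => hv.continuous.mul (hψ.continuous.comp (ht s))
    have m2 : Continuous
        (fun x : Td d => v x * pd i ψ (x + Pi.single i ((0 : ℝ) : UnitAddCircle))) :=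
      hv.continuous.mul ((hψ.continuous_pd i).comp (ht 0))
    have hd : HasDerivAt (fun s : ℝ => ∫ x : Td d, v x * ψ (x + Pi.single i (s : UnitAddCircle)))
        (∫ x : Td d, v x * pd i ψ (x + Pi.single i ((0 : ℝ) : UnitAddCircle))) 0 := by
      refine hasDerivAt_integral_of_bound (μ := (volume : Measure (Td d))) (C := B * P)
        (F := fun (s : ℝ) (x : Td d) => v x * ψ (x + Pi.single i (s : UnitAddCircle)))
        (F' := fun (s : ℝ) (x : Td d) => v x * pd i ψ (x + Pi.single i (s : UnitAddCircle)))
        ?_ ?_ ?_ ?_ ?_ ?_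
      · exact fun s => (m1 s).aestronglyMeasurable
      · exact integrable_of_continuous (m1 0)
      · exact m2.aestronglyMeasurable
      · intro x s
        rw [norm_mul]
        have h1 : ‖v x‖ ≤ B := by simpa using hB x (mem_univ _)
        exact mul_le_mul h1 (hP _ (mem_univ _)) (norm_nonneg _) ((norm_nonneg _).trans h1)
      · exact integrable_const _
      · exact fun x s => (hψ.hasDerivAt i x s).const_mul (v x)
    have e : ∀ s : ℝ, ∫ x : Td d, v x * ψ (x + Pi.single i (s : UnitAddCircle)) =
        ∫ x : Td d, v (x - Pi.single i (s : UnitAddCircle)) * ψ x := by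
      intro s
      have := integral_add_right_eq_self (μ := (volume : Measure (Td d))) (fun x : Td d =>
        v (x - Pi.single i (s : UnitAddCircle)) * ψ x) (Pi.single i (s : UnitAddCircle) : Td d)
      rw [← this]
      simp
    have e0 : ∀ x : Td d, v x * pd i ψ (x + Pi.single i ((0 : ℝ) : UnitAddCircle)) =
        v x * pd i ψ x := by
      intro x
      rw [AddCircle.coe_zero, Pi.single_zero, add_zero]
    simp only [e, e0] at hd
    have hc : ∀ s : ℝ, Continuous
        (fun x : Td d => v (x - Pi.single i (s : UnitAddCircle)) * ψ x) :=
      fun s => (hv.continuous.comp (continuous_id.sub continuous_const)).mul hψ.continuous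
    have hL := hd.le_of_lip' (C := C * ∫ x, ψ x) (by positivity)
      (Filter.Eventually.of_forall fun s => by
        rw [← integral_sub (integrable_of_continuous (hc s)) (integrable_of_continuous (hc 0))]
        refine (norm_integral_le_integral_norm _).trans ?_
        rw [mul_right_comm, ← integral_const_mul]
        refine integral_mono (integrable_of_continuous ((hc s).sub (hc 0)).norm)
          (integrable_of_continuous (continuous_const.mul hψ.continuous)) fun x => ?_
        simp only
        rw [← sub_mul, norm_mul, Real.norm_eq_abs (ψ x), abs_of_nonneg (h0 x)]
        refine mul_le_mul_of_nonneg_right ?_ (h0 x)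
        rw [← dist_eq_norm]
        refine (hv.dist_le_mul _ _).trans (mul_le_mul_of_nonneg_left ?_ C.2)
        rw [AddCircle.coe_zero, Pi.single_zero, sub_zero, dist_eq_norm, sub_sub_cancel_left,
          norm_neg, Pi.norm_single]
        simp only [sub_zero]
        exact QuotientAddGroup.norm_mk_le_norm)
    simpa using hL
  have hi : Integrable (fun x => g x i) := (EuclideanSpace.proj (𝕜 := ℝ) i).integrable_comp h.2.1
  have hψi : ∀ ψ : Td d → ℝ, IsSmooth ψ → Integrable (fun x => g x i * ψ x) :=
    fun ψ hψ => hi.mul_continuous hψ.continuous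
  have u1 : ∀ᵐ x, 0 ≤ C - g x i := by
    refine ae_nonneg_of_integral_mul_smooth ((integrable_const _).sub hi) fun ψ hψ h0 => ?_
    have hCψ : Integrable (fun x => (C : ℝ) * ψ x) :=
      integrable_of_continuous (continuous_const.mul hψ.continuous)
    simp only [sub_mul]
    rw [integral_sub hCψ (hψi ψ hψ),
      integral_const_mul]
    linarith [(abs_le.1 (key ψ hψ h0)).2]
  have u2 : ∀ᵐ x, 0 ≤ C + g x i := by
    refine ae_nonneg_of_integral_mul_smooth ((integrable_const _).add hi) fun ψ hψ h0 => ?_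
    have hCψ : Integrable (fun x => (C : ℝ) * ψ x) :=
      integrable_of_continuous (continuous_const.mul hψ.continuous)
    simp only [add_mul]
    rw [integral_add hCψ (hψi ψ hψ),
      integral_const_mul]
    linarith [(abs_le.1 (key ψ hψ h0)).1]
  filter_upwards [u1, u2] with x h1 h2
  rw [abs_le]; constructor <;> linarith

end ScalarCD

/-! ### Weak equations in time and smooth functions as elements of H¹ -/

namespace ScalarCD

/-- Smooth functions of time that vanish near the final time `T`. -/
def IsTimeTest (T : ℝ) (θ : ℝ → ℝ) : Prop :=
  ContDiff ℝ ((⊤ : ℕ∞) : WithTop ℕ∞) θ ∧ ∃ T' < T, ∀ t, T' ≤ t → θ t = 0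

lemma intervalIntegrable_of_timeMeasure {T : ℝ} (hT : 0 < T) {h : ℝ → ℝ}
    (hh : Integrable h (timeMeasure T)) : IntervalIntegrable h volume 0 T := by
  rw [intervalIntegrable_iff_integrableOn_Ioo_of_le hT.le]; exact hh

lemma integral_timeMeasure {T : ℝ} (hT : 0 ≤ T) (h : ℝ → ℝ) :
    ∫ t, h t ∂(timeMeasure T) = ∫ t in (0 : ℝ)..T, h t := by
  rw [intervalIntegral.integral_of_le hT, integral_Ioc_eq_integral_Ioo]

/-- The weak form of the equation `a' = h`, `a(0) = a₀` on `(0,T)` implies its integrated form. -/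
theorem ae_eq_integral_of_weak {T : ℝ} (hT : 0 < T) {a h : ℝ → ℝ} {a₀ : ℝ}
    (ha : Integrable a (timeMeasure T)) (hh : Integrable h (timeMeasure T))
    (hw : ∀ θ, IsTimeTest T θ →
      ∫ t, (deriv θ t * a t + θ t * h t) ∂(timeMeasure T) + θ 0 * a₀ = 0) :
    ∀ᵐ t ∂(timeMeasure T), a t = a₀ + ∫ s in (0 : ℝ)..t, h s := by
  have hI := intervalIntegrable_of_timeMeasure hT hh
  set b : ℝ → ℝ := fun t => a₀ + ∫ s in (0 : ℝ)..t, h s with hb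
  have hbac : AbsolutelyContinuousOnInterval b 0 T := by
    have h1 : AbsolutelyContinuousOnInterval (fun _ : ℝ => a₀) 0 T :=
      contDiffOn_const.absolutelyContinuousOnInterval
    exact h1.add (hI.absolutelyContinuousOnInterval_intervalIntegral (c := 0) (by simp))
  have hbi : Integrable b (timeMeasure T) := by
    have := hbac.continuousOn
    rw [uIcc_of_le hT.le] at this
    exact (this.integrableOn_Icc).mono_set Ioo_subset_Icc_self
  have hbd : ∀ᵐ t, t ∈ uIcc 0 T → deriv b t = h t := by
    filter_upwards [hI.ae_hasDerivAt_integral] with t ht htm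
    exact ((ht htm 0 (by simp)).const_add a₀).deriv
  have key := isOpen_Ioo.ae_eq_zero_of_integral_contDiff_smul_eq_zero (U := Ioo 0 T)
    (f := fun t => a t - b t) (μ := volume)
    (by
      have : IntegrableOn (fun t => a t - b t) (Ioo 0 T) := ha.sub hbi
      exact this.locallyIntegrableOn) (by
      intro g hg hgc hgs
      -- The primitive based at T vanishes near T but not necessarily at 0, so it is an admissible
      -- test function that sees the initial value. Integrating by parts against b turns the weak
      -- form into ∫ g (a - b) = 0.
      set θ : ℝ → ℝ := fun t => ∫ s in T..t, g s
      have hθd : ∀ t, HasDerivAt θ (g t) t := hasDerivAt_primitive hg.continuous T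
      have hθ' : deriv θ = g := funext fun t => (hθd t).deriv
      have hθs : ContDiff ℝ ((⊤ : ℕ∞) : WithTop ℕ∞) θ := by
        rw [contDiff_infty_iff_deriv]
        exact ⟨fun t => (hθd t).differentiableAt, by rw [hθ']; exact hg⟩
      have hθT : IsTimeTest T θ := by
        refine ⟨hθs, ?_⟩
        obtain ⟨T', hT', hsub⟩ : ∃ T' < T, ∀ t, T' ≤ t → g t = 0 := by
          rcases (tsupport g).eq_empty_or_nonempty with he | hne
          · refine ⟨T - 1, by linarith, fun t _ => ?_⟩
            exact image_eq_zero_of_notMem_tsupport (by rw [he]; simp)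
          · obtain ⟨m, hm, hmax⟩ := hgc.isCompact.exists_isGreatest hne
            refine ⟨(m + T) / 2, by linarith [(hgs hm).2], fun t ht => ?_⟩
            refine image_eq_zero_of_notMem_tsupport fun htm => ?_
            have := hmax htm
            linarith [(hgs hm).2]
        refine ⟨T', hT', fun t ht => ?_⟩
        have : ∫ s in T..t, g s = ∫ s in T..t, (0 : ℝ) := by
          refine intervalIntegral.integral_congr fun s hs => hsub s ?_
          exact (le_min hT'.le ht).trans hs.1
        simp only [θ]
        rw [this]; simp
      have h1 := hw θ hθT
      rw [hθ'] at h1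
      have hθac : AbsolutelyContinuousOnInterval θ 0 T :=
        ((hθs.of_le (by exact_mod_cast le_top)).contDiffOn (n := 1)).absolutelyContinuousOnInterval
      have h2 := hθac.integral_mul_deriv_eq_deriv_mul hbac
      have h3 : ∫ t in (0 : ℝ)..T, θ t * deriv b t = ∫ t in (0 : ℝ)..T, θ t * h t := by
        refine intervalIntegral.integral_congr_ae ?_
        filter_upwards [hbd] with t ht htm
        rw [ht (uIoc_subset_uIcc htm)]
      have hT0 : θ T = 0 := by simp [θ]
      have hb0 : b 0 = a₀ := by simp [hb]
      rw [h3, hθ', hT0, hb0, ← integral_timeMeasure hT.le, ← integral_timeMeasure hT.le] at h2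
      obtain ⟨B, hB⟩ := hgc.exists_bound_of_continuous hg.continuous
      have gb : ∀ {z : ℝ → ℝ}, Integrable z (timeMeasure T) →
          Integrable (fun t => g t * z t) (timeMeasure T) := fun hz =>
        hz.bdd_mul (c := B) hg.continuous.aestronglyMeasurable (Filter.Eventually.of_forall hB)
      have iθ : Integrable (fun t => θ t * h t) (timeMeasure T) := by
        have := hI.continuousOn_mul hθs.continuous.continuousOn
        rw [intervalIntegrable_iff_integrableOn_Ioo_of_le hT.le] at this
        exact this
      rw [integral_add (gb ha) iθ, h2] at h1
      have e : ∫ t, g t • (a t - b t) = ∫ t, (g t * a t - g t * b t) ∂(timeMeasure T) := by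
        simp only [smul_eq_mul, mul_sub]
        refine (setIntegral_eq_integral_of_forall_compl_eq_zero fun t ht => ?_).symm
        have : g t = 0 := image_eq_zero_of_notMem_tsupport fun h => ht (hgs h)
        simp [this]
      rw [e, integral_sub (gb ha) (gb hbi)]
      linarith)
  rw [ae_restrict_iff' measurableSet_Ioo]
  filter_upwards [key] with t ht htm
  have := ht htm
  linarith

/-- The energy identity for a primitive. -/
lemma sq_primitive_eq {T : ℝ} (hT : 0 < T) {h : ℝ → ℝ} (hh : Integrable h (timeMeasure T))
    (a₀ : ℝ) {t : ℝ} (ht : t ∈ Icc 0 T) :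
    (a₀ + ∫ s in (0 : ℝ)..t, h s) ^ 2 =
      a₀ ^ 2 + 2 * ∫ s in (0 : ℝ)..t, h s * (a₀ + ∫ r in (0 : ℝ)..s, h r) := by
  have hI : IntervalIntegrable h volume 0 t :=
    (intervalIntegrable_of_timeMeasure hT hh).mono_set (by
      rw [uIcc_of_le ht.1, uIcc_of_le hT.le]; exact Icc_subset_Icc_right ht.2)
  set b : ℝ → ℝ := fun t => a₀ + ∫ s in (0 : ℝ)..t, h s with hb
  have hbac : AbsolutelyContinuousOnInterval b 0 t := by
    have h1 : AbsolutelyContinuousOnInterval (fun _ : ℝ => a₀) 0 t :=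
      contDiffOn_const.absolutelyContinuousOnInterval
    exact h1.add (hI.absolutelyContinuousOnInterval_intervalIntegral (c := 0) (by simp))
  have h2 := hbac.integral_deriv_mul_eq_sub hbac
  have h3 : ∫ s in (0 : ℝ)..t, (deriv b s * b s + b s * deriv b s) =
      2 * ∫ s in (0 : ℝ)..t, h s * b s := by
    rw [← intervalIntegral.integral_const_mul]
    refine intervalIntegral.integral_congr_ae ?_
    filter_upwards [hI.ae_hasDerivAt_integral] with s hs hsm
    rw [((hs (uIoc_subset_uIcc hsm) 0 (by simp)).const_add a₀).deriv]
    ring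
  have hb0 : b 0 = a₀ := by simp [hb]
  rw [h3, hb0] at h2
  change b t ^ 2 = a₀ ^ 2 + 2 * ∫ s in (0 : ℝ)..t, h s * b s
  rw [h2]; ring

section OfSmooth

variable {d : ℕ}

lemma H1.ofSmooth_fst {ψ : Td d → ℝ} (hψ : IsSmooth ψ) :
    ((H1.ofSmooth ψ hψ : H1 d).1.fst : Td d → ℝ) =ᵐ[volume] ψ :=
  (memLp_of_continuous hψ.continuous).coeFn_toLp

lemma H1.ofSmooth_snd {ψ : Td d → ℝ} (hψ : IsSmooth ψ) :
    ((H1.ofSmooth ψ hψ : H1 d).1.snd : Td d → EuclideanSpace ℝ (Fin d)) =ᵐ[volume] grad ψ :=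
  (memLp_of_continuous (continuous_grad hψ)).coeFn_toLp

lemma H1.ext_of_ae {p q : H1 d} (h1 : (p.1.fst : Td d → ℝ) =ᵐ[volume] q.1.fst)
    (h2 : (p.1.snd : Td d → EuclideanSpace ℝ (Fin d)) =ᵐ[volume] q.1.snd) : p = q := by
  apply Subtype.ext
  apply (WithLp.equiv 2 _).injective
  exact Prod.ext (Lp.ext h1) (Lp.ext h2)

lemma H1.ofSmooth_congr {ψ χ : Td d → ℝ} (hψ : IsSmooth ψ) (hχ : IsSmooth χ) (h : ψ = χ) :
    H1.ofSmooth ψ hψ = H1.ofSmooth χ hχ := by subst h; rfl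

lemma grad_add {ψ χ : Td d → ℝ} (hψ : IsSmooth ψ) (hχ : IsSmooth χ) :
    grad (fun x => ψ x + χ x) = fun x => grad ψ x + grad χ x := by
  funext x
  ext i
  have h := ((hψ.hasDerivAt i x 0).add (hχ.hasDerivAt i x 0)).deriv
  simp only [AddCircle.coe_zero, Pi.single_zero, add_zero] at h
  exact h

lemma grad_const_mul {ψ : Td d → ℝ} (hψ : IsSmooth ψ) (c : ℝ) :
    grad (fun x => c * ψ x) = fun x => c • grad ψ x := by
  funext x
  ext i
  have h := ((hψ.hasDerivAt i x 0).const_mul c).deriv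
  simp only [AddCircle.coe_zero, Pi.single_zero, add_zero] at h
  exact h

lemma IsSmooth.add {ψ χ : Td d → ℝ} (hψ : IsSmooth ψ) (hχ : IsSmooth χ) :
    IsSmooth (fun x => ψ x + χ x) := ContDiff.add hψ hχ

lemma IsSmooth.const_mul {ψ : Td d → ℝ} (hψ : IsSmooth ψ) (c : ℝ) :
    IsSmooth (fun x => c * ψ x) := contDiff_const.mul hψ

lemma H1.ofSmooth_add {ψ χ : Td d → ℝ} (hψ : IsSmooth ψ) (hχ : IsSmooth χ) :
    H1.ofSmooth _ (hψ.add hχ) = H1.ofSmooth ψ hψ + H1.ofSmooth χ hχ := by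
  refine H1.ext_of_ae ?_ ?_
  · filter_upwards [H1.ofSmooth_fst (hψ.add hχ), H1.ofSmooth_fst hψ, H1.ofSmooth_fst hχ,
      Lp.coeFn_add (H1.ofSmooth ψ hψ).1.fst (H1.ofSmooth χ hχ).1.fst] with x h1 h2 h3 h4
    rw [h1]
    refine Eq.trans ?_ h4.symm
    rw [Pi.add_apply, h2, h3]
  · filter_upwards [H1.ofSmooth_snd (hψ.add hχ), H1.ofSmooth_snd hψ, H1.ofSmooth_snd hχ,
      Lp.coeFn_add (H1.ofSmooth ψ hψ).1.snd (H1.ofSmooth χ hχ).1.snd] with x h1 h2 h3 h4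
    rw [h1, grad_add hψ hχ]
    refine Eq.trans ?_ h4.symm
    rw [Pi.add_apply, h2, h3]

lemma H1.ofSmooth_const_mul {ψ : Td d → ℝ} (hψ : IsSmooth ψ) (c : ℝ) :
    H1.ofSmooth _ (hψ.const_mul c) = c • H1.ofSmooth ψ hψ := by
  refine H1.ext_of_ae ?_ ?_
  · filter_upwards [H1.ofSmooth_fst (hψ.const_mul c), H1.ofSmooth_fst hψ,
      Lp.coeFn_smul c (H1.ofSmooth ψ hψ).1.fst] with x h1 h2 h4
    rw [h1]
    refine Eq.trans ?_ h4.symm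
    rw [Pi.smul_apply, h2, smul_eq_mul]
  · filter_upwards [H1.ofSmooth_snd (hψ.const_mul c), H1.ofSmooth_snd hψ,
      Lp.coeFn_smul c (H1.ofSmooth ψ hψ).1.snd] with x h1 h2 h4
    rw [h1, grad_const_mul hψ]
    refine Eq.trans ?_ h4.symm
    rw [Pi.smul_apply, h2]

lemma sq_norm_toLp {E : Type*} [NormedAddCommGroup E] {v : Td d → E} (hv : MemLp v 2) :
    ‖hv.toLp v‖ ^ 2 = ∫ x, ‖v x‖ ^ 2 := by
  rw [Lp.norm_toLp, hv.eLpNorm_eq_integral_rpow_norm (by norm_num) (by norm_num),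
    ENNReal.toReal_ofReal (by positivity)]
  have h0 : 0 ≤ ∫ x, ‖v x‖ ^ 2 := integral_nonneg fun x => by positivity
  have : ((2 : ℝ≥0∞).toReal)⁻¹ = 1 / 2 := by norm_num
  rw [this, ← Real.sqrt_eq_rpow]
  simp only [ENNReal.toReal_ofNat, Real.rpow_ofNat]
  exact Real.sq_sqrt h0

lemma H1.sq_norm_ofSmooth {ψ : Td d → ℝ} (hψ : IsSmooth ψ) :
    ‖H1.ofSmooth ψ hψ‖ ^ 2 = (∫ x, ψ x ^ 2) + ∫ x, ‖grad ψ x‖ ^ 2 := by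
  have h : ‖H1.ofSmooth ψ hψ‖ ^ 2 = ‖(memLp_of_continuous hψ.continuous).toLp ψ‖ ^ 2 +
      ‖(memLp_of_continuous (continuous_grad hψ)).toLp (grad ψ)‖ ^ 2 :=
    WithLp.prod_norm_sq_eq_of_L2 _
  rw [h, sq_norm_toLp, sq_norm_toLp]
  simp

lemma H1.apply_ofSmooth_trigSum (r : Hneg1 d) (F : Finset (Fin d → ℤ)) (a b : (Fin d → ℤ) → ℝ) :
    r (H1.ofSmooth _ (isSmooth_trigSum F a b)) =
      ∑ k ∈ F, (a k * r (H1.ofSmooth _ (isSmooth_tcos k)) +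
        b k * r (H1.ofSmooth _ (isSmooth_tsin k))) := by
  classical
  induction F using Finset.induction_on with
  | empty =>
    have e : H1.ofSmooth _ (isSmooth_trigSum ∅ a b) = (0 : ℝ) • H1.ofSmooth _ (isSmooth_const 0) := by
      rw [← H1.ofSmooth_const_mul]
      exact H1.ofSmooth_congr _ _ (by funext x; simp [trigSum])
    rw [e]; simp
  | insert k F hk ih =>
    have e : H1.ofSmooth _ (isSmooth_trigSum (insert k F) a b) =
        (a k • H1.ofSmooth _ (isSmooth_tcos k) + b k • H1.ofSmooth _ (isSmooth_tsin k)) +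
          H1.ofSmooth _ (isSmooth_trigSum F a b) := by
      rw [← H1.ofSmooth_const_mul, ← H1.ofSmooth_const_mul, ← H1.ofSmooth_add, ← H1.ofSmooth_add]
      exact H1.ofSmooth_congr _ _ (by funext x; simp [trigSum, Finset.sum_insert hk])
    rw [e, map_add, map_add, map_smul, map_smul, ih, Finset.sum_insert hk]
    rfl

end OfSmooth

end ScalarCD

/-! ### Balance laws in energy spaces and the energy inequality -/

namespace ScalarCD

variable {d : ℕ} {T : ℝ}

lemma memLp_norm_dual {V X : Type*} [NormedAddCommGroup V] [NormedSpace ℝ V] [MeasurableSpace X]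
    {μ : Measure X} {r : X → StrongDual ℝ V} (h : MemLp r 2 μ) :
    MemLp (fun t => ‖r t‖) 2 μ := h.norm

lemma aestronglyMeasurable_dual_apply {V X : Type*} [NormedAddCommGroup V] [NormedSpace ℝ V]
    [MeasurableSpace X] {μ : Measure X} {r : X → StrongDual ℝ V} (h : MemLp r 2 μ) (p : V) :
    AEStronglyMeasurable (fun t => r t p) μ :=
  (ContinuousLinearMap.apply ℝ ℝ p).continuous.comp_aestronglyMeasurable h.1

lemma eLpNorm_dual {V X : Type*} [NormedAddCommGroup V] [NormedSpace ℝ V] [MeasurableSpace X]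
    {μ : Measure X} (r : X → StrongDual ℝ V) :
    eLpNorm r 2 μ = eLpNorm (fun t => ‖r t‖) 2 μ := (eLpNorm_norm r).symm

lemma ae_memLp_slice {E : Type*} [NormedAddCommGroup E] {F : ℝ × Td d → E}
    (hF : MemLp F 2 (stMeasure d T)) :
    ∀ᵐ t ∂(timeMeasure T), MemLp (fun x => F (t, x)) 2 := by
  have h2 := (memLp_two_iff_integrable_sq_norm hF.1).1 hF
  filter_upwards [hF.1.prodMk_left, h2.prod_right_ae] with t h3 h4
  exact (memLp_two_iff_integrable_sq_norm h3).2 h4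

lemma integrable_integral_normSq_slice {E : Type*} [NormedAddCommGroup E] {F : ℝ × Td d → E}
    (hF : MemLp F 2 (stMeasure d T)) :
    Integrable (fun t => ∫ x, ‖F (t, x)‖ ^ 2) (timeMeasure T) :=
  ((memLp_two_iff_integrable_sq_norm hF.1).1 hF).integral_prod_left

lemma integrable_integral_mul {w : ℝ → Td d → ℝ}
    (hw : Integrable (fun p : ℝ × Td d => w p.1 p.2) (stMeasure d T)) {ψ : Td d → ℝ}
    (hψ : Continuous ψ) : Integrable (fun t => ∫ x, w t x * ψ x) (timeMeasure T) := by
  obtain ⟨C, hC⟩ := (isCompact_univ (X := Td d)).exists_bound_of_continuousOn hψ.continuousOn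
  have : Integrable (fun p : ℝ × Td d => w p.1 p.2 * ψ p.2) (stMeasure d T) :=
    hw.mul_bdd (c := C) (hψ.comp continuous_snd).aestronglyMeasurable
      (Filter.Eventually.of_forall fun p => hC p.2 (mem_univ _))
  exact this.integral_prod_left

lemma memLp_st_coord {G : ℝ → Td d → EuclideanSpace ℝ (Fin d)} {p : ℝ≥0∞}
    (hG : MemLp (fun p : ℝ × Td d => G p.1 p.2) p (stMeasure d T)) (i : Fin d) :
    MemLp (fun p : ℝ × Td d => G p.1 p.2 i) p (stMeasure d T) :=
  (EuclideanSpace.proj (𝕜 := ℝ) i).comp_memLp' hG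

section Mixed

variable {r : ℝ → Td d → ℝ}

lemma aemeasurable_eLpNorm_slice {E : Type*} [NormedAddCommGroup E] {r : ℝ → Td d → E}
    (hr : AEStronglyMeasurable (fun z : ℝ × Td d => r z.1 z.2) (stMeasure d T)) :
    AEMeasurable (fun t => eLpNorm (r t) 2 volume) (timeMeasure T) := by
  simp only [eLpNorm_eq_lintegral_rpow_enorm_toReal (p := 2) two_ne_zero ENNReal.ofNat_ne_top]
  exact ((hr.enorm.pow_const _).lintegral_prod_right').pow_const _

lemma mixedNorm_one_eq (T : ℝ) (r : ℝ → Td d → ℝ) :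
    mixedNorm 1 2 T r = ∫⁻ t, eLpNorm (r t) 2 volume ∂(timeMeasure T) := by
  rw [mixedNorm, eLpNorm_one_eq_lintegral_enorm]
  simp

lemma MemMixed.ae_memLp (hr : MemMixed 1 2 T r) : ∀ᵐ t ∂(timeMeasure T), MemLp (r t) 2 := by
  have h := hr.2
  rw [mixedNorm_one_eq] at h
  filter_upwards [hr.1.prodMk_left, ae_lt_top' (aemeasurable_eLpNorm_slice hr.1) h.ne]
    with t h1 h2
  exact ⟨h1, h2⟩

lemma MemMixed.integrable (hr : MemMixed 1 2 T r) :
    Integrable (fun z : ℝ × Td d => r z.1 z.2) (stMeasure d T) := by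
  refine ⟨hr.1, ?_⟩
  have h := hr.2
  rw [mixedNorm_one_eq] at h
  rw [hasFiniteIntegral_iff_enorm, lintegral_prod _ hr.1.enorm]
  refine lt_of_le_of_lt (lintegral_mono_ae ?_) h
  filter_upwards [hr.1.prodMk_left] with t ht
  rw [← eLpNorm_one_eq_lintegral_enorm]
  exact eLpNorm_le_eLpNorm_of_exponent_le (by norm_num) ht

/-- The function `t ↦ ‖r(t)‖_{L²}`. -/
noncomputable def normSlice (r : ℝ → Td d → ℝ) (t : ℝ) : ℝ := (eLpNorm (r t) 2 volume).toReal

lemma normSlice_nonneg (r : ℝ → Td d → ℝ) (t : ℝ) : 0 ≤ normSlice r t := ENNReal.toReal_nonneg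

lemma MemMixed.integrable_normSlice (hr : MemMixed 1 2 T r) :
    Integrable (normSlice r) (timeMeasure T) := by
  have h := hr.2
  rw [mixedNorm_one_eq] at h
  exact integrable_toReal_of_lintegral_ne_top (aemeasurable_eLpNorm_slice hr.1) h.ne

lemma MemMixed.integral_normSlice (hr : MemMixed 1 2 T r) :
    ∫ t, normSlice r t ∂(timeMeasure T) = (mixedNorm 1 2 T r).toReal := by
  have h := hr.2
  rw [mixedNorm_one_eq] at h ⊢
  exact integral_toReal (aemeasurable_eLpNorm_slice hr.1)
    (ae_lt_top' (aemeasurable_eLpNorm_slice hr.1) h.ne)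

lemma toReal_eLpNorm_two {X E : Type*} [MeasurableSpace X] {μ : Measure X}
    [NormedAddCommGroup E] {v : X → E} (hv : MemLp v 2 μ) :
    (eLpNorm v 2 μ).toReal = √(∫ x, ‖v x‖ ^ 2 ∂μ) := by
  rw [hv.eLpNorm_eq_integral_rpow_norm (by norm_num) (by norm_num),
    ENNReal.toReal_ofReal (by positivity), Real.sqrt_eq_rpow]
  norm_num

lemma sqrt_integral_sq_eq_normSlice {t : ℝ} (h : MemLp (r t) 2) :
    √(∫ x, r t x ^ 2) = normSlice r t := by
  rw [normSlice, toReal_eLpNorm_two h]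
  simp

end Mixed

/-- The pairing of the flux `G` and of the source `ρ₁ + ρ₂` with a smooth function of space. -/
noncomputable def weakRate (G : ℝ → Td d → EuclideanSpace ℝ (Fin d)) (ρ₁ : ℝ → Td d → ℝ)
    (ρ₂ : ℝ → Hneg1 d) (ψ : Td d → ℝ) (hψ : IsSmooth ψ) (t : ℝ) : ℝ :=
  (∑ i, ∫ x, G t x i * pd i ψ x) + (∫ x, ρ₁ t x * ψ x) + ρ₂ t (H1.ofSmooth ψ hψ)

/-- `∂ₜ w + div G = ρ₁ + ρ₂` with initial data `w₀`, tested with products `θ(t) ψ(x)`; the function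
`w`, its gradient, the flux and the sources belong to the energy spaces. -/
structure IsBalance (T : ℝ) (w : ℝ → Td d → ℝ) (Dw G : ℝ → Td d → EuclideanSpace ℝ (Fin d))
    (ρ₁ : ℝ → Td d → ℝ) (ρ₂ : ℝ → Hneg1 d) (w₀ : Td d → ℝ) : Prop where
  memLp : MemLp (fun p : ℝ × Td d => w p.1 p.2) 2 (stMeasure d T)
  bounded : ∃ M, ∀ᵐ p ∂(stMeasure d T), |w p.1 p.2| ≤ M
  grad : ∀ᵐ t ∂(timeMeasure T), HasWeakGrad (w t) (Dw t)
  memLp_grad : MemLp (fun p : ℝ × Td d => Dw p.1 p.2) 2 (stMeasure d T)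
  memLp_flux : MemLp (fun p : ℝ × Td d => G p.1 p.2) 2 (stMeasure d T)
  source : MemMixed 1 2 T ρ₁
  dual : MemLp (fun t => ‖ρ₂ t‖) 2 (timeMeasure T)
  dual_meas : ∀ p, AEStronglyMeasurable (fun t => ρ₂ t p) (timeMeasure T)
  dual_mean : ∀ᵐ t ∂(timeMeasure T), ρ₂ t (H1.ofSmooth (fun _ => 1) (isSmooth_const 1)) = 0
  initial : MemLp w₀ 2
  weak : ∀ ψ (hψ : IsSmooth ψ) θ, IsTimeTest T θ →
    ∫ t, (deriv θ t * (∫ x, w t x * ψ x) + θ t * weakRate G ρ₁ ρ₂ ψ hψ t) ∂(timeMeasure T)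
      + θ 0 * ∫ x, w₀ x * ψ x = 0

namespace IsBalance

variable {w : ℝ → Td d → ℝ} {Dw G : ℝ → Td d → EuclideanSpace ℝ (Fin d)} {ρ₁ : ℝ → Td d → ℝ}
  {ρ₂ : ℝ → Hneg1 d} {w₀ : Td d → ℝ}

lemma isH1 (h : IsBalance T w Dw G ρ₁ ρ₂ w₀) : ∀ᵐ t ∂(timeMeasure T), IsH1 (w t) (Dw t) := by
  filter_upwards [ae_memLp_slice h.memLp, ae_memLp_slice h.memLp_grad, h.grad] with t h1 h2 h3
  exact ⟨h1, h2, h3⟩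

lemma integrable_weakRate (h : IsBalance T w Dw G ρ₁ ρ₂ w₀) {ψ : Td d → ℝ} (hψ : IsSmooth ψ) :
    Integrable (weakRate G ρ₁ ρ₂ ψ hψ) (timeMeasure T) := by
  refine Integrable.add (Integrable.add ?_ (integrable_integral_mul h.source.integrable
    hψ.continuous)) ?_
  · exact integrable_finsetSum _ fun i _ => integrable_integral_mul
      (w := fun t x => G t x i)
      ((memLp_st_coord h.memLp_flux i).integrable (by norm_num)) (hψ.continuous_pd i)
  · refine ((h.dual.integrable (by norm_num)).mul_const ‖H1.ofSmooth ψ hψ‖).mono'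
      (h.dual_meas _) (Filter.Eventually.of_forall fun t => (ρ₂ t).le_opNorm _)

lemma ae_eq_integral (h : IsBalance T w Dw G ρ₁ ρ₂ w₀) (hT : 0 < T) {ψ : Td d → ℝ}
    (hψ : IsSmooth ψ) : ∀ᵐ t ∂(timeMeasure T), ∫ x, w t x * ψ x =
      (∫ x, w₀ x * ψ x) + ∫ s in (0 : ℝ)..t, weakRate G ρ₁ ρ₂ ψ hψ s :=
  ae_eq_integral_of_weak hT
    (integrable_integral_mul (h.memLp.integrable (by norm_num)) hψ.continuous)
    (h.integrable_weakRate hψ) (h.weak ψ hψ)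

/-- The pairing with ψ agrees a.e. in time with an absolutely continuous function, to which the
product rule applies. The production term is integrable as an integrable rate times that continuous
function. -/
lemma ae_sq_eq (h : IsBalance T w Dw G ρ₁ ρ₂ w₀) (hT : 0 < T) {ψ : Td d → ℝ}
    (hψ : IsSmooth ψ) :
    IntegrableOn (fun s => weakRate G ρ₁ ρ₂ ψ hψ s * ∫ x, w s x * ψ x) (Ioo 0 T) ∧
    ∀ᵐ t ∂(timeMeasure T), (∫ x, w t x * ψ x) ^ 2 =
      (∫ x, w₀ x * ψ x) ^ 2 +
        2 * ∫ s in (0 : ℝ)..t, weakRate G ρ₁ ρ₂ ψ hψ s * ∫ x, w s x * ψ x := by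
  have hae := h.ae_eq_integral hT hψ
  have hi := h.integrable_weakRate hψ
  have hI := intervalIntegrable_of_timeMeasure hT hi
  constructor
  · have hc : ContinuousOn (fun t => (∫ x, w₀ x * ψ x) +
        ∫ s in (0 : ℝ)..t, weakRate G ρ₁ ρ₂ ψ hψ s) (uIcc 0 T) :=
      continuousOn_const.add
        (hI.absolutelyContinuousOnInterval_intervalIntegral (c := 0) (by simp)).continuousOn
    have := hI.mul_continuousOn hc
    rw [intervalIntegrable_iff_integrableOn_Ioo_of_le hT.le] at this
    refine Integrable.congr this ?_
    filter_upwards [hae] with t ht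
    rw [ht]
  · have hae' := (ae_restrict_iff' measurableSet_Ioo).1 hae
    filter_upwards [hae, ae_restrict_mem measurableSet_Ioo] with t ht htm
    rw [ht, sq_primitive_eq hT hi _ ⟨htm.1.le, htm.2.le⟩]
    congr 2
    refine intervalIntegral.integral_congr_ae ?_
    filter_upwards [hae'] with s hs hsm
    rw [uIoc_of_le htm.1.le] at hsm
    rw [hs ⟨hsm.1, hsm.2.trans_lt htm.2⟩]

/-- The part of the energy production which is due to the flux and to the frequencies in `F`. -/
noncomputable def fluxSum (Dw G : ℝ → Td d → EuclideanSpace ℝ (Fin d)) (F : Finset (Fin d → ℤ))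
    (t : ℝ) : ℝ :=
  ∑ i, ∑ k ∈ F, (ccoef (fun x => Dw t x i) k * ccoef (fun x => G t x i) k +
    scoef (fun x => Dw t x i) k * scoef (fun x => G t x i) k)

/-- The sum is r applied to a partial Fourier sum p of v. Since r annihilates constants the zero
frequency may be removed from p; then ‖p‖² ≤ ½‖g‖² by Poincaré and ‖∇p‖² ≤ ‖g‖², which gives the H¹
norm √(3/2) ‖g‖. -/
lemma dual_sum_le {v : Td d → ℝ} {g : Td d → EuclideanSpace ℝ (Fin d)} (h : IsH1 v g)
    {r : Hneg1 d} (hr : r (H1.ofSmooth (fun _ => 1) (isSmooth_const 1)) = 0)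
    (F : Finset (Fin d → ℤ)) :
    ∑ k ∈ F, (ccoef v k * r (H1.ofSmooth _ (isSmooth_tcos k)) +
        scoef v k * r (H1.ofSmooth _ (isSmooth_tsin k))) ≤
      √(3 / 2) * (‖r‖ * √(∫ x, ‖g x‖ ^ 2)) := by
  classical
  set F' := F.erase 0
  have h0 : r (H1.ofSmooth _ (isSmooth_tcos 0)) = 0 := by
    rw [← hr]; congr 1; exact H1.ofSmooth_congr _ _ tcos_zero
  have h0' : r (H1.ofSmooth _ (isSmooth_tsin 0)) = 0 := by
    have e : H1.ofSmooth _ (isSmooth_tsin (d := d) 0) =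
        (0 : ℝ) • H1.ofSmooth _ (isSmooth_const 0) := by
      rw [← H1.ofSmooth_const_mul]
      exact H1.ofSmooth_congr _ _ (by rw [tsin_zero]; simp)
    rw [e]; simp
  have e1 : ∑ k ∈ F, (ccoef v k * r (H1.ofSmooth _ (isSmooth_tcos k)) +
        scoef v k * r (H1.ofSmooth _ (isSmooth_tsin k))) =
      r (H1.ofSmooth _ (isSmooth_trigSum F' (ccoef v) (scoef v))) := by
    rw [H1.apply_ofSmooth_trigSum]
    refine (Finset.sum_erase _ ?_).symm
    rw [h0, h0']; simp
  rw [e1]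
  set p := trigSum F' (ccoef v) (scoef v)
  have hp : IsSmooth p := isSmooth_trigSum F' _ _
  set D := ∫ x, ‖g x‖ ^ 2
  have b1 : ∫ x, p x ^ 2 ≤ 1 / 2 * D :=
    (integral_sq_trigSum_le F' _ _).trans
      (h.weak.sum_sq_coef_le h.memLp_grad (Finset.notMem_erase _ _))
  have b2 : ∫ x, ‖ScalarCD.grad p x‖ ^ 2 ≤ D := by
    rw [integral_normSq_eq (memLp_of_continuous (continuous_grad hp)),
      show D = _ from integral_normSq_eq h.memLp_grad]
    refine Finset.sum_le_sum fun i _ => ?_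
    have e : ∀ x, ScalarCD.grad p x i = trigSum F' (ccoef fun x => g x i) (scoef fun x => g x i) x := by
      intro x
      exact congrFun (h.weak.pd_trigProj F' i) x
    simp only [e]
    exact (integral_sq_trigSum_le F' _ _).trans (sum_sq_coef_le (memLp_coord h.memLp_grad i) F')
  have b3 : ‖H1.ofSmooth p hp‖ ≤ √(3 / 2) * √D := by
    rw [← Real.sqrt_mul (by norm_num)]
    refine Real.le_sqrt_of_sq_le ?_
    rw [H1.sq_norm_ofSmooth]
    linarith
  calc r (H1.ofSmooth p hp) ≤ ‖r‖ * ‖H1.ofSmooth p hp‖ :=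
        (le_abs_self _).trans (r.le_opNorm _)
    _ ≤ ‖r‖ * (√(3 / 2) * √D) := mul_le_mul_of_nonneg_left b3 r.opNorm_nonneg
    _ = _ := by ring

/-- This is the energy production of finitely many modes. The factors 2πk_i from differentiating the
test functions move onto the coefficients of v and produce those of Dw. The source ρ₁ is handled by
Cauchy–Schwarz and Bessel, ρ₂ by `dual_sum_le`. -/
lemma sum_weakRate_le {v : ℝ → Td d → ℝ} {t : ℝ} (hv : IsH1 (v t) (Dw t))
    (hρ : MemLp (ρ₁ t) 2) (hr : ρ₂ t (H1.ofSmooth (fun _ => 1) (isSmooth_const 1)) = 0)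
    (F : Finset (Fin d → ℤ)) :
    ∑ k ∈ F, (weakRate G ρ₁ ρ₂ _ (isSmooth_tcos k) t * ccoef (v t) k +
      weakRate G ρ₁ ρ₂ _ (isSmooth_tsin k) t * scoef (v t) k) ≤
    fluxSum Dw G F t + normSlice ρ₁ t * √(∫ x, v t x ^ 2) +
      √(3 / 2) * (‖ρ₂ t‖ * √(∫ x, ‖Dw t x‖ ^ 2)) := by
  have e1 : ∀ k i, ∫ x, G t x i * pd i (tcos k) x =
      -(2 * Real.pi * k i) * scoef (fun x => G t x i) k := by
    intro k i
    rw [scoef, ← integral_const_mul]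
    refine integral_congr_ae (Filter.Eventually.of_forall fun x => ?_)
    simp only [pd_tcos]; ring
  have e2 : ∀ k i, ∫ x, G t x i * pd i (tsin k) x =
      (2 * Real.pi * k i) * ccoef (fun x => G t x i) k := by
    intro k i
    rw [ccoef, ← integral_const_mul]
    refine integral_congr_ae (Filter.Eventually.of_forall fun x => ?_)
    simp only [pd_tsin]; ring
  have e3 : ∑ k ∈ F, (weakRate G ρ₁ ρ₂ _ (isSmooth_tcos k) t * ccoef (v t) k +
      weakRate G ρ₁ ρ₂ _ (isSmooth_tsin k) t * scoef (v t) k) =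
      fluxSum Dw G F t + ∑ k ∈ F, (ccoef (ρ₁ t) k * ccoef (v t) k +
        scoef (ρ₁ t) k * scoef (v t) k) +
      ∑ k ∈ F, (ccoef (v t) k * ρ₂ t (H1.ofSmooth _ (isSmooth_tcos k)) +
        scoef (v t) k * ρ₂ t (H1.ofSmooth _ (isSmooth_tsin k))) := by
    rw [fluxSum, Finset.sum_comm, ← Finset.sum_add_distrib, ← Finset.sum_add_distrib]
    refine Finset.sum_congr rfl fun k _ => ?_
    simp only [weakRate, e1, e2, hv.weak.ccoef_grad, hv.weak.scoef_grad]
    have : ∑ i, (2 * Real.pi * k i * scoef (v t) k * ccoef (fun x => G t x i) k +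
          -(2 * Real.pi * k i * ccoef (v t) k) * scoef (fun x => G t x i) k) =
        (∑ i, -(2 * Real.pi * k i) * scoef (fun x => G t x i) k) * ccoef (v t) k +
        (∑ i, (2 * Real.pi * k i) * ccoef (fun x => G t x i) k) * scoef (v t) k := by
      rw [Finset.sum_mul, Finset.sum_mul, ← Finset.sum_add_distrib]
      exact Finset.sum_congr rfl fun i _ => by ring
    rw [this]
    simp only [ccoef, scoef]
    ring
  rw [e3]
  refine add_le_add (add_le_add le_rfl ?_) (dual_sum_le hv hr F)
  refine (sum_mul_le_sqrt F _ _ _ _).trans ?_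
  rw [← sqrt_integral_sq_eq_normSlice hρ]
  exact mul_le_mul (Real.sqrt_le_sqrt (sum_sq_coef_le hρ F))
    (Real.sqrt_le_sqrt (sum_sq_coef_le hv.memLp F)) (Real.sqrt_nonneg _) (Real.sqrt_nonneg _)

lemma tendsto_fluxSum {t : ℝ} (hD : MemLp (Dw t) 2) (hG : MemLp (G t) 2) :
    Filter.Tendsto (fun F => fluxSum Dw G F t) Filter.atTop
      (nhds (∑ i, ∫ x, Dw t x i * G t x i)) :=
  tendsto_finsetSum _ fun i _ => hasSum_mul_coef (memLp_coord hD i) (memLp_coord hG i)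

/-- A bound independent of F: it supplies the integrable majorant for the limit over all frequencies
in `energy_le`. -/
lemma abs_fluxSum_le {t : ℝ} (hD : MemLp (Dw t) 2) (hG : MemLp (G t) 2)
    (F : Finset (Fin d → ℤ)) :
    |fluxSum Dw G F t| ≤ (∫ x, ‖Dw t x‖ ^ 2) + ∫ x, ‖G t x‖ ^ 2 := by
  rw [integral_normSq_eq hD, integral_normSq_eq hG, ← Finset.sum_add_distrib, fluxSum]
  refine (Finset.abs_sum_le_sum_abs _ _).trans (Finset.sum_le_sum fun i _ => ?_)
  refine le_trans ?_ (add_le_add (sum_sq_coef_le (memLp_coord hD i) F)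
    (sum_sq_coef_le (memLp_coord hG i) F))
  rw [← Finset.sum_add_distrib]
  refine (Finset.abs_sum_le_sum_abs _ _).trans (Finset.sum_le_sum fun k _ => ?_)
  generalize ccoef (fun x => Dw t x i) k = a
  generalize ccoef (fun x => G t x i) k = b
  generalize scoef (fun x => Dw t x i) k = c
  generalize scoef (fun x => G t x i) k = e
  rw [abs_le]
  constructor <;> nlinarith [sq_nonneg (a + b), sq_nonneg (c + e), sq_nonneg (a - b),
    sq_nonneg (c - e), sq_nonneg a, sq_nonneg b, sq_nonneg c, sq_nonneg e]

lemma aestronglyMeasurable_fluxSum (h : IsBalance T w Dw G ρ₁ ρ₂ w₀) (F : Finset (Fin d → ℤ)) :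
    AEStronglyMeasurable (fluxSum Dw G F) (timeMeasure T) := by
  have m : ∀ {V : ℝ → Td d → EuclideanSpace ℝ (Fin d)},
      MemLp (fun p : ℝ × Td d => V p.1 p.2) 2 (stMeasure d T) → ∀ i, ∀ {ψ : Td d → ℝ},
      IsSmooth ψ → AEStronglyMeasurable (fun t => ∫ x, V t x i * ψ x) (timeMeasure T) :=
    fun {V} hV i {ψ} hψ => (integrable_integral_mul (w := fun t x => V t x i)
      ((memLp_st_coord hV i).integrable (by norm_num)) hψ.continuous).1
  refine Finset.aestronglyMeasurable_fun_sum _ fun i _ =>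
    Finset.aestronglyMeasurable_fun_sum _ fun k _ => ?_
  exact ((m h.memLp_grad i (isSmooth_tcos k)).mul (m h.memLp_flux i (isSmooth_tcos k))).add
    ((m h.memLp_grad i (isSmooth_tsin k)).mul (m h.memLp_flux i (isSmooth_tsin k)))

lemma integrable_energy (h : IsBalance T w Dw G ρ₁ ρ₂ w₀) :
    Integrable (fun t => ∫ x, w t x ^ 2) (timeMeasure T) := by
  simpa using integrable_integral_normSq_slice h.memLp

lemma integrable_flux (h : IsBalance T w Dw G ρ₁ ρ₂ w₀) :
    Integrable (fun t => ∑ i, ∫ x, Dw t x i * G t x i) (timeMeasure T) := by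
  refine integrable_finsetSum _ fun i _ => ?_
  have := (memLp_st_coord h.memLp_grad i).integrable_mul (memLp_st_coord h.memLp_flux i)
  exact this.integral_prod_left

lemma exists_energy_le (h : IsBalance T w Dw G ρ₁ ρ₂ w₀) :
    ∃ M, 0 ≤ M ∧ ∀ᵐ t ∂(timeMeasure T), ∫ x, w t x ^ 2 ≤ M := by
  obtain ⟨M, hM⟩ := h.bounded
  refine ⟨M ^ 2, sq_nonneg _, ?_⟩
  filter_upwards [Measure.ae_ae_of_ae_prod hM, h.isH1] with t ht hH
  calc ∫ x, w t x ^ 2 ≤ ∫ x : Td d, M ^ 2 := by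
        refine integral_mono_ae hH.memLp.integrable_sq (integrable_const _) ?_
        filter_upwards [ht] with x hx
        rw [← sq_abs]
        exact pow_le_pow_left₀ (abs_nonneg _) hx 2
    _ = M ^ 2 := by simp

lemma integrable_source (h : IsBalance T w Dw G ρ₁ ρ₂ w₀) :
    Integrable (fun t => normSlice ρ₁ t * √(∫ x, w t x ^ 2)) (timeMeasure T) := by
  obtain ⟨M, -, hM⟩ := h.exists_energy_le
  refine h.source.integrable_normSlice.mul_bdd (c := √M)
    (Real.continuous_sqrt.comp_aestronglyMeasurable h.integrable_energy.1) ?_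
  filter_upwards [hM] with t ht
  rw [Real.norm_eq_abs, abs_of_nonneg (Real.sqrt_nonneg _)]
  exact Real.sqrt_le_sqrt ht

lemma memLp_sqrt_grad (h : IsBalance T w Dw G ρ₁ ρ₂ w₀) :
    MemLp (fun t => √(∫ x, ‖Dw t x‖ ^ 2)) 2 (timeMeasure T) := by
  have h1 := integrable_integral_normSq_slice h.memLp_grad
  rw [memLp_two_iff_integrable_sq (Real.continuous_sqrt.comp_aestronglyMeasurable h1.1)]
  refine h1.congr (Filter.Eventually.of_forall fun t => ?_)
  exact (Real.sq_sqrt (integral_nonneg fun x => by positivity)).symm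

lemma integrable_dual (h : IsBalance T w Dw G ρ₁ ρ₂ w₀) :
    Integrable (fun t => ‖ρ₂ t‖ * √(∫ x, ‖Dw t x‖ ^ 2)) (timeMeasure T) :=
  h.dual.integrable_mul h.memLp_sqrt_grad

/-- The **energy inequality**. -/
theorem energy_le (h : IsBalance T w Dw G ρ₁ ρ₂ w₀) (hT : 0 < T) :
    ∀ᵐ t ∂(timeMeasure T), ∫ x, w t x ^ 2 ≤ (∫ x, w₀ x ^ 2) +
      2 * ∫ s in (0 : ℝ)..t, ((∑ i, ∫ x, Dw s x i * G s x i) +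
        normSlice ρ₁ s * √(∫ x, w s x ^ 2) +
        √(3 / 2) * (‖ρ₂ s‖ * √(∫ x, ‖Dw s x‖ ^ 2))) := by
  have hi1 := h.integrable_source
  have hi2 := h.integrable_dual.const_mul √(3 / 2)
  have hic := fun k => (h.ae_sq_eq hT (isSmooth_tcos k)).1
  have his := fun k => (h.ae_sq_eq hT (isSmooth_tsin k)).1
  have hGs := ae_memLp_slice h.memLp_flux
  have hall : ∀ᵐ s ∂(timeMeasure T), IsH1 (w s) (Dw s) ∧ MemLp (G s) 2 ∧ MemLp (ρ₁ s) 2 ∧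
      ρ₂ s (H1.ofSmooth (fun _ => 1) (isSmooth_const 1)) = 0 := by
    filter_upwards [h.isH1, hGs, h.source.ae_memLp, h.dual_mean] with s a b c e
    exact ⟨a, b, c, e⟩
  have hdom : Integrable (fun s => (∫ x, ‖Dw s x‖ ^ 2) + ∫ x, ‖G s x‖ ^ 2) (timeMeasure T) :=
    (integrable_integral_normSq_slice h.memLp_grad).add
      (integrable_integral_normSq_slice h.memLp_flux)
  have hiF : ∀ F, Integrable (fluxSum Dw G F) (timeMeasure T) := by
    intro F
    refine hdom.mono' (h.aestronglyMeasurable_fluxSum F) ?_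
    filter_upwards [hall] with s hs
    exact abs_fluxSum_le hs.1.memLp_grad hs.2.1 F
  have hsub : ∀ {t : ℝ}, t ∈ Ioo 0 T → timeMeasure t ≤ timeMeasure T := fun ht =>
    Measure.restrict_mono (Ioo_subset_Ioo_right ht.2.le) le_rfl
  filter_upwards [ae_all_iff.2 fun k => (h.ae_sq_eq hT (isSmooth_tcos k)).2,
    ae_all_iff.2 fun k => (h.ae_sq_eq hT (isSmooth_tsin k)).2, h.isH1,
    ae_restrict_mem measurableSet_Ioo] with t hc hs hH htm
  have hle := hsub htm
  simp only [← integral_timeMeasure htm.1.le] at hc hs ⊢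
  -- The energy identities of the modes in F are added. On the right only the flux term still
  -- depends on F; the sources are already replaced by bounds uniform in F.
  have key : ∀ F : Finset (Fin d → ℤ), ∑ k ∈ F, (ccoef (w t) k ^ 2 + scoef (w t) k ^ 2) ≤
      (∫ x, w₀ x ^ 2) + 2 * ∫ s, (fluxSum Dw G F s + normSlice ρ₁ s * √(∫ x, w s x ^ 2) +
        √(3 / 2) * (‖ρ₂ s‖ * √(∫ x, ‖Dw s x‖ ^ 2))) ∂(timeMeasure t) := by
    intro F
    have e : ∑ k ∈ F, (ccoef (w t) k ^ 2 + scoef (w t) k ^ 2) =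
        ∑ k ∈ F, (ccoef w₀ k ^ 2 + scoef w₀ k ^ 2) + 2 * ∫ s, ∑ k ∈ F,
          (weakRate G ρ₁ ρ₂ _ (isSmooth_tcos k) s * ccoef (w s) k +
            weakRate G ρ₁ ρ₂ _ (isSmooth_tsin k) s * scoef (w s) k) ∂(timeMeasure t) := by
      rw [integral_finsetSum, Finset.mul_sum, ← Finset.sum_add_distrib]
      · refine Finset.sum_congr rfl fun k _ => ?_
        have i1 := Integrable.mono_measure (hic k) hle
        have i2 := Integrable.mono_measure (his k) hle
        have h3 := integral_add i1 i2
        have h1 := hc k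
        have h2 := hs k
        simp only [ccoef, scoef] at *
        rw [h3, h1, h2]; ring
      · exact fun k _ => Integrable.mono_measure ((hic k).add (his k)) hle
    rw [e]
    refine add_le_add (sum_sq_coef_le h.initial F) (mul_le_mul_of_nonneg_left ?_ (by norm_num))
    refine integral_mono_ae (integrable_finsetSum _ fun k _ =>
      Integrable.mono_measure ((hic k).add (his k)) hle)
      (Integrable.mono_measure (((hiF F).add hi1).add hi2) hle) ?_
    filter_upwards [ae_mono hle hall] with s hs
    exact sum_weakRate_le hs.1 hs.2.2.1 hs.2.2.2 F
  have hlimL := hasSum_sq_coef hH.memLp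
  -- As F exhausts all frequencies, Parseval for products identifies the limit of the flux term at
  -- a.e. time and dominated convergence passes it through the time integral.
  have hlimR : Filter.Tendsto (fun F : Finset (Fin d → ℤ) => (∫ x, w₀ x ^ 2) +
      2 * ∫ s, (fluxSum Dw G F s + normSlice ρ₁ s * √(∫ x, w s x ^ 2) +
        √(3 / 2) * (‖ρ₂ s‖ * √(∫ x, ‖Dw s x‖ ^ 2))) ∂(timeMeasure t)) Filter.atTop
      (nhds ((∫ x, w₀ x ^ 2) + 2 * ∫ s, ((∑ i, ∫ x, Dw s x i * G s x i) +
        normSlice ρ₁ s * √(∫ x, w s x ^ 2) +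
        √(3 / 2) * (‖ρ₂ s‖ * √(∫ x, ‖Dw s x‖ ^ 2))) ∂(timeMeasure t))) := by
    refine tendsto_const_nhds.add (Filter.Tendsto.const_mul 2 ?_)
    refine tendsto_integral_filter_of_dominated_convergence
      (fun s => ((∫ x, ‖Dw s x‖ ^ 2) + ∫ x, ‖G s x‖ ^ 2) + ‖normSlice ρ₁ s * √(∫ x, w s x ^ 2)‖ +
        ‖√(3 / 2) * (‖ρ₂ s‖ * √(∫ x, ‖Dw s x‖ ^ 2))‖) ?_ ?_ ?_ ?_
    · exact Filter.Eventually.of_forall fun F =>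
        (Integrable.mono_measure (((hiF F).add hi1).add hi2) hle).1
    · refine Filter.Eventually.of_forall fun F => ?_
      filter_upwards [ae_mono hle hall] with s hs
      exact (norm_add₃_le).trans (add_le_add (add_le_add
        (abs_fluxSum_le hs.1.memLp_grad hs.2.1 F) le_rfl) le_rfl)
    · exact Integrable.mono_measure ((hdom.add hi1.norm).add hi2.norm) hle
    · filter_upwards [ae_mono hle hall] with s hs
      exact ((tendsto_fluxSum hs.1.memLp_grad hs.2.1).add_const _).add_const _
  exact le_of_tendsto_of_tendsto' hlimL hlimR key

end IsBalance
end ScalarCD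

/-! ### Grönwall's inequality, absorption of the supremum, mixed norms -/

namespace ScalarCD

/-- **Grönwall's inequality** in integrated form. -/
lemma gronwall_integral {t Λ C : ℝ} (ht : 0 ≤ t) (hΛ : 0 ≤ Λ) {p : ℝ → ℝ}
    (hp : IntervalIntegrable p volume 0 t)
    (h : ∀ᵐ s, s ∈ Ioo 0 t → p s ≤ C + Λ * ∫ r in (0 : ℝ)..s, p r) :
    C + Λ * ∫ r in (0 : ℝ)..t, p r ≤ C * Real.exp (Λ * t) := by
  set y : ℝ → ℝ := fun s => C + Λ * ∫ r in (0 : ℝ)..s, p r with hy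
  have hyac : AbsolutelyContinuousOnInterval y 0 t := by
    have h1 : AbsolutelyContinuousOnInterval (fun _ : ℝ => C) 0 t :=
      contDiffOn_const.absolutelyContinuousOnInterval
    exact h1.add ((hp.absolutelyContinuousOnInterval_intervalIntegral (c := 0) (by simp)).const_mul
      Λ)
  -- Integrating factor: y g is absolutely continuous with derivative Λ(p - y)g ≤ 0 almost
  -- everywhere.
  set g : ℝ → ℝ := fun s => Real.exp (-(Λ * s))
  have hgd : ∀ s, HasDerivAt g (-Λ * g s) s := by
    intro s
    have := ((hasDerivAt_id s).const_mul Λ).neg.exp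
    simp only [id, mul_one] at this
    rw [mul_comm] at this
    exact this
  have hgac : AbsolutelyContinuousOnInterval g 0 t := by
    have : ContDiff ℝ 1 g := by fun_prop
    exact this.contDiffOn.absolutelyContinuousOnInterval
  have h2 := hyac.integral_deriv_mul_eq_sub hgac
  have h3 : ∫ s in (0 : ℝ)..t, (deriv y s * g s + y s * deriv g s) ≤ 0 := by
    rw [intervalIntegral.integral_of_le ht, integral_Ioc_eq_integral_Ioo]
    refine integral_nonpos_of_ae ?_
    rw [Filter.EventuallyLE, ae_restrict_iff' measurableSet_Ioo]
    filter_upwards [hp.ae_hasDerivAt_integral, h] with s hs1 hs2 hs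
    have hsm : s ∈ uIcc 0 t := by rw [uIcc_of_le ht]; exact Ioo_subset_Icc_self hs
    have e1 : deriv y s = Λ * p s :=
      (((hs1 hsm 0 (by simp)).const_mul Λ).const_add C).deriv
    rw [e1, (hgd s).deriv]
    have h4 : Λ * p s ≤ Λ * y s := mul_le_mul_of_nonneg_left (hs2 hs) hΛ
    have h5 : 0 < g s := Real.exp_pos _
    simp only [Pi.zero_apply]
    nlinarith
  rw [h2] at h3
  have h6 : y 0 * g 0 = C := by simp [hy, g]
  rw [h6] at h3
  have h7 : g t * Real.exp (Λ * t) = 1 := by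
    simp only [g]; rw [← Real.exp_add]; simp
  calc C + Λ * ∫ r in (0 : ℝ)..t, p r = y t * (g t * Real.exp (Λ * t)) := by rw [h7, mul_one]
    _ = (y t * g t) * Real.exp (Λ * t) := by ring
    _ ≤ C * Real.exp (Λ * t) := by
        refine mul_le_mul_of_nonneg_right (by linarith) (Real.exp_pos _).le

/-- A bounded function has a least essential upper bound. -/
lemma exists_least_ae_bound {X : Type*} [MeasurableSpace X] {μ : Measure X} {p : X → ℝ} {B : ℝ}
    (hB : ∀ᵐ s ∂μ, p s ≤ B) (hp : ∀ᵐ s ∂μ, 0 ≤ p s) :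
    ∃ M, 0 ≤ M ∧ (∀ᵐ s ∂μ, p s ≤ M) ∧ ∀ c, 0 ≤ c → (∀ᵐ s ∂μ, p s ≤ c) → M ≤ c := by
  have h1 : ∀ c, 0 ≤ c → (∀ᵐ s ∂μ, p s ≤ c) → eLpNormEssSup p μ ≤ ENNReal.ofReal c := by
    intro c hc h
    refine eLpNormEssSup_le_of_ae_bound ?_
    filter_upwards [h, hp] with s hs hs0
    rwa [Real.norm_eq_abs, abs_of_nonneg hs0]
  have hfin : eLpNormEssSup p μ ≠ ∞ := by
    refine ne_top_of_le_ne_top ENNReal.ofReal_ne_top (h1 (max B 0) (le_max_right _ _) ?_)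
    filter_upwards [hB] with s hs using hs.trans (le_max_left _ _)
  refine ⟨(eLpNormEssSup p μ).toReal, ENNReal.toReal_nonneg, ?_, fun c hc h => ?_⟩
  · filter_upwards [ae_le_eLpNormEssSup (f := p) (μ := μ)] with s hs
    have := ENNReal.toReal_mono hfin hs
    simp only [toReal_enorm] at this
    exact (le_abs_self _).trans this
  · exact ENNReal.toReal_le_of_le_ofReal hc (h1 c hc h)

/-- The estimate which follows from an integrated energy inequality. -/
theorem energy_bound {T Λ p₀ B : ℝ} (hΛ : 0 ≤ Λ) (hp₀ : 0 ≤ p₀) {p n κ I : ℝ → ℝ}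
    (hp : Integrable p (timeMeasure T)) (hn : Integrable n (timeMeasure T))
    (hκ : Integrable κ (timeMeasure T)) (hp0 : ∀ s, 0 ≤ p s) (hn0 : ∀ s, 0 ≤ n s)
    (hκ0 : ∀ s, 0 ≤ κ s) (hI0 : ∀ s, 0 ≤ s → 0 ≤ I s) (hB : ∀ᵐ s ∂(timeMeasure T), p s ≤ B)
    (h : ∀ᵐ s ∂(timeMeasure T), p s + I s ≤ p₀ + Λ * (∫ r in (0 : ℝ)..s, p r) +
      2 * (∫ r in (0 : ℝ)..s, n r * √(p r)) + ∫ r in (0 : ℝ)..s, κ r) :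
    ∀ᵐ t ∂(timeMeasure T),
      (∀ᵐ s ∂(timeMeasure t), p s ≤ 4 / 3 * Real.exp (2 * Λ * t) *
        (p₀ + 4 * (∫ r in (0 : ℝ)..t, n r) ^ 2 + ∫ r in (0 : ℝ)..t, κ r)) ∧
      I t ≤ 4 / 3 * Real.exp (2 * Λ * t) *
        (p₀ + 4 * (∫ r in (0 : ℝ)..t, n r) ^ 2 + ∫ r in (0 : ℝ)..t, κ r) := by
  filter_upwards [h, ae_restrict_mem measurableSet_Ioo] with t hht htm
  have ht0 : 0 ≤ t := htm.1.le
  have hle : timeMeasure t ≤ timeMeasure T :=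
    Measure.restrict_mono (Ioo_subset_Ioo_right htm.2.le) le_rfl
  have hp' := intervalIntegrable_of_timeMeasure htm.1 (hp.mono_measure hle)
  have hn' := intervalIntegrable_of_timeMeasure htm.1 (hn.mono_measure hle)
  have hκ' := intervalIntegrable_of_timeMeasure htm.1 (hκ.mono_measure hle)
  -- Replacing √p in the source by √M, with M the least essential bound on (0,t), makes the
  -- right-hand side a constant C to which Grönwall applies. Minimality of M closes the argument
  -- below.
  obtain ⟨M, hM0, hM, hMmin⟩ := exists_least_ae_bound (ae_mono hle hB)
    (Filter.Eventually.of_forall hp0)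
  set N := ∫ r in (0 : ℝ)..t, n r
  set R := ∫ r in (0 : ℝ)..t, κ r
  have hN : 0 ≤ N := intervalIntegral.integral_nonneg ht0 fun s _ => hn0 s
  have hR : 0 ≤ R := intervalIntegral.integral_nonneg ht0 fun s _ => hκ0 s
  set C := p₀ + 2 * (N * √M) + R with hC
  have hC0 : 0 ≤ C := by positivity
  have hsubset : ∀ {s}, s ∈ Icc 0 t → uIcc 0 s ⊆ uIcc 0 t := fun {s} hs => by
    rw [uIcc_of_le hs.1, uIcc_of_le ht0]; exact Icc_subset_Icc_right hs.2
  have hM' := (ae_restrict_iff' measurableSet_Ioo).1 hM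
  have hsrc : ∀ s ∈ Icc 0 t, ∫ r in (0 : ℝ)..s, n r * √(p r) ≤ N * √M := by
    intro s hs
    have i1 : IntervalIntegrable (fun r => n r * √M) volume 0 s :=
      (hn'.mono_set (hsubset hs)).mul_const _
    have i0 : IntervalIntegrable (fun r => n r * √(p r)) volume 0 s := by
      rw [intervalIntegrable_iff_integrableOn_Ioo_of_le hs.1] at i1 ⊢
      refine Integrable.mono' i1 ?_ ?_
      · exact ((hn.mono_measure (Measure.restrict_mono
          (Ioo_subset_Ioo_right (hs.2.trans htm.2.le)) le_rfl)).1).mul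
          (Real.continuous_sqrt.comp_aestronglyMeasurable (hp.mono_measure (Measure.restrict_mono
          (Ioo_subset_Ioo_right (hs.2.trans htm.2.le)) le_rfl)).1)
      · rw [ae_restrict_iff' measurableSet_Ioo]
        filter_upwards [hM'] with r hr hrm
        rw [Real.norm_eq_abs, abs_of_nonneg (mul_nonneg (hn0 r) (Real.sqrt_nonneg _))]
        exact mul_le_mul_of_nonneg_left
          (Real.sqrt_le_sqrt (hr ⟨hrm.1, hrm.2.trans_le hs.2⟩)) (hn0 r)
    calc ∫ r in (0 : ℝ)..s, n r * √(p r) ≤ ∫ r in (0 : ℝ)..s, n r * √M := by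
          refine intervalIntegral.integral_mono_ae_restrict hs.1 i0 i1 ?_
          rw [Filter.EventuallyLE, ← restrict_Ioo_eq_restrict_Icc,
            ae_restrict_iff' measurableSet_Ioo]
          filter_upwards [hM'] with r hr hrm
          exact mul_le_mul_of_nonneg_left
            (Real.sqrt_le_sqrt (hr ⟨hrm.1, hrm.2.trans_le hs.2⟩)) (hn0 r)
      _ = (∫ r in (0 : ℝ)..s, n r) * √M := intervalIntegral.integral_mul_const _ _
      _ ≤ N * √M := mul_le_mul_of_nonneg_right (intervalIntegral.integral_mono_interval le_rfl
          hs.1 hs.2 (Filter.Eventually.of_forall hn0) hn') (Real.sqrt_nonneg _)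
  have hkap : ∀ s ∈ Icc 0 t, ∫ r in (0 : ℝ)..s, κ r ≤ R := fun s hs =>
    intervalIntegral.integral_mono_interval le_rfl hs.1 hs.2 (Filter.Eventually.of_forall hκ0) hκ'
  have hstep : ∀ᵐ s, s ∈ Ioo 0 t → p s ≤ C + Λ * ∫ r in (0 : ℝ)..s, p r := by
    have := (ae_restrict_iff' measurableSet_Ioo).1 h
    filter_upwards [this] with s hs hsm
    have h1 := hs ⟨hsm.1, hsm.2.trans htm.2⟩
    have h2 := hsrc s (Ioo_subset_Icc_self hsm)
    have h3 := hkap s (Ioo_subset_Icc_self hsm)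
    have h4 := hI0 s hsm.1.le
    simp only [hC]
    linarith
  have hgr : ∀ s ∈ Icc 0 t, C + Λ * ∫ r in (0 : ℝ)..s, p r ≤ C * Real.exp (Λ * t) := by
    intro s hs
    refine (gronwall_integral hs.1 hΛ (hp'.mono_set (hsubset hs)) ?_).trans ?_
    · filter_upwards [hstep] with r hr hrm
      exact hr ⟨hrm.1, hrm.2.trans_le hs.2⟩
    · exact mul_le_mul_of_nonneg_left (Real.exp_le_exp.2 (mul_le_mul_of_nonneg_left hs.2 hΛ)) hC0
  set E := Real.exp (Λ * t)
  have hE1 : 1 ≤ E := Real.one_le_exp (mul_nonneg hΛ ht0)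
  have hE2 : Real.exp (2 * Λ * t) = E ^ 2 := by
    rw [← Real.exp_nat_mul]; congr 1; push_cast; ring
  have hpC : ∀ᵐ s ∂(timeMeasure t), p s ≤ C * E := by
    rw [ae_restrict_iff' measurableSet_Ioo]
    filter_upwards [hstep] with s hs hsm
    exact (hs hsm).trans (hgr s (Ioo_subset_Icc_self hsm))
  -- C itself contains √M. Young's inequality 2N√M E ≤ M/4 + 4E²N² together with M ≤ C E absorbs a
  -- quarter of C E: this gives the factor 4/3, the coefficient 4 of N², and, through E², the
  -- exponent 2Λt.
  have hMC : M ≤ C * E := hMmin _ (by positivity) hpC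
  have hsq := Real.sq_sqrt hM0
  have hy1 : 2 * (N * √M) * E ≤ M / 4 + 4 * E ^ 2 * N ^ 2 := by
    nlinarith [sq_nonneg (√M / 2 - 2 * E * N)]
  have hEE : E ≤ E ^ 2 := by nlinarith
  have hpR : E * (p₀ + R) ≤ E ^ 2 * (p₀ + R) := mul_le_mul_of_nonneg_right hEE (by positivity)
  have hCE : C * E = E * (p₀ + R) + 2 * (N * √M) * E := by simp only [hC]; ring
  have hfin : C * E ≤ 4 / 3 * Real.exp (2 * Λ * t) * (p₀ + 4 * N ^ 2 + R) := by
    rw [hE2]; nlinarith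
  constructor
  · filter_upwards [hpC] with s hs using hs.trans hfin
  · have h1 := hsrc t (right_mem_Icc.2 ht0)
    have h2 := hgr t (right_mem_Icc.2 ht0)
    have h3 := hp0 t
    refine le_trans ?_ hfin
    refine le_trans ?_ h2
    simp only [hC]
    linarith

section Norms

variable {d : ℕ}

lemma sq_eLpNorm_two {X E : Type*} [MeasurableSpace X] {μ : Measure X}
    [NormedAddCommGroup E] {v : X → E} (hv : MemLp v 2 μ) :
    eLpNorm v 2 μ ^ 2 = ENNReal.ofReal (∫ x, ‖v x‖ ^ 2 ∂μ) := by
  rw [← ENNReal.ofReal_toReal hv.2.ne, toReal_eLpNorm_two hv,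
    ← ENNReal.ofReal_pow (Real.sqrt_nonneg _),
    Real.sq_sqrt (integral_nonneg fun x => by positivity)]

lemma sq_mixedNorm_top_le {t Y : ℝ} (hY : 0 ≤ Y) {w : ℝ → Td d → ℝ}
    (hw : ∀ᵐ s ∂(timeMeasure t), MemLp (w s) 2)
    (h : ∀ᵐ s ∂(timeMeasure t), ∫ x, w s x ^ 2 ≤ Y) :
    mixedNorm ∞ 2 t w ^ 2 ≤ ENNReal.ofReal Y := by
  have h1 : mixedNorm ∞ 2 t w ≤ ENNReal.ofReal (√Y) := by
    rw [mixedNorm, eLpNorm_exponent_top]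
    refine essSup_le_of_ae_le _ ?_
    filter_upwards [hw, h] with s hs1 hs2
    simp only [enorm_eq_self]
    rw [← ENNReal.ofReal_toReal hs1.2.ne, toReal_eLpNorm_two hs1]
    refine ENNReal.ofReal_le_ofReal (Real.sqrt_le_sqrt ?_)
    simpa using hs2
  calc mixedNorm ∞ 2 t w ^ 2 ≤ ENNReal.ofReal (√Y) ^ 2 := by gcongr
    _ = ENNReal.ofReal Y := by rw [← ENNReal.ofReal_pow (Real.sqrt_nonneg _), Real.sq_sqrt hY]

lemma sq_mixedNorm_two {t : ℝ} {E : Type*} [NormedAddCommGroup E] {V : ℝ → Td d → E}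
    (hV : MemLp (fun p : ℝ × Td d => V p.1 p.2) 2 (stMeasure d t)) :
    mixedNorm 2 2 t V ^ 2 = ENNReal.ofReal (∫ s, (∫ x, ‖V s x‖ ^ 2) ∂(timeMeasure t)) := by
  have hi := integrable_integral_normSq_slice hV
  have hs := ae_memLp_slice hV
  rw [ofReal_integral_eq_lintegral_ofReal hi
    (Filter.Eventually.of_forall fun s => integral_nonneg fun x => by positivity)]
  rw [mixedNorm, eLpNorm_eq_lintegral_rpow_enorm_toReal (p := 2) two_ne_zero ENNReal.ofNat_ne_top,
    ← ENNReal.rpow_natCast, ← ENNReal.rpow_mul]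
  have : 1 / (2 : ℝ≥0∞).toReal * ((2 : ℕ) : ℝ) = 1 := by norm_num
  rw [this, ENNReal.rpow_one]
  refine lintegral_congr_ae ?_
  filter_upwards [hs] with s hs
  rw [← sq_eLpNorm_two hs]
  simp

end Norms
end ScalarCD

/-! ### Pointwise and integral estimates of the convective and diffusive fluxes -/

namespace ScalarCD

lemma memLp_top_comp {X : Type*} [MeasurableSpace X] {μ : Measure X} {K : Set ℝ}
    (hK : IsCompact K) {h : ℝ → ℝ} (hh : ContinuousOn h K) {u : X → ℝ}
    (hu : AEStronglyMeasurable u μ) (huK : ∀ᵐ x ∂μ, u x ∈ K) :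
    MemLp (fun x => h (u x)) ∞ μ := by
  obtain ⟨H, hH, ⟨C, hC⟩, he⟩ := exists_bounded_extension hK hh
  have h1 : MemLp (fun x => H (u x)) ∞ μ :=
    memLp_top_of_bound (hH.comp_aestronglyMeasurable hu) C (Filter.Eventually.of_forall fun x => hC _)
  refine (memLp_congr_ae ?_).1 h1
  filter_upwards [huK] with x hx using he _ hx

lemma abs_sub_le_of_deriv_bound {f f' : ℝ → ℝ} {a b S : ℝ}
    (hf : ∀ s ∈ Icc a b, HasDerivAt f (f' s) s) (hS : ∀ s ∈ Icc a b, |f' s| ≤ S) {v z : ℝ}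
    (hv : v ∈ Icc a b) (hz : z ∈ Icc a b) : |f v - f z| ≤ S * |v - z| := by
  have := Convex.norm_image_sub_le_of_norm_hasDerivWithin_le (f := f) (f' := f') (C := S)
      (s := Icc a b) (fun x hx => (hf x hx).hasDerivWithinAt) (fun x hx => hS x hx)
      (convex_Icc a b) hz hv
  simpa using this

/-- Mean value inequality for f minus its tangent at z, on the segment between z and v. The constant
S, without the factor 1/2, is what the definition of Λ accommodates. -/
lemma abs_taylor_le {f f' f'' : ℝ → ℝ} {a b S : ℝ}
    (hf : ∀ s ∈ Icc a b, HasDerivAt f (f' s) s) (hf' : ∀ s ∈ Icc a b, HasDerivAt f' (f'' s) s)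
    (hS : ∀ s ∈ Icc a b, |f'' s| ≤ S) {v z : ℝ}
    (hv : v ∈ Icc a b) (hz : z ∈ Icc a b) : |f v - f z - f' z * (v - z)| ≤ S * (v - z) ^ 2 := by
  have hsub : ∀ s ∈ uIcc z v, s ∈ Icc a b := fun s hs =>
    (convex_Icc a b).ordConnected.uIcc_subset hz hv hs
  have hS0 : 0 ≤ S := (abs_nonneg _).trans (hS z hz)
  have := Convex.norm_image_sub_le_of_norm_hasDerivWithin_le
    (f := fun s => f s - f' z * (s - z)) (f' := fun s => f' s - f' z) (C := S * |v - z|)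
      (s := uIcc z v) (fun x hx => ?_) (fun x hx => ?_) (convex_uIcc z v) left_mem_uIcc
      right_mem_uIcc
  · have e : f v - f' z * (v - z) - (f z - f' z * (z - z)) = f v - f z - f' z * (v - z) := by ring
    rw [e, Real.norm_eq_abs, Real.norm_eq_abs, mul_assoc, ← sq, sq_abs] at this
    exact this
  · have h1 := ((hf x (hsub x hx)).sub
      (((hasDerivAt_id x).sub_const z).const_mul (f' z))).hasDerivWithinAt (s := uIcc z v)
    rw [mul_one] at h1
    exact h1
  · refine (abs_sub_le_of_deriv_bound hf' hS (hsub x hx) hz).trans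
      (mul_le_mul_of_nonneg_left ?_ hS0)
    have := abs_sub_left_of_mem_uIcc hx
    rwa [abs_sub_comm x z, abs_sub_comm v z] at *

variable {d : ℕ}

/-- The flux `f(v) - ε A(v) ∇v` of the convection-diffusion equation. -/
noncomputable def cdFlux (f : Fin d → ℝ → ℝ) (A : ℝ → ℝ) (ε : ℝ) (v : Td d → ℝ)
    (Dv : Td d → EuclideanSpace ℝ (Fin d)) (x : Td d) : EuclideanSpace ℝ (Fin d) :=
  WithLp.toLp 2 fun i => f i (v x) - ε * (A (v x) * Dv x i)

section Slices

variable {v z : Td d → ℝ} {Dv Dz : Td d → EuclideanSpace ℝ (Fin d)}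

lemma memLp_comp_mul {X : Type*} [MeasurableSpace X] {μ : Measure X} {K : Set ℝ}
    (hK : IsCompact K) {h : ℝ → ℝ} (hh : ContinuousOn h K) {u : X → ℝ}
    (hu : AEStronglyMeasurable u μ) (huK : ∀ᵐ x ∂μ, u x ∈ K) {p : ℝ≥0∞} {g : X → ℝ}
    (hg : MemLp g p μ) : MemLp (fun x => h (u x) * g x) p μ :=
  MemLp.mul' hg (memLp_top_comp hK hh hu huK)

lemma IsH1.integrable_comp_mul_grad (hv : AEStronglyMeasurable v volume) (hz : IsH1 z Dz)
    {K : Set ℝ} (hK : IsCompact K) (hvK : ∀ᵐ x, v x ∈ K) {h : ℝ → ℝ} (hh : ContinuousOn h K)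
    (i : Fin d) : Integrable (fun x => h (v x) * Dz x i) :=
  (memLp_comp_mul hK hh hv hvK (memLp_coord hz.memLp_grad i)).integrable (by norm_num)

lemma memLp_of_coord {X : Type*} [MeasurableSpace X] {μ : Measure X} {p : ℝ≥0∞}
    {g : X → EuclideanSpace ℝ (Fin d)} (h : ∀ i, MemLp (fun x => g x i) p μ) : MemLp g p μ := by
  have h1 : MemLp (fun x => WithLp.ofLp (g x)) p μ := MemLp.of_eval h
  exact (PiLp.continuousLinearEquiv 2 ℝ (fun _ : Fin d => ℝ)).symm.toContinuousLinearMap.comp_memLp' h1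

/-- Convection produces no energy by itself. -/
lemma IsH1.sum_integral_grad_mul_cdFlux_le (hv : IsH1 v Dv) {K : Set ℝ} (hK : IsCompact K)
    (hvK : ∀ᵐ x, v x ∈ K) {f : Fin d → ℝ → ℝ} (hf : ∀ i, ContinuousOn (f i) K) {A : ℝ → ℝ}
    (hA : ContinuousOn A K) (hA1 : ∀ s ∈ K, 1 ≤ A s) {ε : ℝ} (hε : 0 ≤ ε) :
    ∑ i, ∫ x, Dv x i * cdFlux f A ε v Dv x i ≤ -(ε * ∫ x, ‖Dv x‖ ^ 2) := by
  rw [integral_normSq_eq hv.memLp_grad, Finset.mul_sum, ← Finset.sum_neg_distrib]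
  refine Finset.sum_le_sum fun i _ => ?_
  -- The convective part f(v)∂ᵢv is an exact derivative and integrates to zero, so only diffusion
  -- remains.
  have e0 := hv.integral_mul_grad_eq_zero hK hvK (hf i) i
  have i1 := IsH1.integrable_comp_mul_grad hv.memLp.1 hv hK hvK (hf i) i
  have i2 : Integrable (fun x => Dv x i * (A (v x) * Dv x i)) :=
    (memLp_coord hv.memLp_grad i).integrable_mul
      (memLp_comp_mul hK hA hv.memLp.1 hvK (memLp_coord hv.memLp_grad i))
  have e1 : ∫ x, Dv x i * cdFlux f A ε v Dv x i =
      (∫ x, f i (v x) * Dv x i) - ε * ∫ x, Dv x i * (A (v x) * Dv x i) := by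
    rw [← integral_const_mul, ← integral_sub i1 (i2.const_mul ε)]
    refine integral_congr_ae (Filter.Eventually.of_forall fun x => ?_)
    simp only [cdFlux]; ring
  rw [e1, e0, zero_sub, neg_le_neg_iff]
  refine mul_le_mul_of_nonneg_left (integral_mono_ae
    (memLp_coord hv.memLp_grad i).integrable_sq i2 ?_) hε
  filter_upwards [hvK] with x hx
  nlinarith [hA1 _ hx, sq_nonneg (Dv x i)]

lemma integral_sub_sub {X : Type*} [MeasurableSpace X] {μ : Measure X} {p q r s : X → ℝ}
    (hp : Integrable p μ) (hq : Integrable q μ) (hr : Integrable r μ) (hs : Integrable s μ) :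
    ∫ x, ((p x - q x) - (r x - s x)) ∂μ =
      ((∫ x, p x ∂μ) - ∫ x, q x ∂μ) - ((∫ x, r x ∂μ) - ∫ x, s x ∂μ) := by
  rw [← integral_sub hp hq, ← integral_sub hr hs]
  exact integral_sub (hp.sub hq) (hr.sub hs)

/-- The integrals of f(v)Dv, f(z)Dz and f'(z)z Dz vanish as exact derivatives, and ∫ f(z)Dv = -∫
f'(z)v Dz. What is left is minus the integral of the Taylor remainder of f at z times Dz: no
derivative of v survives, and the remainder is quadratic in v - z. -/
lemma IsH1.integral_convective_le (hv : IsH1 v Dv) (hz : IsH1 z Dz) {a b : ℝ}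
    (hvI : ∀ᵐ x, v x ∈ Icc a b) (hzI : ∀ᵐ x, z x ∈ Icc a b) {f f' f'' : ℝ → ℝ} {S L : ℝ}
    (hf : ∀ s ∈ Icc a b, HasDerivAt f (f' s) s) (hf' : ∀ s ∈ Icc a b, HasDerivAt f' (f'' s) s)
    (hS : ∀ s ∈ Icc a b, |f'' s| ≤ S) {i : Fin d} (hL : ∀ᵐ x, |Dz x i| ≤ L) :
    ∫ x, (f (v x) - f (z x)) * (Dv x i - Dz x i) ≤ S * L * ∫ x, (v x - z x) ^ 2 := by
  have hfc : ContinuousOn f (Icc a b) := fun s hs => (hf s hs).continuousAt.continuousWithinAt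
  have hfc' : ContinuousOn f' (Icc a b) := fun s hs => (hf' s hs).continuousAt.continuousWithinAt
  have hK : IsCompact (Icc a b) := isCompact_Icc
  -- The chain rule is stated for functions on ℝ with bounded continuous derivative, so f is
  -- extended from [a,b].
  obtain ⟨g, g', hg, hgc, ⟨C, hC⟩, hgf⟩ := exists_C1_extension hf hfc'
  have k1 := hz.integral_comp_mul_grad hv hg hgc hC i
  have k1' : ∫ x, f (z x) * Dv x i = -∫ x, (f' (z x) * v x) * Dz x i := by
    rw [integral_congr_ae (g := fun x => g (z x) * Dv x i), k1]
    · congr 1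
      refine integral_congr_ae ?_
      filter_upwards [hzI] with x hx
      rw [(hgf _ hx).2]
    · filter_upwards [hzI] with x hx
      rw [(hgf _ hx).1]
  have k2 := hv.integral_mul_grad_eq_zero hK hvI hfc i
  have k3 := hz.integral_mul_grad_eq_zero hK hzI hfc i
  have k4 := hz.integral_mul_grad_eq_zero hK hzI (h := fun s => f' s * s)
    (hfc'.mul continuousOn_id) i
  have j1 := IsH1.integrable_comp_mul_grad hv.memLp.1 hv hK hvI hfc i
  have j2 := IsH1.integrable_comp_mul_grad hz.memLp.1 hz hK hzI hfc i
  have j3 := IsH1.integrable_comp_mul_grad hv.memLp.1 hz hK hvI hfc i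
  have j4 := IsH1.integrable_comp_mul_grad hz.memLp.1 hv hK hzI hfc i
  have j5 := IsH1.integrable_comp_mul_grad hz.memLp.1 hz hK hzI (h := fun s => f' s * s)
    (hfc'.mul continuousOn_id) i
  have j6 : Integrable (fun x => (f' (z x) * v x) * Dz x i) := by
    have : MemLp (fun x => v x * Dz x i) 2 :=
      memLp_comp_mul hK (h := fun s => s) continuousOn_id hv.memLp.1 hvI
        (memLp_coord hz.memLp_grad i)
    refine ((memLp_comp_mul hK hfc' hz.memLp.1 hzI this).integrable (by norm_num)).congr
      (Filter.Eventually.of_forall fun x => ?_)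
    simp only; ring
  have e1 : ∫ x, (f (v x) - f (z x)) * (Dv x i - Dz x i) =
      -(∫ x, f (v x) * Dz x i) + ∫ x, (f' (z x) * v x) * Dz x i := by
    have : ∀ x, (f (v x) - f (z x)) * (Dv x i - Dz x i) =
      (f (v x) * Dv x i - f (v x) * Dz x i) - (f (z x) * Dv x i - f (z x) * Dz x i) :=
      fun x => by ring
    simp only [this]
    rw [integral_sub_sub j1 j3 j4 j2, k2, k3, k1']
    ring
  have e2 : ∫ x, -((f (v x) - f (z x) - f' (z x) * (v x - z x)) * Dz x i) =
      -(∫ x, f (v x) * Dz x i) + ∫ x, (f' (z x) * v x) * Dz x i := by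
    have : ∀ x, -((f (v x) - f (z x) - f' (z x) * (v x - z x)) * Dz x i) =
      ((f' (z x) * v x) * Dz x i - f (v x) * Dz x i) -
        (f' (z x) * z x * Dz x i - f (z x) * Dz x i) := fun x => by ring
    simp only [this]
    rw [integral_sub_sub j6 j3 j5 j2, k3, k4]
    ring
  have hw : MemLp (fun x => v x - z x) 2 := hv.memLp.sub hz.memLp
  rw [e1, ← e2, ← integral_const_mul]
  refine integral_mono_ae ?_ (hw.integrable_sq.const_mul _) ?_
  · refine (((j6.sub j3).sub (j5.sub j2))).congr (Filter.Eventually.of_forall fun x => ?_)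
    simp only [Pi.sub_apply]; ring
  · filter_upwards [hvI, hzI, hL] with x h1 h2 h3
    have h4 := abs_taylor_le hf hf' hS h1 h2
    calc _ ≤ |f (v x) - f (z x) - f' (z x) * (v x - z x)| * |Dz x i| := by
          rw [← abs_mul]; exact neg_le_abs _
      _ ≤ (S * (v x - z x) ^ 2) * L := mul_le_mul h4 h3 (abs_nonneg _) ((abs_nonneg _).trans h4)
      _ = _ := by ring

/-- Writing αV - βZ = α(V - Z) + (α - β)Z, the first part is coercive because α ≥ 1. Young's
inequality for the second costs a quarter of ‖V - Z‖², hence the 3/4. -/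
lemma diffusive_le {n : ℕ} {V Z : EuclideanSpace ℝ (Fin n)} {α β Q L w : ℝ} (hα : 1 ≤ α)
    (hQ : (α - β) ^ 2 ≤ Q * w ^ 2) (hL : ‖Z‖ ≤ L) :
    3 / 4 * ‖V - Z‖ ^ 2 - Q * L ^ 2 * w ^ 2 ≤ ∑ i, (V i - Z i) * (α * V i - β * Z i) := by
  have e : ∑ i, (V i - Z i) * (α * V i - β * Z i) =
      α * ‖V - Z‖ ^ 2 + (α - β) * inner ℝ Z (V - Z) := by
    rw [EuclideanSpace.real_norm_sq_eq, PiLp.inner_apply, Finset.mul_sum, Finset.mul_sum,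
      ← Finset.sum_add_distrib]
    refine Finset.sum_congr rfl fun i _ => ?_
    simp only [PiLp.sub_apply, RCLike.inner_apply, conj_trivial]
    ring
  rw [e]
  have h1 : |inner ℝ Z (V - Z)| ≤ L * ‖V - Z‖ :=
    (abs_real_inner_le_norm _ _).trans (mul_le_mul_of_nonneg_right hL (norm_nonneg _))
  have h2 : -((α - β) * inner ℝ Z (V - Z)) ≤ |α - β| * (L * ‖V - Z‖) := by
    refine (neg_le_abs _).trans ?_
    rw [abs_mul]
    exact mul_le_mul_of_nonneg_left h1 (abs_nonneg _)
  have h3 : |α - β| ^ 2 * L ^ 2 ≤ Q * w ^ 2 * L ^ 2 := by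
    rw [sq_abs]; exact mul_le_mul_of_nonneg_right hQ (sq_nonneg _)
  nlinarith [sq_nonneg (|α - β| * L - 1 / 2 * ‖V - Z‖), sq_nonneg ‖V - Z‖]

/-- The relative energy production of two states with values in an interval. -/
theorem IsH1.sum_integral_sub_mul_cdFlux_le (hv : IsH1 v Dv) (hz : IsH1 z Dz) {a b : ℝ}
    (hvI : ∀ᵐ x, v x ∈ Icc a b) (hzI : ∀ᵐ x, z x ∈ Icc a b) {f f' f'' : Fin d → ℝ → ℝ}
    {A A' : ℝ → ℝ} {S L : Fin d → ℝ} {Q N ε : ℝ} (hε : 0 ≤ ε)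
    (hf : ∀ i, ∀ s ∈ Icc a b, HasDerivAt (f i) (f' i s) s)
    (hf' : ∀ i, ∀ s ∈ Icc a b, HasDerivAt (f' i) (f'' i s) s)
    (hS : ∀ i, ∀ s ∈ Icc a b, |f'' i s| ≤ S i)
    (hA : ∀ s ∈ Icc a b, HasDerivAt A (A' s) s) (hA1 : ∀ s ∈ Icc a b, 1 ≤ A s)
    (hQ : ∀ s ∈ Icc a b, |A' s| ^ 2 ≤ Q)
    (hL : ∀ᵐ x, ∀ i, |Dz x i| ≤ L i) (hN : ∀ᵐ x, ‖Dz x‖ ≤ N) :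
    ∑ i, ∫ x, (Dv x - Dz x) i * (cdFlux f A ε v Dv x - cdFlux f A ε z Dz x) i ≤
      ((∑ i, S i * L i) + ε * Q * N ^ 2) * (∫ x, (v x - z x) ^ 2) -
        3 / 4 * ε * ∫ x, ‖Dv x - Dz x‖ ^ 2 := by
  have hfc : ∀ i, ContinuousOn (f i) (Icc a b) :=
    fun i s hs => (hf i s hs).continuousAt.continuousWithinAt
  have hAc : ContinuousOn A (Icc a b) := fun s hs => (hA s hs).continuousAt.continuousWithinAt
  have hK : IsCompact (Icc a b) := isCompact_Icc
  have hD : MemLp (fun x => Dv x - Dz x) 2 := hv.memLp_grad.sub hz.memLp_grad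
  have hw : MemLp (fun x => v x - z x) 2 := hv.memLp.sub hz.memLp
  have mD : ∀ i, MemLp (fun x => Dv x i - Dz x i) 2 := fun i => memLp_coord hD i
  have mc : ∀ i, MemLp (fun x => f i (v x) - f i (z x)) 2 := fun i =>
    ((memLp_top_comp hK (hfc i) hv.memLp.1 hvI).mono_exponent le_top).sub
      ((memLp_top_comp hK (hfc i) hz.memLp.1 hzI).mono_exponent le_top)
  have md : ∀ i, MemLp (fun x => A (v x) * Dv x i - A (z x) * Dz x i) 2 := fun i =>
    (memLp_comp_mul hK hAc hv.memLp.1 hvI (memLp_coord hv.memLp_grad i)).sub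
      (memLp_comp_mul hK hAc hz.memLp.1 hzI (memLp_coord hz.memLp_grad i))
  have i1 : ∀ i, Integrable (fun x => (f i (v x) - f i (z x)) * (Dv x i - Dz x i)) :=
    fun i => (mc i).integrable_mul (mD i)
  have i2 : ∀ i, Integrable
      (fun x => (Dv x i - Dz x i) * (A (v x) * Dv x i - A (z x) * Dz x i)) :=
    fun i => (mD i).integrable_mul (md i)
  have e1 : ∀ i, ∫ x, (Dv x - Dz x) i * (cdFlux f A ε v Dv x - cdFlux f A ε z Dz x) i =
      (∫ x, (f i (v x) - f i (z x)) * (Dv x i - Dz x i)) -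
        ε * ∫ x, (Dv x i - Dz x i) * (A (v x) * Dv x i - A (z x) * Dz x i) := by
    intro i
    rw [← integral_const_mul, ← integral_sub (i1 i) ((i2 i).const_mul ε)]
    refine integral_congr_ae (Filter.Eventually.of_forall fun x => ?_)
    simp only [cdFlux, PiLp.sub_apply]; ring
  simp only [e1]
  rw [Finset.sum_sub_distrib, ← Finset.mul_sum, ← integral_finsetSum _ fun i _ => i2 i]
  have c1 : ∑ i, ∫ x, (f i (v x) - f i (z x)) * (Dv x i - Dz x i) ≤
      (∑ i, S i * L i) * ∫ x, (v x - z x) ^ 2 := by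
    rw [Finset.sum_mul]
    refine Finset.sum_le_sum fun i _ => hv.integral_convective_le hz hvI hzI (hf i) (hf' i) (hS i) ?_
    filter_upwards [hL] with x hx using hx i
  have c2 : 3 / 4 * (∫ x, ‖Dv x - Dz x‖ ^ 2) - Q * N ^ 2 * (∫ x, (v x - z x) ^ 2) ≤
      ∫ x, ∑ i, (Dv x i - Dz x i) * (A (v x) * Dv x i - A (z x) * Dz x i) := by
    have i3 : Integrable (fun x => ‖Dv x - Dz x‖ ^ 2) :=
      (memLp_two_iff_integrable_sq_norm hD.1).1 hD
    rw [← integral_const_mul, ← integral_const_mul,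
      ← integral_sub (i3.const_mul _) (hw.integrable_sq.const_mul _)]
    refine integral_mono_ae ((i3.const_mul _).sub (hw.integrable_sq.const_mul _))
      (integrable_finsetSum _ fun i _ => i2 i) ?_
    filter_upwards [hvI, hzI, hN] with x h1 h2 h3
    refine diffusive_le (hA1 _ h1) ?_ h3
    have h4 := abs_sub_le_of_deriv_bound hA (S := √Q)
      (fun s hs => Real.le_sqrt_of_sq_le (hQ s hs)) h1 h2
    have h5 := pow_le_pow_left₀ (abs_nonneg _) h4 2
    rwa [sq_abs, mul_pow, sq_abs, Real.sq_sqrt ((sq_nonneg _).trans (hQ _ h1))] at h5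
  nlinarith [mul_le_mul_of_nonneg_left c2 hε]

end Slices
end ScalarCD

/-! ### From weak solutions to balance laws -/

namespace ScalarCD

variable {d : ℕ} {T : ℝ}

lemma ae_fst_mem_Ioo (T : ℝ) : ∀ᵐ p ∂(stMeasure d T), p.1 ∈ Ioo 0 T :=
  Measure.quasiMeasurePreserving_fst.ae (ae_restrict_mem measurableSet_Ioo)

lemma Integrable.mul_continuous_st {F : ℝ × Td d → ℝ} (hF : Integrable F (stMeasure d T))
    {m : ℝ × Td d → ℝ} (hm : Continuous m) : Integrable (fun p => m p * F p) (stMeasure d T) := by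
  obtain ⟨C, hC⟩ := (isCompact_Icc.prod isCompact_univ :
    IsCompact (Icc 0 T ×ˢ (univ : Set (Td d)))).exists_bound_of_continuousOn hm.continuousOn
  refine hF.bdd_mul (c := C) hm.aestronglyMeasurable ?_
  filter_upwards [ae_fst_mem_Ioo T] with p hp
  exact hC p ⟨Ioo_subset_Icc_self hp, mem_univ _⟩

lemma Integrable.mul_continuous_time {h : ℝ → ℝ} (hh : Integrable h (timeMeasure T))
    {m : ℝ → ℝ} (hm : Continuous m) : Integrable (fun t => m t * h t) (timeMeasure T) := by
  obtain ⟨C, hC⟩ := (isCompact_Icc (a := (0 : ℝ)) (b := T)).exists_bound_of_continuousOn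
    hm.continuousOn
  refine hh.bdd_mul (c := C) hm.aestronglyMeasurable ?_
  filter_upwards [ae_restrict_mem measurableSet_Ioo] with p hp
  exact hC p (Ioo_subset_Icc_self hp)

lemma IsTimeTest.continuous_deriv {θ : ℝ → ℝ} (hθ : IsTimeTest T θ) : Continuous (deriv θ) :=
  hθ.1.continuous_deriv (by simp)

lemma IsTimeTest.isTest_mul {θ : ℝ → ℝ} (hθ : IsTimeTest T θ) {ψ : Td d → ℝ} (hψ : IsSmooth ψ) :
    IsTest T (fun t x => θ t * ψ x) := by
  refine ⟨ContDiff.mul (hθ.1.comp contDiff_fst) (ContDiff.comp (g := fun y => ψ (toTd y)) hψ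
    contDiff_snd), ?_⟩
  obtain ⟨T', hT', h⟩ := hθ.2
  exact ⟨T', hT', fun t ht x => by simp [h t ht]⟩

lemma dt_mul {θ : ℝ → ℝ} (hθ : IsTimeTest T θ) (ψ : Td d → ℝ) (t : ℝ) (x : Td d) :
    dt (fun t x => θ t * ψ x) t x = deriv θ t * ψ x :=
  deriv_mul_const ((hθ.1.differentiable (by simp)) t) _

lemma pd_const_mul {ψ : Td d → ℝ} (c : ℝ) (i : Fin d) (x : Td d) :
    pd i (fun x => c * ψ x) x = c * pd i ψ x := deriv_const_mul_field _

lemma IsTimeTest.integral_deriv {θ : ℝ → ℝ} (hθ : IsTimeTest T θ) (hT : 0 < T) :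
    ∫ t, deriv θ t ∂(timeMeasure T) = -θ 0 := by
  rw [integral_timeMeasure hT.le, intervalIntegral.integral_eq_sub_of_hasDerivAt
    (f := θ) (fun t _ => ((hθ.1.differentiable (by simp)) t).hasDerivAt)
    (hθ.continuous_deriv.intervalIntegrable _ _)]
  obtain ⟨T', hT', h⟩ := hθ.2
  rw [h T hT'.le, zero_sub]

lemma MemMixed.neg {r : ℝ → Td d → ℝ} (hr : MemMixed 1 2 T r) :
    MemMixed 1 2 T (fun t x => -r t x) := by
  refine ⟨hr.1.neg, ?_⟩
  have h := hr.2
  rw [mixedNorm_one_eq] at h ⊢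
  refine lt_of_le_of_lt (lintegral_mono fun t => le_of_eq ?_) h
  exact eLpNorm_neg (r t) 2 volume

lemma normSlice_neg (r : ℝ → Td d → ℝ) : normSlice (fun t x => -r t x) = normSlice r := by
  funext t
  exact congrArg ENNReal.toReal (eLpNorm_neg (r t) 2 volume)

lemma memMixed_zero : MemMixed 1 2 T (fun (_ : ℝ) (_ : Td d) => 0) := by
  refine ⟨aestronglyMeasurable_const, ?_⟩
  rw [mixedNorm_one_eq]
  simp

namespace IsBalance

variable {w w' : ℝ → Td d → ℝ} {Dw Dw' G G' : ℝ → Td d → EuclideanSpace ℝ (Fin d)}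
  {ρ₁ : ℝ → Td d → ℝ} {ρ₂ : ℝ → Hneg1 d} {w₀ w₀' : Td d → ℝ}

/-- Constants are compared with solutions when c lies outside K, where nothing is assumed of f and
A. They are given zero flux, which is legitimate since only the divergence matters. -/
lemma const (hT : 0 < T) (c : ℝ) : IsBalance (d := d) T (fun _ _ => c) (fun _ _ => 0)
    (fun _ _ => 0) (fun _ _ => 0) (fun _ => 0) (fun _ => c) where
  memLp := memLp_const c
  bounded := ⟨|c|, Filter.Eventually.of_forall fun _ => le_rfl⟩
  grad := by
    refine Filter.Eventually.of_forall fun _ => ?_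
    have := (isSmooth_const (d := d) c).hasWeakGrad
    rwa [grad_const] at this
  memLp_grad := memLp_const 0
  memLp_flux := memLp_const 0
  source := memMixed_zero
  dual := by
    have : (fun _ : ℝ => ‖(0 : Hneg1 d)‖) = fun _ => 0 := funext fun _ => ContinuousLinearMap.opNorm_zero
    rw [this]; exact memLp_const 0
  dual_meas := fun p => aestronglyMeasurable_const
  dual_mean := Filter.Eventually.of_forall fun _ => rfl
  initial := memLp_const c
  weak := by
    intro ψ hψ θ hθ
    simp only [weakRate]
    have : ∀ t, deriv θ t * (∫ x, c * ψ x) + θ t * ((∑ i, ∫ x,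
        (0 : EuclideanSpace ℝ (Fin d)) i * pd i ψ x) + (∫ x, 0 * ψ x) +
        (0 : Hneg1 d) (H1.ofSmooth ψ hψ)) = deriv θ t * (∫ x, c * ψ x) := by
      intro t
      simp
    simp only [this]
    rw [integral_mul_const, hθ.integral_deriv hT]
    ring

lemma integrable_test (h : IsBalance T w Dw G ρ₁ ρ₂ w₀) {ψ : Td d → ℝ} (hψ : IsSmooth ψ)
    {θ : ℝ → ℝ} (hθ : IsTimeTest T θ) : Integrable (fun t => deriv θ t * (∫ x, w t x * ψ x) +
      θ t * weakRate G ρ₁ ρ₂ ψ hψ t) (timeMeasure T) :=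
  (Integrable.mul_continuous_time (integrable_integral_mul (h.memLp.integrable (by norm_num))
    hψ.continuous) hθ.continuous_deriv).add
    (Integrable.mul_continuous_time (h.integrable_weakRate hψ) hθ.1.continuous)

/-- The difference of a solution without sources and of a solution with sources. -/
lemma sub (h : IsBalance T w Dw G (fun _ _ => 0) (fun _ => 0) w₀)
    (h' : IsBalance T w' Dw' G' ρ₁ ρ₂ w₀') :
    IsBalance T (fun t x => w t x - w' t x) (fun t x => Dw t x - Dw' t x)
      (fun t x => G t x - G' t x) (fun t x => -ρ₁ t x) (fun t => -ρ₂ t)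
      (fun x => w₀ x - w₀' x) where
  memLp := h.memLp.sub h'.memLp
  bounded := by
    obtain ⟨M, hM⟩ := h.bounded
    obtain ⟨M', hM'⟩ := h'.bounded
    refine ⟨M + M', ?_⟩
    filter_upwards [hM, hM'] with p h1 h2
    exact (abs_sub _ _).trans (add_le_add h1 h2)
  grad := by
    filter_upwards [h.grad, h'.grad] with t h1 h2
    refine ⟨h1.1.sub h2.1, h1.2.1.sub h2.2.1, fun ψ hψ i => ?_⟩
    have e1 := integral_sub (Integrable.mul_continuous h1.1 (hψ.continuous_pd i))
      (Integrable.mul_continuous h2.1 (hψ.continuous_pd i))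
    have e2 := integral_sub
      (Integrable.mul_continuous ((EuclideanSpace.proj (𝕜 := ℝ) i).integrable_comp h1.2.1)
        hψ.continuous)
      (Integrable.mul_continuous ((EuclideanSpace.proj (𝕜 := ℝ) i).integrable_comp h2.2.1)
        hψ.continuous)
    simp only [PiLp.sub_apply, sub_mul]
    rw [e1, h1.2.2 ψ hψ i, h2.2.2 ψ hψ i]
    refine Eq.trans ?_ (congrArg Neg.neg e2.symm)
    ring_nf
    rfl
  memLp_grad := h.memLp_grad.sub h'.memLp_grad
  memLp_flux := h.memLp_flux.sub h'.memLp_flux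
  source := h'.source.neg
  dual := by
    have : (fun t => ‖-ρ₂ t‖) = fun t => ‖ρ₂ t‖ := funext fun t => ContinuousLinearMap.opNorm_neg _
    rw [this]; exact h'.dual
  dual_meas := fun p => (h'.dual_meas p).neg
  dual_mean := by
    filter_upwards [h'.dual_mean] with t ht
    rw [neg_apply, ht, neg_zero]
  initial := h.initial.sub h'.initial
  weak := by
    intro ψ hψ θ hθ
    have k1 := h.weak ψ hψ θ hθ
    have k2 := h'.weak ψ hψ θ hθ
    have e0 : ∫ x, (w₀ x - w₀' x) * ψ x = (∫ x, w₀ x * ψ x) - ∫ x, w₀' x * ψ x := by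
      simp only [sub_mul]
      exact integral_sub (Integrable.mul_continuous (h.initial.integrable (by norm_num))
        hψ.continuous) (Integrable.mul_continuous (h'.initial.integrable (by norm_num))
        hψ.continuous)
    have e1 : ∫ t, (deriv θ t * (∫ x, (w t x - w' t x) * ψ x) + θ t *
        weakRate (fun t x => G t x - G' t x) (fun t x => -ρ₁ t x) (fun t => -ρ₂ t) ψ hψ t)
          ∂(timeMeasure T) =
        (∫ t, (deriv θ t * (∫ x, w t x * ψ x) +
          θ t * weakRate G (fun _ _ => 0) (fun _ => 0) ψ hψ t) ∂(timeMeasure T)) -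
        ∫ t, (deriv θ t * (∫ x, w' t x * ψ x) + θ t * weakRate G' ρ₁ ρ₂ ψ hψ t)
          ∂(timeMeasure T) := by
      rw [← integral_sub (h.integrable_test hψ hθ) (h'.integrable_test hψ hθ)]
      refine integral_congr_ae ?_
      filter_upwards [h.isH1, h'.isH1, ae_memLp_slice h.memLp_flux, ae_memLp_slice h'.memLp_flux,
        h'.source.ae_memLp] with t a1 a2 a3 a4 a5
      have b1 : ∫ x, (w t x - w' t x) * ψ x = (∫ x, w t x * ψ x) - ∫ x, w' t x * ψ x := by
        simp only [sub_mul]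
        exact integral_sub (Integrable.mul_continuous a1.weak.1 hψ.continuous)
          (Integrable.mul_continuous a2.weak.1 hψ.continuous)
      have b2 : ∀ i, ∫ x, (G t x - G' t x) i * pd i ψ x =
          (∫ x, G t x i * pd i ψ x) - ∫ x, G' t x i * pd i ψ x := by
        intro i
        simp only [PiLp.sub_apply, sub_mul]
        exact integral_sub
          (Integrable.mul_continuous ((memLp_coord a3 i).integrable (by norm_num))
            (hψ.continuous_pd i))
          (Integrable.mul_continuous ((memLp_coord a4 i).integrable (by norm_num))
            (hψ.continuous_pd i))
      simp only [weakRate, b1, b2, Finset.sum_sub_distrib, neg_mul, integral_neg, zero_mul,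
        integral_zero, neg_apply, zero_apply]
      ring
    rw [e0, e1]
    linarith

end IsBalance

section WeakSolution

variable {U K : Set ℝ} {f : Fin d → ℝ → ℝ} {A : ℝ → ℝ} {ε : ℝ} {u₀ : Td d → ℝ}
  {r : (φ : ℝ → Td d → ℝ) → IsTest T φ → ℝ} {u : ℝ → Td d → ℝ}
  {Du : ℝ → Td d → EuclideanSpace ℝ (Fin d)} {ρ₁ : ℝ → Td d → ℝ} {ρ₂ : ℝ → Hneg1 d}

/-- Compactness of K bounds f(u) and A(u), so the flux is in L². Product test functions θ(t)ψ(x) and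
Fubini give the weak form slice by slice. -/
lemma IsWeakSolution.isBalance (hu : IsWeakSolution U f A ε T u₀ r u Du) (hK : IsCompact K)
    (huK : ∀ᵐ p ∂(stMeasure d T), u p.1 p.2 ∈ K) (hf : ∀ i, ContinuousOn (f i) K)
    (hA : ContinuousOn A K) (hDu : MemLp (fun p : ℝ × Td d => Du p.1 p.2) 2 (stMeasure d T))
    (hu₀ : MemLp u₀ 2) (hρ₁ : MemMixed 1 2 T ρ₁) (hρ₂ : MemLp (fun t => ‖ρ₂ t‖) 2 (timeMeasure T))
    (hρ₂m : ∀ p, AEStronglyMeasurable (fun t => ρ₂ t p) (timeMeasure T))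
    (hρ₂0 : ∀ᵐ t ∂(timeMeasure T), ρ₂ t (H1.ofSmooth (fun _ => 1) (isSmooth_const 1)) = 0)
    (hr : ∀ θ (hθ : IsTimeTest T θ) ψ (hψ : IsSmooth ψ), r _ (hθ.isTest_mul hψ) =
      ∫ t, θ t * ((∫ x, ρ₁ t x * ψ x) + ρ₂ t (H1.ofSmooth ψ hψ)) ∂(timeMeasure T)) :
    IsBalance T u Du (fun t => cdFlux f A ε (u t) (Du t)) ρ₁ ρ₂ u₀ := by
  have hG : MemLp (fun p : ℝ × Td d => cdFlux f A ε (u p.1) (Du p.1) p.2) 2 (stMeasure d T) :=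
    memLp_of_coord fun i =>
      ((memLp_top_comp hK (hf i) hu.memLp.1 huK).mono_exponent le_top).sub
      ((memLp_comp_mul hK hA hu.memLp.1 huK (memLp_st_coord hDu i)).const_mul ε)
  have hu2 : MemLp (fun p : ℝ × Td d => u p.1 p.2) 2 (stMeasure d T) :=
    hu.memLp.mono_exponent le_top
  refine ⟨hu2, ?_, hu.grad.2, hDu, hG, hρ₁, hρ₂, hρ₂m, hρ₂0, hu₀, ?_⟩
  · obtain ⟨M, hM⟩ := hK.isBounded.exists_norm_le
    exact ⟨M, huK.mono fun p hp => hM _ hp⟩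
  intro ψ hψ θ hθ
  have key := hu.weak _ (hθ.isTest_mul hψ)
  simp only [dt_mul hθ, pd_const_mul] at key
  rw [hr θ hθ ψ hψ] at key
  have i1 : Integrable (fun p : ℝ × Td d => (deriv θ p.1 * ψ p.2) * u p.1 p.2) (stMeasure d T) :=
    Integrable.mul_continuous_st (hu2.integrable (by norm_num))
      ((hθ.continuous_deriv.comp continuous_fst).mul (hψ.continuous.comp continuous_snd))
  have i2 : ∀ i, Integrable (fun p : ℝ × Td d => (θ p.1 * pd i ψ p.2) *
      cdFlux f A ε (u p.1) (Du p.1) p.2 i) (stMeasure d T) := fun i =>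
    Integrable.mul_continuous_st ((memLp_st_coord
      (G := fun t => cdFlux f A ε (u t) (Du t)) hG i).integrable (by norm_num))
      ((hθ.1.continuous.comp continuous_fst).mul ((hψ.continuous_pd i).comp continuous_snd))
  have i3 : Integrable (fun t => θ t * ((∫ x, ρ₁ t x * ψ x) + ρ₂ t (H1.ofSmooth ψ hψ)))
      (timeMeasure T) := by
    refine Integrable.mul_continuous_time ?_ hθ.1.continuous
    refine (integrable_integral_mul hρ₁.integrable hψ.continuous).add ?_
    exact ((hρ₂.integrable (by norm_num)).mul_const ‖H1.ofSmooth ψ hψ‖).mono'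
      (hρ₂m _) (Filter.Eventually.of_forall fun t => (ρ₂ t).le_opNorm _)
  have i12 : Integrable (fun p : ℝ × Td d => (deriv θ p.1 * ψ p.2) * u p.1 p.2 +
      ∑ i, (θ p.1 * pd i ψ p.2) * cdFlux f A ε (u p.1) (Du p.1) p.2 i) (stMeasure d T) :=
    i1.add (integrable_finsetSum Finset.univ fun i _ => i2 i)
  have e1 := integral_prod _ i12
  have e2 : ∫ x, u₀ x * (θ 0 * ψ x) = θ 0 * ∫ x, u₀ x * ψ x := by
    rw [← integral_const_mul]
    exact integral_congr_ae (Filter.Eventually.of_forall fun x => by simp only; ring)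
  rw [e2] at key
  refine Eq.trans ?_ key
  congr 1
  refine Eq.trans ?_ (congrArg (· + _) e1.symm)
  rw [← integral_add i12.integral_prod_left i3]
  refine integral_congr_ae ?_
  filter_upwards [ae_memLp_slice hu2, ae_memLp_slice hG] with t h1 h2
  have j1 := Integrable.mul_continuous (h1.integrable (by norm_num)) hψ.continuous
  have j2 := fun i => Integrable.mul_continuous
    ((memLp_coord h2 i).integrable (by norm_num)) (hψ.continuous_pd i)
  have e3 : ∫ x, (deriv θ t * ψ x * u t x + ∑ i, θ t * pd i ψ x *
      cdFlux f A ε (u t) (Du t) x i) = deriv θ t * (∫ x, u t x * ψ x) +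
      θ t * ∑ i, ∫ x, cdFlux f A ε (u t) (Du t) x i * pd i ψ x := by
    rw [← integral_finsetSum _ fun i _ => j2 i, ← integral_const_mul, ← integral_const_mul,
      ← integral_add (j1.const_mul _) ((integrable_finsetSum _ fun i _ => j2 i).const_mul _)]
    refine integral_congr_ae (Filter.Eventually.of_forall fun x => ?_)
    simp only [Finset.mul_sum]
    congr 1
    · ring
    · exact Finset.sum_congr rfl fun i _ => by ring
  rw [e3, weakRate]
  ring

end WeakSolution
end ScalarCD

/-! ### Energy estimates for balance laws and the values of the solutions -/

namespace ScalarCD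

variable {d : ℕ} {T : ℝ}

/-- Young's inequality by completing the square; γ is the share of dissipation spent on the dual
source. -/
lemma two_mul_sqrt_mul_le {γ x y : ℝ} (hγ : 0 < γ) :
    2 * (√(3 / 2) * (y * x)) ≤ γ * x ^ 2 + 3 / (2 * γ) * y ^ 2 := by
  have h1 : √(3 / 2) ^ 2 = 3 / 2 := Real.sq_sqrt (by norm_num)
  have h2 : γ * x ^ 2 + 3 / (2 * γ) * y ^ 2 - 2 * (√(3 / 2) * (y * x)) =
      (γ * x - √(3 / 2) * y) ^ 2 / γ := by
    field_simp
    ring_nf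
    rw [h1]; ring
  have h3 : 0 ≤ (γ * x - √(3 / 2) * y) ^ 2 / γ := by positivity
  linarith

namespace IsBalance

variable {w : ℝ → Td d → ℝ} {Dw G : ℝ → Td d → EuclideanSpace ℝ (Fin d)} {ρ₁ : ℝ → Td d → ℝ}
  {ρ₂ : ℝ → Hneg1 d} {w₀ : Td d → ℝ}

lemma integrable_dissipation (h : IsBalance T w Dw G ρ₁ ρ₂ w₀) :
    Integrable (fun t => ∫ x, ‖Dw t x‖ ^ 2) (timeMeasure T) :=
  integrable_integral_normSq_slice h.memLp_grad

lemma integrable_sq_dual (h : IsBalance T w Dw G ρ₁ ρ₂ w₀) :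
    Integrable (fun t => ‖ρ₂ t‖ ^ 2) (timeMeasure T) := h.dual.integrable_sq

lemma restrict_le {t : ℝ} (ht : t ∈ Ioo 0 T) : timeMeasure t ≤ timeMeasure T :=
  Measure.restrict_mono (Ioo_subset_Ioo_right ht.2.le) le_rfl

/-- The energy estimate for a dissipative flux. -/
theorem energy_bound_of_flux_le (h : IsBalance T w Dw G ρ₁ ρ₂ w₀) (hT : 0 < T) {Λ b γ : ℝ}
    (hΛ : 0 ≤ Λ) (hb : 0 ≤ b) (hγ : 0 < γ)
    (hG : ∀ᵐ s ∂(timeMeasure T), ∑ i, ∫ x, Dw s x i * G s x i ≤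
      Λ / 2 * (∫ x, w s x ^ 2) - (b + γ) / 2 * ∫ x, ‖Dw s x‖ ^ 2) :
    ∀ᵐ t ∂(timeMeasure T),
      (∀ᵐ s ∂(timeMeasure t), ∫ x, w s x ^ 2 ≤ 4 / 3 * Real.exp (2 * Λ * t) *
        ((∫ x, w₀ x ^ 2) + 4 * (∫ r in (0 : ℝ)..t, normSlice ρ₁ r) ^ 2 +
          ∫ r in (0 : ℝ)..t, 3 / (2 * γ) * ‖ρ₂ r‖ ^ 2)) ∧
      (b * ∫ r in (0 : ℝ)..t, ∫ x, ‖Dw r x‖ ^ 2) ≤ 4 / 3 * Real.exp (2 * Λ * t) *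
        ((∫ x, w₀ x ^ 2) + 4 * (∫ r in (0 : ℝ)..t, normSlice ρ₁ r) ^ 2 +
          ∫ r in (0 : ℝ)..t, 3 / (2 * γ) * ‖ρ₂ r‖ ^ 2) := by
  obtain ⟨M, -, hM⟩ := h.exists_energy_le
  have hD := h.integrable_dissipation
  refine energy_bound (I := fun t => b * ∫ r in (0 : ℝ)..t, ∫ x, ‖Dw r x‖ ^ 2) hΛ
    (integral_nonneg fun x => sq_nonneg _) h.integrable_energy h.source.integrable_normSlice
    (h.integrable_sq_dual.const_mul _) (fun s => integral_nonneg fun x => sq_nonneg _)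
    (normSlice_nonneg _) (fun s => by positivity) (fun s hs => ?_) hM ?_
  · exact mul_nonneg hb (intervalIntegral.integral_nonneg hs fun r _ =>
      integral_nonneg fun x => by positivity)
  filter_upwards [h.energy_le hT, ae_restrict_mem measurableSet_Ioo] with t ht htm
  have hle := restrict_le htm
  simp only [← integral_timeMeasure htm.1.le] at ht ⊢
  have j1 := h.integrable_energy.mono_measure hle
  have j2 := hD.mono_measure hle
  have j3 := h.integrable_source.mono_measure hle
  have j4 := (h.integrable_sq_dual.const_mul (3 / (2 * γ))).mono_measure hle
  have j5 := (h.integrable_flux.mono_measure hle)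
  have j6 := (h.integrable_dual.const_mul √(3 / 2)).mono_measure hle
  have e : ∫ s, ((Λ * (∫ x, w s x ^ 2) - b * ∫ x, ‖Dw s x‖ ^ 2) +
      (2 * (normSlice ρ₁ s * √(∫ x, w s x ^ 2)) + 3 / (2 * γ) * ‖ρ₂ s‖ ^ 2)) ∂(timeMeasure t) =
      (Λ * (∫ s, ∫ x, w s x ^ 2 ∂(volume) ∂(timeMeasure t)) -
        b * ∫ s, ∫ x, ‖Dw s x‖ ^ 2 ∂(volume) ∂(timeMeasure t)) +
      (2 * (∫ s, normSlice ρ₁ s * √(∫ x, w s x ^ 2) ∂(timeMeasure t)) +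
        ∫ s, 3 / (2 * γ) * ‖ρ₂ s‖ ^ 2 ∂(timeMeasure t)) := by
    rw [← integral_const_mul, ← integral_const_mul, ← integral_const_mul]
    exact (integral_add ((j1.const_mul Λ).sub (j2.const_mul b)) ((j3.const_mul 2).add j4)).trans
      (congrArg₂ (· + ·) (integral_sub (j1.const_mul Λ) (j2.const_mul b))
        (integral_add (j3.const_mul 2) j4))
  -- The flux provides the dissipation (b + γ)∫‖Dw‖². Young's inequality for ρ₂ uses up γ of it and
  -- leaves b for the conclusion.
  have hmono := integral_mono_ae (((j5.add j3).add j6).const_mul 2)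
    (((j1.const_mul Λ).sub (j2.const_mul b)).add ((j3.const_mul 2).add j4)) (by
      filter_upwards [ae_mono hle hG] with s hs
      have h1 := two_mul_sqrt_mul_le (x := √(∫ x, ‖Dw s x‖ ^ 2)) (y := ‖ρ₂ s‖) hγ
      rw [Real.sq_sqrt (integral_nonneg fun x => by positivity)] at h1
      simp only [Pi.add_apply, Pi.sub_apply]
      linarith)
  rw [integral_const_mul] at hmono
  have := hmono.trans_eq e
  simp only [Pi.add_apply] at this
  linarith

/-- The energy estimate for a dissipative flux without sources. -/
theorem energy_add_dissipation_le (h : IsBalance T w Dw G ρ₁ ρ₂ w₀)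
    (hT : 0 < T) (h₁ : ∀ t x, ρ₁ t x = 0) (h₂ : ∀ t, ρ₂ t = 0) {b : ℝ}
    (hG : ∀ᵐ s ∂(timeMeasure T), ∑ i, ∫ x, Dw s x i * G s x i ≤ -(b * ∫ x, ‖Dw s x‖ ^ 2)) :
    ∀ᵐ t ∂(timeMeasure T), (∫ x, w t x ^ 2) + 2 * b * (∫ r in (0 : ℝ)..t, ∫ x, ‖Dw r x‖ ^ 2) ≤
      ∫ x, w₀ x ^ 2 := by
  have hD := h.integrable_dissipation
  filter_upwards [h.energy_le hT, ae_restrict_mem measurableSet_Ioo] with t ht htm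
  have hle := restrict_le htm
  have e1 : ∀ s, normSlice ρ₁ s = 0 := by
    intro s
    have : ρ₁ s = 0 := funext fun x => h₁ s x
    simp [normSlice, this]
  have e2 : ∀ s, ‖ρ₂ s‖ = 0 := fun s => by rw [h₂ s]; exact ContinuousLinearMap.opNorm_zero
  simp only [← integral_timeMeasure htm.1.le, e1, e2, zero_mul, mul_zero, add_zero] at ht ⊢
  have := integral_mono_ae (h.integrable_flux.mono_measure hle)
    ((hD.mono_measure hle).const_mul b).neg (by
      filter_upwards [ae_mono hle hG] with s hs
      exact hs)
  have e3 : ∫ s, (-fun s => b * ∫ x, ‖Dw s x‖ ^ 2) s ∂(timeMeasure t) =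
      -(b * ∫ s, ∫ x, ‖Dw s x‖ ^ 2 ∂(volume) ∂(timeMeasure t)) := by
    simp only [Pi.neg_apply]
    rw [integral_neg, integral_const_mul]
  rw [e3] at this
  linarith

/-- For fixed ψ ≥ 0 the pairing of w with ψ has a continuous representative with value ∫ w₀ψ at time
0. If that value were negative, the pairing would be negative for almost all small times. -/
lemma initial_nonneg (h : IsBalance T w Dw G ρ₁ ρ₂ w₀) (hT : 0 < T)
    (hw : ∀ᵐ p ∂(stMeasure d T), 0 ≤ w p.1 p.2) : ∀ᵐ x, 0 ≤ w₀ x := by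
  refine ae_nonneg_of_integral_mul_smooth (h.initial.integrable (by norm_num)) fun ψ hψ hψ0 => ?_
  by_contra! hneg
  have hc : ContinuousOn (fun t => (∫ x, w₀ x * ψ x) +
      ∫ s in (0 : ℝ)..t, weakRate G ρ₁ ρ₂ ψ hψ s) (uIcc 0 T) :=
    continuousOn_const.add
      ((intervalIntegrable_of_timeMeasure hT
        (h.integrable_weakRate hψ)).absolutelyContinuousOnInterval_intervalIntegral
        (c := 0) (by simp)).continuousOn
  rw [uIcc_of_le hT.le] at hc
  have h0 := hc 0 ⟨le_rfl, hT.le⟩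
  have hev : ∀ᶠ t in nhdsWithin 0 (Icc 0 T), (∫ x, w₀ x * ψ x) +
      ∫ s in (0 : ℝ)..t, weakRate G ρ₁ ρ₂ ψ hψ s < 0 :=
    h0.eventually_lt continuousWithinAt_const (by simpa using hneg)
  obtain ⟨δ, hδ, hsub⟩ := Metric.mem_nhdsWithin_iff.1 hev
  have hfalse : ∀ᵐ t ∂(timeMeasure T), t ∉ Ioo 0 (min δ T) := by
    filter_upwards [h.ae_eq_integral hT hψ, Measure.ae_ae_of_ae_prod hw] with t h1 h2 h3
    have h4 := @hsub t ⟨by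
      rw [Metric.mem_ball, Real.dist_eq, sub_zero, abs_of_pos h3.1]
      exact h3.2.trans_le (min_le_left _ _), h3.1.le, (h3.2.trans_le (min_le_right _ _)).le⟩
    have h5 : 0 ≤ ∫ x, w t x * ψ x := by
      refine integral_nonneg_of_ae ?_
      filter_upwards [h2] with x hx using mul_nonneg hx (hψ0 x)
    rw [h1] at h5
    exact absurd h4 (not_lt.2 h5)
  have h6 : (timeMeasure T) (Ioo 0 (min δ T)) = 0 := by
    have := ae_iff.1 hfalse
    simpa only [not_not, ofPred_mem_eq] using this
  rw [Measure.restrict_apply measurableSet_Ioo, inter_eq_left.2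
    (Ioo_subset_Ioo_right (min_le_right _ _)), Real.volume_Ioo, ENNReal.ofReal_eq_zero] at h6
  have := lt_min hδ hT
  linarith

/-- The mean is conserved without sources. -/
lemma integral_eq (h : IsBalance T w Dw G ρ₁ ρ₂ w₀)
    (hT : 0 < T) (h₁ : ∀ t x, ρ₁ t x = 0) (h₂ : ∀ t, ρ₂ t = 0) :
    ∀ᵐ t ∂(timeMeasure T), ∫ x, w t x = ∫ x, w₀ x := by
  filter_upwards [h.ae_eq_integral hT (isSmooth_const 1)] with t ht
  have hp : ∀ i x, pd i (fun _ : Td d => (1 : ℝ)) x = 0 := fun i x => by simp [pd]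
  have : ∀ s, weakRate G ρ₁ ρ₂ (fun _ => 1) (isSmooth_const 1) s = 0 := by
    intro s
    simp [weakRate, hp, h₁, h₂]
  simpa [this] using ht

/-- At almost every time w lies on one side of c by `IsH1.lt_or_gt`. The mean of w then lies
strictly on that side, and being conserved it selects the same side at almost all times. -/
lemma lt_or_gt (h : IsBalance T w Dw G ρ₁ ρ₂ w₀)
    (hT : 0 < T) (h₁ : ∀ t x, ρ₁ t x = 0) (h₂ : ∀ t, ρ₂ t = 0) {K : Set ℝ} (hK : IsClosed K)
    (hwK : ∀ᵐ p ∂(stMeasure d T), w p.1 p.2 ∈ K) {c : ℝ} (hc : c ∉ K) :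
    (∀ᵐ t ∂(timeMeasure T), ∀ᵐ x, w t x < c) ∨ ∀ᵐ t ∂(timeMeasure T), ∀ᵐ x, c < w t x := by
  have strict : ∀ v v' : Td d → ℝ, Integrable v → Integrable v' → (∀ᵐ x, v x < v' x) →
      ∫ x, v x < ∫ x, v' x := by
    intro v v' hv hv' hlt
    refine lt_of_le_of_ne (integral_mono_ae hv hv' (hlt.mono fun x hx => hx.le)) fun heq => ?_
    have h3 : ∫ x, (v' x - v x) = 0 := by rw [integral_sub hv' hv, heq, sub_self]
    have h4 := (integral_eq_zero_iff_of_nonneg_ae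
      (hlt.mono fun x hx => (sub_pos.2 hx).le) (hv'.sub hv)).1 h3
    have h5 : ∀ᵐ _ : Td d, False := by
      filter_upwards [hlt, h4] with x h6 h7
      simp only [Pi.zero_apply] at h7
      linarith
    obtain ⟨x, hx⟩ := h5.exists
    exact hx
  have hc' : ∫ _ : Td d, c = c := by simp
  have hside : ∀ᵐ t ∂(timeMeasure T), ((∀ᵐ x, w t x < c) ∧ ∫ x, w₀ x < c) ∨
      ((∀ᵐ x, c < w t x) ∧ c < ∫ x, w₀ x) := by
    filter_upwards [h.integral_eq hT h₁ h₂, h.isH1, Measure.ae_ae_of_ae_prod hwK] with t a1 a2 a3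
    rcases a2.lt_or_gt hK a3 hc with a4 | a4
    · refine Or.inl ⟨a4, ?_⟩
      have := strict _ _ a2.weak.1 (integrable_const c) a4
      rwa [a1, hc'] at this
    · refine Or.inr ⟨a4, ?_⟩
      have := strict _ _ (integrable_const c) a2.weak.1 a4
      rwa [a1, hc'] at this
  by_cases hm : ∫ x, w₀ x < c
  · left
    filter_upwards [hside] with t ht
    rcases ht with ht | ht
    · exact ht.1
    · exact absurd hm ht.2.not_gt
  · right
    filter_upwards [hside] with t ht
    rcases ht with ht | ht
    · exact absurd ht.2 hm
    · exact ht.1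

end IsBalance

/-! ### Values of the solutions -/

/-- The interval is the connected component of x₀ in K. A point of K outside it is separated from x₀
by a gap of K, which is open and thus contains a rational; rationality allows countably many null
sets to be discarded at once. -/
lemma exists_Icc_component {K : Set ℝ} (hK : IsCompact K) {x₀ : ℝ} (hx₀ : x₀ ∈ K) :
    ∃ a b, Icc a b ⊆ K ∧ (∀ S ⊆ K, IsPreconnected S → x₀ ∈ S → S ⊆ Icc a b) ∧
      ∀ y ∈ K, y ∉ Icc a b → ∃ c : ℚ, (c : ℝ) ∉ K ∧ ((x₀ < c ∧ c < y) ∨ (y < c ∧ c < x₀)) := by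
  have hJK : connectedComponentIn K x₀ ⊆ K := connectedComponentIn_subset K x₀
  have hJ : IsPreconnected (connectedComponentIn K x₀) := isPreconnected_connectedComponentIn
  have hxJ : x₀ ∈ connectedComponentIn K x₀ := mem_connectedComponentIn hx₀
  have hcl : IsClosed (connectedComponentIn K x₀) := by
    refine isClosed_of_closure_subset ?_
    exact hJ.closure.subset_connectedComponentIn (subset_closure hxJ)
      (closure_minimal hJK hK.isClosed)
  have hcomp : IsCompact (connectedComponentIn K x₀) := hK.of_isClosed_subset hcl hJK
  have he := eq_Icc_of_connected_compact ⟨⟨x₀, hxJ⟩, hJ⟩ hcomp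
  refine ⟨_, _, he ▸ hJK, fun S hS hSp hxS => he ▸ hSp.subset_connectedComponentIn hxS hS, ?_⟩
  intro y hy hyJ
  rw [← he] at hyJ
  have h1 : ¬ uIcc x₀ y ⊆ K := fun hsub =>
    hyJ (isPreconnected_uIcc.subset_connectedComponentIn left_mem_uIcc hsub right_mem_uIcc)
  obtain ⟨c, hc, hcK⟩ := not_subset.1 h1
  have hcx : c ≠ x₀ := fun h => hcK (h ▸ hx₀)
  have hcy : c ≠ y := fun h => hcK (h ▸ hy)
  have hopen := hK.isClosed.isOpen_compl
  rcases le_total x₀ y with hle | hle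
  · rw [uIcc_of_le hle] at hc
    obtain ⟨q, hq⟩ := Rat.isDenseEmbedding_coe_real.dense.exists_mem_open (hopen.inter isOpen_Ioo)
      ⟨c, hcK, lt_of_le_of_ne hc.1 hcx.symm, lt_of_le_of_ne hc.2 hcy⟩
    exact ⟨q, hq.1, Or.inl hq.2⟩
  · rw [uIcc_of_ge hle] at hc
    obtain ⟨q, hq⟩ := Rat.isDenseEmbedding_coe_real.dense.exists_mem_open (hopen.inter isOpen_Ioo)
      ⟨c, hcK, lt_of_le_of_ne hc.1 hcy.symm, lt_of_le_of_ne hc.2 hcx⟩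
    exact ⟨q, hq.1, Or.inr hq.2⟩

/-- Passing from almost all slices to the product needs a measurable exceptional set, hence the
detour through a strongly measurable representative. -/
lemma ae_prod_of_ae_ae {E : Type*} [NormedAddCommGroup E] [MeasurableSpace E] [BorelSpace E]
    {F : ℝ × Td d → E} (hF : AEStronglyMeasurable F (stMeasure d T)) {P : Set E}
    (hP : MeasurableSet P) (h : ∀ᵐ t ∂(timeMeasure T), ∀ᵐ x, F (t, x) ∈ P) :
    ∀ᵐ p ∂(stMeasure d T), F p ∈ P := by
  have h1 : ∀ᵐ p ∂(stMeasure d T), hF.mk F p ∈ P := by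
    rw [Measure.ae_prod_iff_ae_ae (hF.stronglyMeasurable_mk.measurable hP)]
    filter_upwards [h, Measure.ae_ae_of_ae_prod hF.ae_eq_mk] with t h2 h3
    filter_upwards [h2, h3] with x h4 h5
    rwa [← h5]
  filter_upwards [h1, hF.ae_eq_mk] with p h2 h3
  rwa [h3]

section Lipschitz

variable {û : ℝ → Td d → ℝ} {Dû : ℝ → Td d → EuclideanSpace ℝ (Fin d)}

lemma IsLipschitzST.memLp_top_grad (hû : IsLipschitzST T û) (hD : HasSpatialWeakGrad T û Dû) :
    MemLp (fun p : ℝ × Td d => Dû p.1 p.2) ∞ (stMeasure d T) := by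
  obtain ⟨C, hC⟩ := hû
  have h1 : ∀ᵐ t ∂(timeMeasure T), ∀ᵐ x, Dû t x ∈
      {e : EuclideanSpace ℝ (Fin d) | ∀ i, |e i| ≤ C} := by
    filter_upwards [hD.2, ae_restrict_mem measurableSet_Ioo] with t ht htm
    have hl : LipschitzWith C (û t) := by
      intro x y
      have := hC (x := (t, x)) ⟨Ioo_subset_Icc_self htm, mem_univ _⟩ (y := (t, y))
        ⟨Ioo_subset_Icc_self htm, mem_univ _⟩
      simpa [Prod.edist_eq] using this
    exact ae_all_iff.2 fun i => ht.abs_le_of_lipschitz hl i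
  have h2 := ae_prod_of_ae_ae (F := fun p : ℝ × Td d => Dû p.1 p.2) hD.1 (by
    have : {e : EuclideanSpace ℝ (Fin d) | ∀ i, |e i| ≤ C} =
        ⋂ i, {e : EuclideanSpace ℝ (Fin d) | |e i| ≤ C} := by
      ext e; simp
    rw [this]
    exact MeasurableSet.iInter fun i => (isClosed_le
      (EuclideanSpace.proj (𝕜 := ℝ) i).continuous.abs continuous_const).measurableSet) h1
  refine memLp_of_coord fun i => memLp_top_of_bound
    ((EuclideanSpace.proj (𝕜 := ℝ) i).continuous.comp_aestronglyMeasurable hD.1) C ?_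
  filter_upwards [h2] with p hp using hp i

lemma ae_norm_le_supNorm {E : Type*} [NormedAddCommGroup E] {v : ℝ → Td d → E}
    (h : MemLp (fun p : ℝ × Td d => v p.1 p.2) ∞ (stMeasure d T)) :
    ∀ᵐ p ∂(stMeasure d T), ‖v p.1 p.2‖ ≤ supNorm T v := by
  have h1 := ae_le_eLpNormEssSup (f := fun p : ℝ × Td d => v p.1 p.2) (μ := stMeasure d T)
  filter_upwards [h1] with p hp
  rw [← eLpNorm_exponent_top] at hp
  have := ENNReal.toReal_mono h.2.ne hp
  rwa [toReal_enorm] at this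

lemma IsLipschitzST.continuousOn (hû : IsLipschitzST T û) :
    ContinuousOn (fun p : ℝ × Td d => û p.1 p.2) (Icc 0 T ×ˢ univ) := by
  obtain ⟨C, hC⟩ := hû
  exact hC.continuousOn

/-- A value outside the closed set K at an interior point would persist on a nonempty open set,
which has positive measure. The boundary times follow by continuity. -/
lemma IsLipschitzST.mem_of_ae_mem (hû : IsLipschitzST T û) (hT : 0 < T) {K : Set ℝ}
    (hK : IsClosed K) (hûK : ∀ᵐ p ∂(stMeasure d T), û p.1 p.2 ∈ K) {p : ℝ × Td d}
    (hp : p ∈ Icc 0 T ×ˢ (univ : Set (Td d))) : û p.1 p.2 ∈ K := by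
  have hc := hû.continuousOn
  have hIo : IsOpen (Ioo 0 T ×ˢ (univ : Set (Td d))) := isOpen_Ioo.prod isOpen_univ
  have h1 : ∀ p ∈ Ioo 0 T ×ˢ (univ : Set (Td d)), û p.1 p.2 ∈ K := by
    by_contra! hcon
    obtain ⟨p, hp, hpK⟩ := hcon
    have hop : IsOpen (Ioo 0 T ×ˢ (univ : Set (Td d)) ∩ (fun p : ℝ × Td d => û p.1 p.2) ⁻¹' Kᶜ) :=
      (hc.mono (prod_mono Ioo_subset_Icc_self subset_rfl)).isOpen_inter_preimage hIo hK.isOpen_compl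
    have hpos := hop.measure_pos (volume.prod volume) ⟨p, hp, hpK⟩
    have hst : stMeasure d T = (volume.prod volume).restrict (Ioo 0 T ×ˢ (univ : Set (Td d))) := by
      rw [← Measure.prod_restrict, Measure.restrict_univ]
    rw [hst, ae_restrict_iff' hIo.measurableSet, ae_iff] at hûK
    refine hpos.ne' (measure_mono_null ?_ hûK)
    intro q hq
    simp only [mem_ofPred_eq, Classical.not_imp]
    exact hq
  have hcl : closure (Ioo 0 T ×ˢ (univ : Set (Td d))) = Icc 0 T ×ˢ univ := by
    rw [closure_prod_eq, closure_Ioo hT.ne, closure_univ]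
  have := (hcl ▸ hc).image_closure
  rw [hcl] at this
  exact closure_minimal (image_subset_iff.2 h1) hK (this (mem_image_of_mem _ hp))

lemma IsLipschitzST.isPreconnected_image (hû : IsLipschitzST T û) :
    IsPreconnected ((fun p : ℝ × Td d => û p.1 p.2) '' (Icc 0 T ×ˢ univ)) :=
  (isPreconnected_Icc.prod isPreconnected_univ).image _ hû.continuousOn

end Lipschitz
end ScalarCD

/-! ### Stability in the separated case and in the interval case -/

namespace ScalarCD

variable {d : ℕ} {T : ℝ}

lemma sq_norm_neg_smul {V : Type*} [NormedAddCommGroup V] [NormedSpace ℝ V] (ε : ℝ)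
    (r : StrongDual ℝ V) : ‖-(ε • r)‖ ^ 2 = ε ^ 2 * ‖r‖ ^ 2 := by
  rw [norm_neg, norm_smul, mul_pow, Real.norm_eq_abs, sq_abs]

lemma MemLp.norm_const_smul_dual {V X : Type*} [NormedAddCommGroup V] [NormedSpace ℝ V]
    [MeasurableSpace X] {μ : Measure X} {r : X → StrongDual ℝ V}
    (h : MemLp (fun t => ‖r t‖) 2 μ) (ε : ℝ) : MemLp (fun t => ‖ε • r t‖) 2 μ := by
  simp only [norm_smul]
  exact h.const_mul _

section Stability

variable {K : Set ℝ} {f : Fin d → ℝ → ℝ} {A : ℝ → ℝ} {ε : ℝ} {u û : ℝ → Td d → ℝ}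
  {Du Dû : ℝ → Td d → EuclideanSpace ℝ (Fin d)} {u₀ û₀ : Td d → ℝ} {r₁ : ℝ → Td d → ℝ}
  {r₂ : ℝ → Hneg1 d}

lemma integral_dual_eq {t γ κ : ℝ} (h : 3 / (2 * γ) * ε ^ 2 = κ) :
    ∫ s in (0 : ℝ)..t, 3 / (2 * γ) * ‖-(ε • r₂ s)‖ ^ 2 = κ * ∫ s in (0 : ℝ)..t, ‖r₂ s‖ ^ 2 := by
  rw [← intervalIntegral.integral_const_mul]
  refine intervalIntegral.integral_congr fun s _ => ?_
  have : ‖-(ε • r₂ s)‖ ^ 2 = ε ^ 2 * ‖r₂ s‖ ^ 2 := sq_norm_neg_smul ε (r₂ s)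
  rw [this, ← h]; ring

/-- Stability of two states that are separated by a value outside of the state space. -/
theorem stability_of_separated (hT : 0 < T) (hε : 0 < ε) (hK : IsCompact K)
    (hf : ∀ i, ContinuousOn (f i) K) (hA : ContinuousOn A K) (hA1 : ∀ s ∈ K, 1 ≤ A s)
    (hu : IsBalance T u Du (fun t => cdFlux f A ε (u t) (Du t)) (fun _ _ => 0) (fun _ => 0) u₀)
    (hû : IsBalance T û Dû (fun t => cdFlux f A ε (û t) (Dû t)) r₁ (fun t => ε • r₂ t) û₀)
    (huK : ∀ᵐ p ∂(stMeasure d T), u p.1 p.2 ∈ K) (hûK : ∀ᵐ p ∂(stMeasure d T), û p.1 p.2 ∈ K)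
    {c : ℝ} (hsep : ∀ᵐ x, 0 ≤ (u₀ x - c) * (c - û₀ x)) {Λ : ℝ} (hΛ : 0 ≤ Λ) :
    ∀ᵐ t ∂(timeMeasure T), ∃ Y₁ Y₂ : ℝ, 0 ≤ Y₁ ∧
      (∀ᵐ s ∂(timeMeasure t), ∫ x, (u s x - û s x) ^ 2 ≤ Y₁) ∧
      (ε * ∫ s in (0 : ℝ)..t, ∫ x, ‖Du s x - Dû s x‖ ^ 2) ≤ Y₂ ∧
      Y₁ + Y₂ ≤ (4 * (∫ x, (u₀ x - û₀ x) ^ 2) + 16 * (∫ s in (0 : ℝ)..t, normSlice r₁ s) ^ 2 +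
        8 * ε * ∫ s in (0 : ℝ)..t, ‖r₂ s‖ ^ 2) * Real.exp (2 * Λ * t) := by
  have b1 := hu.sub (IsBalance.const hT c)
  have b2 := (IsBalance.const hT c).sub hû
  have d1 : ∀ᵐ s ∂(timeMeasure T), ∑ i, ∫ x, (Du s x - 0) i * (cdFlux f A ε (u s) (Du s) x - 0) i
      ≤ -(ε * ∫ x, ‖Du s x - 0‖ ^ 2) := by
    filter_upwards [hu.isH1, Measure.ae_ae_of_ae_prod huK] with s h1 h2
    simp only [sub_zero]
    exact h1.sum_integral_grad_mul_cdFlux_le hK h2 hf hA hA1 hε.le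
  -- No growth is produced, so Λ = 0. The full dissipation ε is split as (b + γ)/2 with b = 5ε/4 and
  -- γ = 3ε/4; the weight 3ε²/(2γ) of r₂ becomes 2ε.
  have d2 : ∀ᵐ s ∂(timeMeasure T), ∑ i, ∫ x, (0 - Dû s x) i *
      (0 - cdFlux f A ε (û s) (Dû s) x) i
      ≤ 0 / 2 * (∫ x, (c - û s x) ^ 2) - (5 / 4 * ε + 3 / 4 * ε) / 2 * ∫ x, ‖0 - Dû s x‖ ^ 2 := by
    filter_upwards [hû.isH1, Measure.ae_ae_of_ae_prod hûK] with s h1 h2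
    simp only [zero_sub, PiLp.neg_apply, neg_mul_neg, norm_neg]
    have := h1.sum_integral_grad_mul_cdFlux_le hK h2 hf hA hA1 hε.le
    linarith
  have e1 := b1.energy_add_dissipation_le hT (fun _ _ => neg_zero) (fun _ => neg_zero) d1
  have e2 := b2.energy_bound_of_flux_le hT le_rfl (by positivity) (by positivity) d2
  filter_upwards [e1, e2, ae_restrict_mem measurableSet_Ioo] with t h1 h2 htm
  have hle := IsBalance.restrict_le htm
  rw [normSlice_neg] at h2
  simp only [integral_dual_eq (r₂ := r₂) (ε := ε) (γ := 3 / 4 * ε) (κ := 2 * ε) (t := t)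
    (by field_simp; ring), mul_zero, zero_mul, Real.exp_zero] at h2
  set R₁ := ∫ s in (0 : ℝ)..t, normSlice r₁ s
  set R₂ := ∫ s in (0 : ℝ)..t, ‖r₂ s‖ ^ 2
  have hR₂ : 0 ≤ R₂ := intervalIntegral.integral_nonneg htm.1.le fun s _ => sq_nonneg _
  set B := ∫ x, (u₀ x - c) ^ 2
  set Y := 4 / 3 * 1 * ((∫ x, (c - û₀ x) ^ 2) + 4 * R₁ ^ 2 + 2 * ε * R₂) with hY
  have hB0 : 0 ≤ B := integral_nonneg fun x => sq_nonneg _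
  have hE0 : 0 ≤ ∫ x, (c - û₀ x) ^ 2 := integral_nonneg fun x => sq_nonneg _
  have hY0 : 0 ≤ Y := by positivity
  -- With x = u₀ - c and y = c - û₀ the sign condition xy ≥ 0 gives x² + y² ≤ (x + y)².
  have hinit : B + (∫ x, (c - û₀ x) ^ 2) ≤ ∫ x, (u₀ x - û₀ x) ^ 2 := by
    have i1 := b1.initial.integrable_sq
    have i2 := b2.initial.integrable_sq
    rw [← integral_add i1 i2]
    refine integral_mono_ae (i1.add i2) (hu.sub hû).initial.integrable_sq ?_
    filter_upwards [hsep] with x hx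
    nlinarith
  have hD1 := b1.integrable_dissipation
  have hD2 := b2.integrable_dissipation
  have hnonneg : ∀ V : ℝ → Td d → EuclideanSpace ℝ (Fin d),
      0 ≤ ∫ s in (0 : ℝ)..t, ∫ x, ‖V s x‖ ^ 2 := fun V =>
    intervalIntegral.integral_nonneg htm.1.le fun s _ => integral_nonneg fun x => by positivity
  have h1' : ε * (∫ s in (0 : ℝ)..t, ∫ x, ‖Du s x - 0‖ ^ 2) ≤ B / 2 := by
    have : 0 ≤ ∫ x, (u t x - c) ^ 2 := integral_nonneg fun x => sq_nonneg _
    linarith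
  -- The weights come from (x + y)² ≤ 5/2 x² + 5/3 y² for the energy and ‖X + Y‖² ≤ 3‖X‖² + 3/2‖Y‖²
  -- for the gradients, combined with the bounds B/2 and 4Y/5 on the two dissipations. The sum is 4B
  -- + 43/15 Y, and 43/15 · 4/3 < 4 leaves room for the coefficients 16 and 8.
  refine ⟨5 / 2 * B + 5 / 3 * Y, 3 / 2 * B + 6 / 5 * Y, by positivity, ?_, ?_, ?_⟩
  · filter_upwards [ae_mono hle e1, h2.1, ae_mono hle b1.isH1, ae_mono hle b2.isH1,
      ae_mono hle (hu.sub hû).isH1, ae_restrict_mem measurableSet_Ioo] with s g1 g2 g3 g4 g5 hsm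
    have g6 : 0 ≤ ∫ r in (0 : ℝ)..s, ∫ x, ‖Du r x - 0‖ ^ 2 :=
      intervalIntegral.integral_nonneg hsm.1.le fun s _ => integral_nonneg fun x => by positivity
    have g7 : ∫ x, (u s x - c) ^ 2 ≤ B := by nlinarith
    have i1 := g3.memLp.integrable_sq
    have i2 := g4.memLp.integrable_sq
    have g8 : ∫ x, (u s x - û s x) ^ 2 ≤
        5 / 2 * (∫ x, (u s x - c) ^ 2) + 5 / 3 * ∫ x, (c - û s x) ^ 2 := by
      rw [← integral_const_mul, ← integral_const_mul,
        ← integral_add (i1.const_mul _) (i2.const_mul _)]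
      refine integral_mono g5.memLp.integrable_sq ((i1.const_mul _).add (i2.const_mul _))
        fun x => ?_
      simp only
      nlinarith [sq_nonneg (3 * (u s x - c) - 2 * (c - û s x))]
    linarith
  · have g1 : ∫ s in (0 : ℝ)..t, ∫ x, ‖Du s x - Dû s x‖ ^ 2 ≤
        3 * (∫ s in (0 : ℝ)..t, ∫ x, ‖Du s x - 0‖ ^ 2) +
          3 / 2 * ∫ s in (0 : ℝ)..t, ∫ x, ‖0 - Dû s x‖ ^ 2 := by
      simp only [← integral_timeMeasure htm.1.le]
      rw [← integral_const_mul, ← integral_const_mul, ← integral_add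
        ((hD1.mono_measure hle).const_mul _) ((hD2.mono_measure hle).const_mul _)]
      refine integral_mono_ae ((hu.sub hû).integrable_dissipation.mono_measure hle)
        (((hD1.mono_measure hle).const_mul _).add ((hD2.mono_measure hle).const_mul _)) ?_
      filter_upwards [ae_mono hle b1.isH1, ae_mono hle b2.isH1, ae_mono hle (hu.sub hû).isH1]
        with s g3 g4 g5
      have i1 := (memLp_two_iff_integrable_sq_norm g3.memLp_grad.1).1 g3.memLp_grad
      have i2 := (memLp_two_iff_integrable_sq_norm g4.memLp_grad.1).1 g4.memLp_grad
      rw [← integral_const_mul, ← integral_const_mul,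
        ← integral_add (i1.const_mul _) (i2.const_mul _)]
      refine integral_mono ((memLp_two_iff_integrable_sq_norm g5.memLp_grad.1).1 g5.memLp_grad)
        ((i1.const_mul _).add (i2.const_mul _)) fun x => ?_
      simp only
      have h3 := norm_sub_le (Du s x) (Dû s x)
      rw [sub_zero, zero_sub, norm_neg]
      nlinarith [sq_nonneg (2 * ‖Du s x‖ - ‖Dû s x‖), norm_nonneg (Du s x - Dû s x)]
    have g2 := mul_le_mul_of_nonneg_left g1 hε.le
    linarith [h2.2]
  · have hexp : 1 ≤ Real.exp (2 * Λ * t) := Real.one_le_exp (by have := htm.1; positivity)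
    have h3 : 0 ≤ 4 * (∫ x, (u₀ x - û₀ x) ^ 2) + 16 * R₁ ^ 2 + 8 * ε * R₂ := by
      have : 0 ≤ ∫ x, (u₀ x - û₀ x) ^ 2 := integral_nonneg fun x => sq_nonneg _
      positivity
    refine le_trans ?_ (le_mul_of_one_le_right h3 hexp)
    have : 0 ≤ ε * R₂ := by positivity
    nlinarith [sq_nonneg R₁]

/-- Stability of two states with values in an interval. -/
theorem stability_of_interval (hT : 0 < T) (hε : 0 < ε) {a b : ℝ} {f' f'' : Fin d → ℝ → ℝ}
    {A' : ℝ → ℝ} {S L : Fin d → ℝ} {Q N Λ : ℝ}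
    (hf : ∀ i, ∀ s ∈ Icc a b, HasDerivAt (f i) (f' i s) s)
    (hf' : ∀ i, ∀ s ∈ Icc a b, HasDerivAt (f' i) (f'' i s) s)
    (hS : ∀ i, ∀ s ∈ Icc a b, |f'' i s| ≤ S i)
    (hA : ∀ s ∈ Icc a b, HasDerivAt A (A' s) s) (hA1 : ∀ s ∈ Icc a b, 1 ≤ A s)
    (hQ : ∀ s ∈ Icc a b, |A' s| ^ 2 ≤ Q)
    (hu : IsBalance T u Du (fun t => cdFlux f A ε (u t) (Du t)) (fun _ _ => 0) (fun _ => 0) u₀)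
    (hû : IsBalance T û Dû (fun t => cdFlux f A ε (û t) (Dû t)) r₁ (fun t => ε • r₂ t) û₀)
    (huI : ∀ᵐ p ∂(stMeasure d T), u p.1 p.2 ∈ Icc a b)
    (hûI : ∀ᵐ p ∂(stMeasure d T), û p.1 p.2 ∈ Icc a b)
    (hL : ∀ᵐ p ∂(stMeasure d T), ∀ i, |Dû p.1 p.2 i| ≤ L i)
    (hN : ∀ᵐ p ∂(stMeasure d T), ‖Dû p.1 p.2‖ ≤ N) (hΛ : 0 ≤ Λ)
    (hΛeq : Λ / 2 = (∑ i, S i * L i) + ε * Q * N ^ 2) :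
    ∀ᵐ t ∂(timeMeasure T), ∃ Y₁ Y₂ : ℝ, 0 ≤ Y₁ ∧
      (∀ᵐ s ∂(timeMeasure t), ∫ x, (u s x - û s x) ^ 2 ≤ Y₁) ∧
      (ε * ∫ s in (0 : ℝ)..t, ∫ x, ‖Du s x - Dû s x‖ ^ 2) ≤ Y₂ ∧
      Y₁ + Y₂ ≤ (4 * (∫ x, (u₀ x - û₀ x) ^ 2) + 16 * (∫ s in (0 : ℝ)..t, normSlice r₁ s) ^ 2 +
        8 * ε * ∫ s in (0 : ℝ)..t, ‖r₂ s‖ ^ 2) * Real.exp (2 * Λ * t) := by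
  -- The coercivity 3ε/4 is split as (b + γ)/2 with b = ε and γ = ε/2, so r₂ gets the weight
  -- 3ε²/(2γ) = 3ε. Adding the two bounds, each with factor 4/3, turns this into exactly 8ε.
  have hd : ∀ᵐ s ∂(timeMeasure T), ∑ i, ∫ x, (Du s x - Dû s x) i *
      (cdFlux f A ε (u s) (Du s) x - cdFlux f A ε (û s) (Dû s) x) i
      ≤ Λ / 2 * (∫ x, (u s x - û s x) ^ 2) - (ε + ε / 2) / 2 * ∫ x, ‖Du s x - Dû s x‖ ^ 2 := by
    filter_upwards [hu.isH1, hû.isH1, Measure.ae_ae_of_ae_prod huI, Measure.ae_ae_of_ae_prod hûI,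
      Measure.ae_ae_of_ae_prod hL, Measure.ae_ae_of_ae_prod hN] with s h1 h2 h3 h4 h5 h6
    have := h1.sum_integral_sub_mul_cdFlux_le h2 h3 h4 hε.le hf hf' hS hA hA1 hQ h5 h6
    rw [hΛeq]
    linarith
  filter_upwards [(hu.sub hû).energy_bound_of_flux_le hT hΛ hε.le (half_pos hε) hd,
    ae_restrict_mem measurableSet_Ioo] with t h2 htm
  rw [normSlice_neg] at h2
  simp only [integral_dual_eq (r₂ := r₂) (ε := ε) (γ := ε / 2) (κ := 3 * ε) (t := t)
    (by field_simp)] at h2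
  have hR₂ : 0 ≤ ∫ s in (0 : ℝ)..t, ‖r₂ s‖ ^ 2 :=
    intervalIntegral.integral_nonneg htm.1.le fun s _ => sq_nonneg _
  have h0 : 0 ≤ ∫ x, (u₀ x - û₀ x) ^ 2 := integral_nonneg fun x => sq_nonneg _
  refine ⟨_, _, by positivity, h2.1, h2.2, ?_⟩
  have hexp := Real.exp_pos (2 * Λ * t)
  have : ∀ E B R₁ R₂ : ℝ, 0 < E → 0 ≤ B → 4 / 3 * E * (B + 4 * R₁ ^ 2 + 3 * ε * R₂) +
      4 / 3 * E * (B + 4 * R₁ ^ 2 + 3 * ε * R₂) ≤ (4 * B + 16 * R₁ ^ 2 + 8 * ε * R₂) * E := by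
    intro E B R₁ R₂ hE hB
    nlinarith [mul_nonneg hE.le hB, mul_nonneg hE.le (sq_nonneg R₁)]
  exact this _ _ _ _ hexp h0

end Stability
end ScalarCD

/-! ### Passage to extended norms and the main theorem -/

namespace ScalarCD

variable {d : ℕ} {T : ℝ}

lemma stMeasure_mono {t : ℝ} (ht : t ∈ Ioo 0 T) : stMeasure d t ≤ stMeasure d T := by
  have h : ∀ s, stMeasure d s = (volume.prod volume).restrict (Ioo 0 s ×ˢ (univ : Set (Td d))) := by
    intro s
    rw [← Measure.prod_restrict, Measure.restrict_univ]
  rw [h, h]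
  exact Measure.restrict_mono (prod_mono (Ioo_subset_Ioo_right ht.2.le) subset_rfl) le_rfl

lemma MemMixed.mono {r : ℝ → Td d → ℝ} (hr : MemMixed 1 2 T r) {t : ℝ} (ht : t ∈ Ioo 0 T) :
    MemMixed 1 2 t r := by
  refine ⟨hr.1.mono_measure (stMeasure_mono ht), lt_of_le_of_lt ?_ hr.2⟩
  exact eLpNorm_mono_measure _ (IsBalance.restrict_le ht)

lemma residual_mul {ε : ℝ} {r₁ : ℝ → Td d → ℝ} (hr₁ : MemMixed 1 2 T r₁) {r₂ : ℝ → Hneg1 d}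
    (hr₂ : MemLp (fun t => ‖r₂ t‖) 2 (timeMeasure T))
    (hr₂m : ∀ p, AEStronglyMeasurable (fun t => r₂ t p) (timeMeasure T)) {θ : ℝ → ℝ}
    (hθ : IsTimeTest T θ) {ψ : Td d → ℝ} (hψ : IsSmooth ψ) :
    residual ε T r₁ r₂ _ (hθ.isTest_mul hψ) =
      ∫ t, θ t * ((∫ x, r₁ t x * ψ x) + (ε • r₂ t) (H1.ofSmooth ψ hψ)) ∂(timeMeasure T) := by
  have i1 : Integrable (fun p : ℝ × Td d => r₁ p.1 p.2 * (θ p.1 * ψ p.2)) (stMeasure d T) :=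
    (Integrable.mul_continuous_st hr₁.integrable
      ((hθ.1.continuous.comp continuous_fst).mul (hψ.continuous.comp continuous_snd))).congr
      (Filter.Eventually.of_forall fun p => mul_comm _ _)
  have i2 : Integrable (fun t => r₂ t (H1.ofSmooth ψ hψ)) (timeMeasure T) :=
    ((hr₂.integrable (by norm_num)).mul_const ‖H1.ofSmooth ψ hψ‖).mono'
      (hr₂m _) (Filter.Eventually.of_forall fun t => (r₂ t).le_opNorm _)
  have e1 : ∀ t, r₂ t (H1.ofSmooth _ ((hθ.isTest_mul hψ).1.slice t)) =
      θ t * r₂ t (H1.ofSmooth ψ hψ) := by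
    intro t
    have : H1.ofSmooth _ ((hθ.isTest_mul hψ).1.slice t) = θ t • H1.ofSmooth ψ hψ :=
      H1.ofSmooth_const_mul hψ (θ t)
    rw [this, map_smul]
    rfl
  have e2 : ∀ t, ∫ x, r₁ t x * (θ t * ψ x) = θ t * ∫ x, r₁ t x * ψ x := by
    intro t
    rw [← integral_const_mul]
    exact integral_congr_ae (Filter.Eventually.of_forall fun x => by simp only; ring)
  have i3 := i1.integral_prod_left
  have i4 := (Integrable.mul_continuous_time i2 hθ.1.continuous).const_mul ε
  rw [residual, integral_prod _ i1, ← integral_const_mul]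
  simp only [e1, e2] at i3 ⊢
  rw [← integral_add i3 i4]
  refine integral_congr_ae (Filter.Eventually.of_forall fun t => ?_)
  have : (ε • r₂ t) (H1.ofSmooth ψ hψ) = ε * r₂ t (H1.ofSmooth ψ hψ) := rfl
  simp only [this]
  ring

lemma hasDerivAt_of_contDiffOn {U : Set ℝ} (hU : IsOpen U) {f : ℝ → ℝ} (hf : ContDiffOn ℝ 2 f U)
    {s : ℝ} (hs : s ∈ U) : HasDerivAt f (deriv f s) s :=
  ((hf.contDiffAt (hU.mem_nhds hs)).differentiableAt (by simp)).hasDerivAt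

lemma contDiffOn_deriv {U : Set ℝ} (hU : IsOpen U) {f : ℝ → ℝ} (hf : ContDiffOn ℝ 2 f U) :
    ContDiffOn ℝ 1 (deriv f) U := hf.deriv_of_isOpen hU (by norm_num)

lemma hasDerivAt_deriv_of_contDiffOn {U : Set ℝ} (hU : IsOpen U) {f : ℝ → ℝ}
    (hf : ContDiffOn ℝ 2 f U) {s : ℝ} (hs : s ∈ U) :
    HasDerivAt (deriv f) (deriv (deriv f) s) s :=
  (((contDiffOn_deriv hU hf).contDiffAt (hU.mem_nhds hs)).differentiableAt (by simp)).hasDerivAt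

lemma continuousOn_deriv_deriv {U : Set ℝ} (hU : IsOpen U) {f : ℝ → ℝ}
    (hf : ContDiffOn ℝ 2 f U) : ContinuousOn (deriv (deriv f)) U :=
  (contDiffOn_deriv hU hf).continuousOn_deriv_of_isOpen hU (by norm_num)

lemma le_sSup_image_of_continuousOn {K : Set ℝ} (hK : IsCompact K) {h : ℝ → ℝ}
    (hh : ContinuousOn h K) {s : ℝ} (hs : s ∈ K) : h s ≤ sSup (h '' K) :=
  le_csSup (hK.image_of_continuousOn hh).bddAbove (mem_image_of_mem h hs)

lemma stabilityRate_nonneg (f : Fin d → ℝ → ℝ) (A : ℝ → ℝ) (K : Set ℝ) {ε : ℝ} (hε : 0 ≤ ε)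
    (Dû : ℝ → Td d → EuclideanSpace ℝ (Fin d)) : 0 ≤ stabilityRate f A K ε T Dû := by
  have h1 : ∀ α, 0 ≤ sSup ((fun z => |deriv (deriv (f α)) z|) '' K) := fun α =>
    Real.sSup_nonneg (by rintro _ ⟨z, -, rfl⟩; exact abs_nonneg _)
  have h2 : 0 ≤ sSup ((fun z => |deriv A z| ^ 2) '' K) :=
    Real.sSup_nonneg (by rintro _ ⟨z, -, rfl⟩; positivity)
  refine add_nonneg (mul_nonneg (by norm_num) (Finset.sum_nonneg fun α _ =>
    mul_nonneg (h1 α) ENNReal.toReal_nonneg)) ?_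
  positivity

lemma mixedNorm_bound_of_integral_bound {ε : ℝ} (hε : 0 < ε) {u û : ℝ → Td d → ℝ}
    {Du Dû : ℝ → Td d → EuclideanSpace ℝ (Fin d)} {G : ℝ → Td d → EuclideanSpace ℝ (Fin d)}
    {σ₁ : ℝ → Td d → ℝ} {σ₂ : ℝ → Hneg1 d} {u₀ û₀ : Td d → ℝ}
    (h : IsBalance T (fun t x => u t x - û t x) (fun t x => Du t x - Dû t x) G σ₁ σ₂
      (fun x => u₀ x - û₀ x)) {r₁ : ℝ → Td d → ℝ} (hr₁ : MemMixed 1 2 T r₁) {r₂ : ℝ → Hneg1 d}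
    (hr₂ : MemLp (fun t => ‖r₂ t‖) 2 (timeMeasure T)) {t E Y₁ Y₂ : ℝ} (ht : t ∈ Ioo 0 T)
    (hY₁ : 0 ≤ Y₁)
    (h₁ : ∀ᵐ s ∂(timeMeasure t), ∫ x, (u s x - û s x) ^ 2 ≤ Y₁)
    (h₂ : (ε * ∫ s in (0 : ℝ)..t, ∫ x, ‖Du s x - Dû s x‖ ^ 2) ≤ Y₂)
    (hY : Y₁ + Y₂ ≤ (4 * (∫ x, (u₀ x - û₀ x) ^ 2) +
      16 * (∫ s in (0 : ℝ)..t, normSlice r₁ s) ^ 2 +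
        8 * ε * ∫ s in (0 : ℝ)..t, ‖r₂ s‖ ^ 2) * E) :
    mixedNorm ∞ 2 t (fun s x => u s x - û s x) ^ 2
        + ENNReal.ofReal ε * mixedNorm 2 2 t (fun s x => Du s x - Dû s x) ^ 2
      ≤ (4 * eLpNorm (fun x => u₀ x - û₀ x) 2 volume ^ 2
          + 16 * mixedNorm 1 2 t r₁ ^ 2
          + 8 * ENNReal.ofReal ε * eLpNorm (fun t => ‖r₂ t‖) 2 (timeMeasure t) ^ 2)
        * ENNReal.ofReal E := by
  have hle := IsBalance.restrict_le ht
  have hst := stMeasure_mono (d := d) ht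
  have a1 := sq_mixedNorm_top_le hY₁ (w := fun s x => u s x - û s x)
    (ae_mono hle (h.isH1.mono fun s hs => hs.memLp)) h₁
  have a2 := sq_mixedNorm_two (V := fun s x => Du s x - Dû s x) (h.memLp_grad.mono_measure hst)
  have a3 := sq_eLpNorm_two h.initial
  have a4 := (hr₁.mono ht).integral_normSlice
  have a5 := sq_eLpNorm_two (hr₂.mono_measure hle)
  simp only [← integral_timeMeasure ht.1.le] at h₂ hY
  simp only [Real.norm_eq_abs, sq_abs] at a3
  simp only [Real.norm_eq_abs, sq_abs] at a5
  have p1 : 0 ≤ ∫ x, (u₀ x - û₀ x) ^ 2 := integral_nonneg fun x => sq_nonneg _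
  have p2 : 0 ≤ ∫ s, normSlice r₁ s ∂(timeMeasure t) := integral_nonneg fun s => normSlice_nonneg _ _
  have p3 : 0 ≤ ∫ s, ‖r₂ s‖ ^ 2 ∂(timeMeasure t) := integral_nonneg fun s => sq_nonneg _
  have p4 : 0 ≤ ∫ s, (∫ x, ‖Du s x - Dû s x‖ ^ 2) ∂(timeMeasure t) :=
    integral_nonneg fun s => integral_nonneg fun x => by positivity
  have a6 : mixedNorm 1 2 t r₁ = ENNReal.ofReal (∫ s, normSlice r₁ s ∂(timeMeasure t)) := by
    rw [a4, ENNReal.ofReal_toReal (hr₁.mono ht).2.ne]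
  rw [a2, a3, a5, a6, ← ENNReal.ofReal_mul hε.le, ← ENNReal.ofReal_pow p2]
  refine (add_le_add a1 (ENNReal.ofReal_le_ofReal h₂)).trans ?_
  have hY₂ : 0 ≤ Y₂ := (mul_nonneg hε.le p4).trans h₂
  rw [← ENNReal.ofReal_add hY₁ hY₂]
  refine (ENNReal.ofReal_le_ofReal hY).trans (le_of_eq ?_)
  rw [ENNReal.ofReal_mul (by positivity), ENNReal.ofReal_add (by positivity) (by positivity),
    ENNReal.ofReal_add (by positivity) (by positivity), ENNReal.ofReal_mul (by norm_num),
    ENNReal.ofReal_mul (by norm_num), ENNReal.ofReal_mul (by positivity),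
    ENNReal.ofReal_mul (by norm_num)]
  norm_num

end ScalarCD

open ScalarCD in
theorem mainTheorem1 {d : ℕ} (T ε : ℝ) (hT : 0 < T) (hε : 0 < ε)
    (U K : Set ℝ) (hU : IsOpen U) (hK : IsCompact K) (hKU : K ⊆ U)
    (f : Fin d → ℝ → ℝ) (hf : ∀ α, ContDiffOn ℝ 2 (f α) U)
    (A : ℝ → ℝ) (hA : ContDiffOn ℝ 2 A U) (hA1 : IsGLB (A '' K) 1)
    -- a strictly convex entropy pair
    (η : ℝ → ℝ) (q : Fin d → ℝ → ℝ) (hηq : IsEntropyPair U f η q)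
    -- the entropy weak solution
    (u₀ : Td d → ℝ) (hu₀ : MemH1 u₀)
    (u : ℝ → Td d → ℝ) (Du : ℝ → Td d → EuclideanSpace ℝ (Fin d)) (huH1 : MemL2H1 T u Du)
    (hu : IsEntropyWeakSolution U f A ε T η q u₀ u Du)
    (huK : ∀ᵐ p ∂(stMeasure d T), u p.1 p.2 ∈ K)
    -- the residual
    (r₁ : ℝ → Td d → ℝ) (hr₁ : MemMixed 1 2 T r₁)
    (r₂ : ℝ → Hneg1 d) (hr₂ : MemLp r₂ 2 (timeMeasure T))
    (hr₂0 : ∀ᵐ t ∂(timeMeasure T), r₂ t (H1.ofSmooth (fun _ => 1) (isSmooth_const 1)) = 0)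
    -- the Lipschitz continuous weak solution of the perturbed equation
    (û : ℝ → Td d → ℝ) (hûLip : IsLipschitzST T û)
    (Dû : ℝ → Td d → EuclideanSpace ℝ (Fin d))
    (hû : IsWeakSolution U f A ε T (û 0) (residual ε T r₁ r₂) û Dû)
    (hûK : ∀ᵐ p ∂(stMeasure d T), û p.1 p.2 ∈ K) :
    ∀ᵐ t ∂(MeasureTheory.volume.restrict (Set.Ioc 0 T)),
      mixedNorm ∞ 2 t (fun s x => u s x - û s x) ^ 2
        + ENNReal.ofReal ε * mixedNorm 2 2 t (fun s x => Du s x - Dû s x) ^ 2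
      ≤ (4 * MeasureTheory.eLpNorm (fun x => u₀ x - û 0 x) 2 MeasureTheory.volume ^ 2
          + 16 * mixedNorm 1 2 t r₁ ^ 2
          + 8 * ENNReal.ofReal ε * MeasureTheory.eLpNorm r₂ 2 (timeMeasure t) ^ 2)
        * ENNReal.ofReal (Real.exp (2 * stabilityRate f A K ε T Dû * t)) := by
  have hfK : ∀ α, ContinuousOn (f α) K := fun α => (hf α).continuousOn.mono hKU
  have hAK : ContinuousOn A K := hA.continuousOn.mono hKU
  have hA1' : ∀ s ∈ K, 1 ≤ A s := fun s hs => hA1.1 (mem_image_of_mem A hs)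
  have hr₂n : MemLp (fun t => ‖r₂ t‖) 2 (timeMeasure T) := memLp_norm_dual hr₂
  have hr₂m : ∀ p, AEStronglyMeasurable (fun t => r₂ t p) (timeMeasure T) :=
    fun p => aestronglyMeasurable_dual_apply hr₂ p
  have hDû : MemLp (fun p : ℝ × Td d => Dû p.1 p.2) ∞ (stMeasure d T) :=
    hûLip.memLp_top_grad hû.grad
  have hûmem : ∀ p ∈ Icc 0 T ×ˢ (univ : Set (Td d)), û p.1 p.2 ∈ K :=
    fun p hp => hûLip.mem_of_ae_mem hT hK.isClosed hûK hp
  have hû0 : MemLp (û 0) 2 := by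
    refine memLp_of_continuous ?_
    have := hûLip.continuousOn.comp_continuous (f := fun x : Td d => ((0 : ℝ), x)) (by fun_prop)
      (fun x => ⟨⟨le_rfl, hT.le⟩, mem_univ _⟩)
    exact this
  have bu : IsBalance T u Du (fun t => cdFlux f A ε (u t) (Du t)) (fun _ _ => 0) (fun _ => 0) u₀ :=
    hu.weakSolution.isBalance hK huK hfK hAK huH1.2.2 hu₀.1 memMixed_zero
      (IsBalance.const (d := d) hT 0).dual (fun _ => aestronglyMeasurable_const)
      (Filter.Eventually.of_forall fun _ => rfl) (fun θ hθ ψ hψ => by simp)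
  have bû : IsBalance T û Dû (fun t => cdFlux f A ε (û t) (Dû t)) r₁ (fun t => ε • r₂ t) (û 0) :=
    hû.isBalance hK hûK hfK hAK (hDû.mono_exponent le_top) hû0 hr₁
      (MemLp.norm_const_smul_dual hr₂n ε) (fun p => (hr₂m p).const_smul ε)
      (hr₂0.mono fun t ht => by
        have : (ε • r₂ t) (H1.ofSmooth (fun _ => 1) (isSmooth_const 1)) =
          ε * r₂ t (H1.ofSmooth (fun _ => 1) (isSmooth_const 1)) := rfl
        rw [this, ht, mul_zero])
      (fun θ hθ ψ hψ => residual_mul hr₁ hr₂n hr₂m hθ hψ)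
  have hΛ := stabilityRate_nonneg (T := T) f A K hε.le Dû
  -- It is enough to bound the supremum and the dissipation by separate real numbers with a
  -- controlled sum. The time t = T is a null set, so the open interval suffices.
  suffices hmain : ∀ᵐ t ∂(timeMeasure T), ∃ Y₁ Y₂ : ℝ, 0 ≤ Y₁ ∧
      (∀ᵐ s ∂(timeMeasure t), ∫ x, (u s x - û s x) ^ 2 ≤ Y₁) ∧
      (ε * ∫ s in (0 : ℝ)..t, ∫ x, ‖Du s x - Dû s x‖ ^ 2) ≤ Y₂ ∧
      Y₁ + Y₂ ≤ (4 * (∫ x, (u₀ x - û 0 x) ^ 2) + 16 * (∫ s in (0 : ℝ)..t, normSlice r₁ s) ^ 2 +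
        8 * ε * ∫ s in (0 : ℝ)..t, ‖r₂ s‖ ^ 2) *
          Real.exp (2 * stabilityRate f A K ε T Dû * t) by
    rw [← Measure.restrict_congr_set Ioo_ae_eq_Ioc]
    filter_upwards [hmain, ae_restrict_mem measurableSet_Ioo] with t ht htm
    obtain ⟨Y₁, Y₂, h0, h1, h2, h3⟩ := ht
    have := mixedNorm_bound_of_integral_bound hε (bu.sub bû) hr₁ hr₂n htm h0 h1 h2 h3
    rwa [← eLpNorm_dual r₂] at this
  -- S is connected and contained in K, so the single value û 0 0 decides on which side of any c ∉ K
  -- all of û lies.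
  set S := (fun p : ℝ × Td d => û p.1 p.2) '' (Icc 0 T ×ˢ univ)
  have hSK : S ⊆ K := image_subset_iff.2 hûmem
  have hS := hûLip.isPreconnected_image
  have hx₀ : û 0 0 ∈ S := ⟨(0, 0), ⟨⟨le_rfl, hT.le⟩, mem_univ _⟩, rfl⟩
  have hSt : ∀ x, û 0 x ∈ S := fun x => ⟨(0, x), ⟨⟨le_rfl, hT.le⟩, mem_univ _⟩, rfl⟩
  have hside : ∀ c ∉ K, (∀ᵐ p ∂(stMeasure d T), u p.1 p.2 < c) ∨
      ∀ᵐ p ∂(stMeasure d T), c < u p.1 p.2 := fun c hc =>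
    (bu.lt_or_gt hT (fun _ _ => rfl) (fun _ => rfl) hK.isClosed huK hc).imp
      (ae_prod_of_ae_ae bu.memLp.1 measurableSet_Iio)
      (ae_prod_of_ae_ae bu.memLp.1 measurableSet_Ioi)
  -- Either some c ∉ K has u and û on opposite sides, or u is on the same side as û of every such c.
  by_cases hsep : ∃ c ∉ K, ((∀ᵐ p ∂(stMeasure d T), u p.1 p.2 < c) ∧ c < û 0 0) ∨
      ((∀ᵐ p ∂(stMeasure d T), c < u p.1 p.2) ∧ û 0 0 < c)
  · obtain ⟨c, hcK, hc⟩ := hsep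
    refine stability_of_separated hT hε hK hfK hAK hA1' bu bû huK hûK (c := c) ?_ hΛ
    have hcS : c ∉ S := fun h => hcK (hSK h)
    rcases hc with ⟨hc1, hc2⟩ | ⟨hc1, hc2⟩
    · have h1 := ((IsBalance.const hT c).sub bu).initial_nonneg hT
        (hc1.mono fun p hp => (sub_pos.2 hp).le)
      filter_upwards [h1] with x hx
      -- Otherwise S, being an interval, would contain c. The sides of u₀ and û(0) then give the
      -- sign condition of the separated case.
      have : c < û 0 x := by
        by_contra! hle
        exact hcS (hS.ordConnected.out (hSt x) hx₀ ⟨hle, hc2.le⟩)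
      nlinarith
    · have h1 := (bu.sub (IsBalance.const hT c)).initial_nonneg hT
        (hc1.mono fun p hp => (sub_pos.2 hp).le)
      filter_upwards [h1] with x hx
      have : û 0 x < c := by
        by_contra! hle
        exact hcS (hS.ordConnected.out hx₀ (hSt x) ⟨hc2.le, hle⟩)
      nlinarith
  · push Not at hsep
    obtain ⟨a, b, habK, hSab, hrat⟩ := exists_Icc_component hK (hSK hx₀)
    have habU := habK.trans hKU
    have hûI : ∀ᵐ p ∂(stMeasure d T), û p.1 p.2 ∈ Icc a b := by
      filter_upwards [ae_fst_mem_Ioo T] with p hp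
      exact hSab S hSK hS hx₀ ⟨p, ⟨Ioo_subset_Icc_self hp, mem_univ _⟩, rfl⟩
    -- Restricting to rational c keeps the union of the exceptional null sets null.
    have hall : ∀ᵐ p ∂(stMeasure d T), ∀ c : ℚ, (c : ℝ) ∉ K →
        (c < û 0 0 → c < u p.1 p.2) ∧ (û 0 0 < c → u p.1 p.2 < c) := by
      refine ae_all_iff.2 fun c => ?_
      by_cases hc : (c : ℝ) ∈ K
      · exact Filter.Eventually.of_forall fun p h => absurd hc h
      · rcases hside c hc with h | h
        · filter_upwards [h] with p hp _
          exact ⟨fun h' => absurd h' ((hsep c hc).1 h).not_gt, fun _ => hp⟩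
        · filter_upwards [h] with p hp _
          exact ⟨fun _ => hp, fun h' => absurd h' ((hsep c hc).2 h).not_gt⟩
    -- A value of u in K but outside the component of û 0 0 would have a rational gap point between
    -- it and û 0 0, contrary to `hall`.
    have huI : ∀ᵐ p ∂(stMeasure d T), u p.1 p.2 ∈ Icc a b := by
      filter_upwards [hall, huK] with p hp hpK
      by_contra hnot
      obtain ⟨c, hcK, hc⟩ := hrat _ hpK hnot
      rcases hc with hc | hc
      · exact absurd hc.2 ((hp c hcK).2 hc.1).not_gt
      · exact absurd hc.1 ((hp c hcK).1 hc.2).not_gt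
    refine stability_of_interval hT hε (f' := fun α => deriv (f α))
      (f'' := fun α => deriv (deriv (f α))) (A' := deriv A)
      (S := fun α => sSup ((fun z => |deriv (deriv (f α)) z|) '' K))
      (L := fun α => supNorm T (fun t x => Dû t x α))
      (Q := sSup ((fun z => |deriv A z| ^ 2) '' K)) (N := supNorm T Dû)
      (fun α s hs => hasDerivAt_of_contDiffOn hU (hf α) (habU hs))
      (fun α s hs => hasDerivAt_deriv_of_contDiffOn hU (hf α) (habU hs))
      (fun α s hs => le_sSup_image_of_continuousOn hK
        ((continuousOn_deriv_deriv hU (hf α)).mono hKU).abs (habK hs))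
      (fun s hs => hasDerivAt_of_contDiffOn hU hA (habU hs)) (fun s hs => hA1' s (habK hs))
      (fun s hs => le_sSup_image_of_continuousOn hK
        (((contDiffOn_deriv hU hA).continuousOn.mono hKU).abs.pow 2) (habK hs))
      bu bû huI hûI ?_ (ae_norm_le_supNorm hDû) hΛ ?_
    · exact ae_all_iff.2 fun α => ae_norm_le_supNorm (v := fun t x => Dû t x α)
        (memLp_st_coord hDû α)
    · rw [stabilityRate]; ring
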